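/- Let $\Omega\subset\mathbb R^3$ be a bounded domain with smooth boundary and $\Gamma\subset\partial\Omega$ a nonempty relatively open part of its boundary. Let $d\in C^2(\overline\Omega)$ satisfy $d>0$ in $\Omega$, $|\nabla d|>0$ on $\overline\Omega$ and $d=0$ on $\partial\Omega\setminus\Gamma$. For $\lambda\in\mathbb R$ put $\varphi_0:=e^{\lambda d}$. Let $A=(A_{kj})$ be a $3\times3$ matrix field with $A\in W^{1,\infty}(\Omega)$ and $b=(b_1,b_2,b_3)^T$ a vector field with $b\in W^{2,\infty}(\Omega)$, both identified with their continuous representatives on $\overline\Omega$, and assume $$\det A(x)\neq 0\quad\text{and}\quad |\nabla d(x)\times b(x)|\neq 0\qquad\text{for all }x\in\overline\Omega .$$ For scalar functions $f,g$ on $\Omega$ set $Pf:=\mathrm{div}(fA)$, that is $[Pf]_k=\sum_{j=1}^3\partial_j(fA_{kj})$, and $Qg:=\mathrm{rot}(gb)$, with derivatives taken in the weak sense. Then there exist constants $\lambda_0\ge1$, $s_0\ge1$ and $C>0$ (depending only on $\Omega,\Gamma,d,A,b$) such that for all $\lambda\ge\lambda_0$ and $s\ge s_0$: (i) for every $f\in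 H^1(\Omega)$, $$\int_\Omega\big(|\nabla f|^2+s^2\lambda^2\varphi_0^2|f|^2\big)e^{2s\varphi_0}\,dx\le C\int_\Omega|Pf|^2e^{2s\varphi_0}\,dx+C\int_\Gamma s\lambda\varphi_0|f|^2e^{2s\varphi_0}\,d\sigma ;$$ (ii) for every $g\in H^2(\Omega)$, $$\int_\Omega\big(|\nabla g|^2+s^2\lambda^2\varphi_0^2|g|^2\big)e^{2s\varphi_0}\,dx\le C\int_\Omega\Big(\frac1{s^2\lambda^2\varphi_0^2}|\nabla(Qg)|^2+|Qg|^2\Big)e^{2s\varphi_0}\,dx+C\int_{\partial\Omega}\Big(\frac1{s\lambda\varphi_0}|\nabla g|^2+s\lambda\varphi_0|g|^2\Big)e^{2s\varphi_0}\,d\sigma .$$ Here $d\sigma$ is surface measure on $\partial\Omega$, and the boundary values of $f$, $g$ and $\nabla g$ are taken in the sense of traces. -/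

import Mathlib

open MeasureTheory Filter Topology
open scoped ContDiff Matrix ENNReal

noncomputable section

namespace Carleman

/-- Euclidean three-space. -/
abbrev E3 : Type := EuclideanSpace ℝ (Fin 3)

/-- The `k`-th standard basis vector of `ℝ³`. -/
def basisVec (k : Fin 3) : E3 := EuclideanSpace.single k 1

/-- `Ω` has a smooth boundary: near every boundary point, after a rigid change of coordinates,
`Ω` is the region lying strictly above the graph of a smooth function of two variables. -/
def HasSmoothBoundary (Ω : Set E3) : Prop :=
  ∀ x₀ ∈ frontier Ω, ∃ (e : E3 ≃ₗᵢ[ℝ] E3) (γ : ℝ × ℝ → ℝ) (r : ℝ),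
    0 < r ∧ ContDiff ℝ ∞ γ ∧
      ∀ x ∈ Metric.ball x₀ r, (x ∈ Ω ↔ γ (e x 0, e x 1) < e x 2)

/-- A bounded domain (nonempty, open, connected) of `ℝ³` with smooth boundary. -/
structure IsSmoothBoundedDomain (Ω : Set E3) : Prop where
  isOpen : IsOpen Ω
  isConnected : IsConnected Ω
  isBounded : Bornology.IsBounded Ω
  smoothBoundary : HasSmoothBoundary Ω

/-- Surface measure `dσ`: the two-dimensional Hausdorff measure. Mathlib's `μH[2]` is built from
`diam ^ 2`, so the factor `π / 4` makes it agree with area on planes and smooth surfaces. -/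
def surfaceMeasure : Measure E3 :=
  ENNReal.ofReal (Real.pi / 4) • Measure.hausdorffMeasure 2

/-- `v` is a weak partial derivative `∂ₖ u` in the open set `Ω`, tested against `C_c^∞(Ω)`. -/
structure HasWeakPartial (Ω : Set E3) (k : Fin 3) (u v : E3 → ℝ) : Prop where
  locallyIntegrableOn : LocallyIntegrableOn u Ω
  locallyIntegrableOn_deriv : LocallyIntegrableOn v Ω
  integral_eq : ∀ φ : E3 → ℝ, ContDiff ℝ ∞ φ → HasCompactSupport φ → tsupport φ ⊆ Ω →
    ∫ x in Ω, u x * fderiv ℝ φ x (basisVec k) = - ∫ x in Ω, v x * φ x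

open Classical in
/-- The weak partial derivative `∂ₖ u` in `Ω` (unique up to a null subset of `Ω` where it exists;
zero if it does not exist). -/
def weakPartial (Ω : Set E3) (k : Fin 3) (u : E3 → ℝ) : E3 → ℝ :=
  if h : ∃ v, HasWeakPartial Ω k u v then h.choose else 0

/-- The Sobolev space `W^{m,p}(Ω)`: all weak derivatives of order at most `m` lie in `L^p(Ω)`.
`H^m(Ω)` is the case `p = 2`. -/
def MemSobolev (Ω : Set E3) (p : ℝ≥0∞) : ℕ → (E3 → ℝ) → Prop
  | 0, u => MemLp u p (volume.restrict Ω)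
  | m + 1, u => MemLp u p (volume.restrict Ω) ∧
      ∀ k : Fin 3, ∃ v, HasWeakPartial Ω k u v ∧ MemSobolev Ω p m v

/-- `τ` is the boundary trace in `L²(∂Ω)` of `u ∈ H¹(Ω)`: it is the `L²(∂Ω)`-limit of the boundary
values of smooth functions that converge to `u` in `H¹(Ω)`. -/
def IsTrace (Ω : Set E3) (u τ : E3 → ℝ) : Prop :=
  MemLp τ 2 (surfaceMeasure.restrict (frontier Ω)) ∧
  ∃ φ : ℕ → E3 → ℝ, (∀ n, ContDiff ℝ ∞ (φ n)) ∧
    Tendsto (fun n => eLpNorm (fun x => φ n x - u x) 2 (volume.restrict Ω)) atTop (𝓝 0) ∧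
    (∀ k : Fin 3, Tendsto (fun n => eLpNorm
      (fun x => fderiv ℝ (φ n) x (basisVec k) - weakPartial Ω k u x) 2 (volume.restrict Ω))
      atTop (𝓝 0)) ∧
    Tendsto (fun n => eLpNorm (fun x => φ n x - τ x) 2
      (surfaceMeasure.restrict (frontier Ω))) atTop (𝓝 0)

open Classical in
/-- The boundary trace of `u` (unique up to a `σ`-null subset of `∂Ω`; it exists for every
`u ∈ H¹(Ω)` when `Ω` is a smooth bounded domain, and is set to zero where it does not exist). -/
def trace (Ω : Set E3) (u : E3 → ℝ) : E3 → ℝ :=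
  if h : ∃ τ, IsTrace Ω u τ then h.choose else 0

/-- Square of the Euclidean length of a vector. -/
def normSq (v : Fin 3 → ℝ) : ℝ := ∑ i, v i ^ 2

/-- The weak gradient `∇u` in `Ω`. -/
def weakGrad (Ω : Set E3) (u : E3 → ℝ) (x : E3) : Fin 3 → ℝ :=
  fun k => weakPartial Ω k u x

/-- The boundary trace of the weak gradient, taken componentwise. -/
def traceGrad (Ω : Set E3) (u : E3 → ℝ) (x : E3) : Fin 3 → ℝ :=
  fun k => trace Ω (weakPartial Ω k u) x

/-- The row-wise divergence of a matrix field, `[div M]ₖ = ∑ⱼ ∂ⱼ Mₖⱼ`, in the weak sense. -/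
def matDiv (Ω : Set E3) (M : E3 → Matrix (Fin 3) (Fin 3) ℝ) (x : E3) : Fin 3 → ℝ :=
  fun k => ∑ j, weakPartial Ω j (fun y => M y k j) x

/-- The rotation (curl) of a vector field, in the weak sense. -/
def rot (Ω : Set E3) (v : E3 → Fin 3 → ℝ) (x : E3) : Fin 3 → ℝ :=
  ![weakPartial Ω 1 (fun y => v y 2) x - weakPartial Ω 2 (fun y => v y 1) x,
    weakPartial Ω 2 (fun y => v y 0) x - weakPartial Ω 0 (fun y => v y 2) x,
    weakPartial Ω 0 (fun y => v y 1) x - weakPartial Ω 1 (fun y => v y 0) x]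

/-- The operator `P f = div (f A)`. -/
def opP (Ω : Set E3) (A : E3 → Matrix (Fin 3) (Fin 3) ℝ) (f : E3 → ℝ) : E3 → Fin 3 → ℝ :=
  matDiv Ω (fun y => f y • A y)

/-- The operator `Q g = rot (g b)`. -/
def opQ (Ω : Set E3) (b : E3 → Fin 3 → ℝ) (g : E3 → ℝ) : E3 → Fin 3 → ℝ :=
  rot Ω (fun y => g y • b y)

/-- The classical gradient, up to the boundary, of a `C¹` function on `closure Ω`. -/
def closureGrad (Ω : Set E3) (d : E3 → ℝ) (x : E3) : Fin 3 → ℝ :=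
  fun k => fderivWithin ℝ d (closure Ω) x (basisVec k)

/-- `Γ` is a nonempty relatively open part of `∂Ω`. -/
def IsSubBoundary (Ω Γ : Set E3) : Prop :=
  Γ.Nonempty ∧ ∃ U : Set E3, IsOpen U ∧ Γ = frontier Ω ∩ U

/-- The conditions on `d`: `d ∈ C²(closure Ω)`, `d > 0` in `Ω`, `|∇d| > 0` on `closure Ω` and
`d = 0` on `∂Ω \ Γ`. -/
structure IsWeightFunction (Ω Γ : Set E3) (d : E3 → ℝ) : Prop where
  contDiffOn : ContDiffOn ℝ 2 d (closure Ω)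
  pos : ∀ x ∈ Ω, 0 < d x
  grad_pos : ∀ x ∈ closure Ω, 0 < normSq (closureGrad Ω d x)
  eq_zero : ∀ x ∈ frontier Ω \ Γ, d x = 0

/-- The weight `φ₀ = e^{λ d}`. -/
def phi0 (d : E3 → ℝ) (lam : ℝ) (x : E3) : ℝ := Real.exp (lam * d x)

end Carleman

end

/-!
The estimates for `P` and `Q` both reduce to a Carleman estimate for a transport operator `X·∇`.

**Transport operators** (`exists_carleman_smooth`, `exists_carleman`). Let `X` be a continuous
field in `W^{1,∞}` with `X·∇d ≥ c₀ > 0`, and let `W > 0` grow fast, in the sense that `W' ≥ m₀ W` with `m₀`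
large. Integrating `div (W(d) φ² X)` over `Ω` gives the term `W'(d) (X·∇d) φ²`, which dominates the
term with `div X`, and a mixed term `2 W(d) φ (X·∇φ)`, to which Young's inequality applies. Hence
`∫ W'(d) φ²` is bounded by `∫ W(d)² / W'(d) (X·∇φ)²` plus a boundary integral. The boundary terms
have the good sign where `X` points into `Ω`, so only the part `S` of the boundary outside of which
`X` points inwards appears. This is `exists_div_bound`, an inequality form of the divergence theorem
that is proved chart by chart: in a chart a cut-off in the height variable turns the weak derivatives
into interior integrals, and in the limit thin layers above the boundary graph give the flux
(`BoundaryChart.chart_identity`). Up to constants, surface measure and the area of the horizontal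
projection agree on the graph. The estimate passes from smooth functions to `H¹` because smooth
functions are dense in `H¹` (`smoothlyApproximable`, by mollification with kernels shifted into a cone)
and traces are `L²` limits (`exists_trace_bound`).

With `W(t) = exp (q λ t + 2 s e^{λ t})` one has `W'(d) ∼ s λ φ₀ W(d)`; the choices `q = 1` and `q = -1`
give `exists_carleman_pair`.

**The operator `P`.** Take `X = ∇d` and `S = Γ`: where `d` vanishes on the boundary it attains its
minimum, so `∇d` points inwards there (`closureGrad_inner_nonneg`). Since `Pf = A ∇f + f div A` with
`A` invertible, `|∇f|² ≤ K (|Pf|² + f²)`, and the `f²` term is absorbed for large `λ`.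

**The operator `Q`.** Here `Qg = ∇g × b + g rot b` sees only the part of `∇g` orthogonal to `b`. Put
`X = b × (∇d × b)` and `S = ∂Ω`. Then `X·∇d = |∇d × b|² > 0`, and `X·v = (∇d × b)·(v × b)` for every
vector `v`, so `X·∇g` is controlled by `Qg` and, as second weak derivatives commute, `X·∇(∂ₗ g)` is
controlled by `∂ₗ(Qg)`, up to terms of lower order. The estimate with `q = 1` is applied to `g`, the one
with `q = -1` to each `∂ₗ g`, and the lower order terms are again absorbed for large `λ`.
-/

noncomputable section

namespace Carleman

/-! ### Weak partial derivatives -/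

/-- The classical partial derivative `∂ₖ φ`. -/
abbrev pderiv (k : Fin 3) (φ : E3 → ℝ) (x : E3) : ℝ := fderiv ℝ φ x (basisVec k)

lemma continuous_pderiv {φ : E3 → ℝ} (hφ : ContDiff ℝ ∞ φ) (k : Fin 3) :
    Continuous (pderiv k φ) :=
  (hφ.continuous_fderiv (by simp)).clm_apply continuous_const

lemma contDiff_pderiv {φ : E3 → ℝ} (hφ : ContDiff ℝ ∞ φ) (k : Fin 3) :
    ContDiff ℝ ∞ (pderiv k φ) :=
  (hφ.fderiv_right (m := ∞) (by simp)).clm_apply contDiff_const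

lemma hasCompactSupport_pderiv {φ : E3 → ℝ} (hφ : HasCompactSupport φ) (k : Fin 3) :
    HasCompactSupport (pderiv k φ) := by
  have := hφ.fderiv (𝕜 := ℝ)
  exact this.comp_left (g := fun L : E3 →L[ℝ] ℝ => L (basisVec k)) (by simp)

lemma tsupport_pderiv_subset (φ : E3 → ℝ) (k : Fin 3) :
    tsupport (pderiv k φ) ⊆ tsupport φ :=
  (closure_mono (Function.support_comp_subset (g := fun L : E3 →L[ℝ] ℝ => L (basisVec k))
    (by simp) (fderiv ℝ φ))).trans (tsupport_fderiv_subset ℝ)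

lemma pderiv_mul {φ ψ : E3 → ℝ} {x : E3} (hφ : DifferentiableAt ℝ φ x)
    (hψ : DifferentiableAt ℝ ψ x) (k : Fin 3) :
    pderiv k (fun y => φ y * ψ y) x = pderiv k φ x * ψ x + φ x * pderiv k ψ x := by
  simp only [pderiv]
  rw [fderiv_fun_mul hφ hψ]
  simp; ring

/-- A locally integrable function on `Ω` times a continuous function with compact support in `Ω`
is integrable. -/
lemma integrableOn_mul_of_tsupport {Ω : Set E3} {u ψ : E3 → ℝ} (hu : LocallyIntegrableOn u Ω)
    (hψ : Continuous ψ) (hc : HasCompactSupport ψ) (hs : tsupport ψ ⊆ Ω) :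
    IntegrableOn (fun x => u x * ψ x) Ω := by
  have h1 : IntegrableOn u (tsupport ψ) := hu.integrableOn_compact_subset hs hc
  have h2 : IntegrableOn (fun x => u x * ψ x) (tsupport ψ) :=
    h1.mul_continuousOn hψ.continuousOn hc
  refine Integrable.integrableOn ?_
  rw [← integrableOn_iff_integrable_of_support_subset (s := tsupport ψ)]
  · exact h2
  · intro x hx
    exact subset_tsupport ψ (right_ne_zero_of_mul hx)

namespace HasWeakPartial

variable {Ω : Set E3} {k : Fin 3} {u u' v v' : E3 → ℝ}

lemma integrable_mul_pderiv (h : HasWeakPartial Ω k u v) {φ : E3 → ℝ} (hφ : ContDiff ℝ ∞ φ)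
    (hc : HasCompactSupport φ) (hs : tsupport φ ⊆ Ω) (j : Fin 3) :
    IntegrableOn (fun x => u x * pderiv j φ x) Ω :=
  integrableOn_mul_of_tsupport h.locallyIntegrableOn (continuous_pderiv hφ j)
    (hasCompactSupport_pderiv hc j) ((tsupport_pderiv_subset φ j).trans hs)

lemma integrable_mul (h : HasWeakPartial Ω k u v) {φ : E3 → ℝ} (hφ : ContDiff ℝ ∞ φ)
    (hc : HasCompactSupport φ) (hs : tsupport φ ⊆ Ω) :
    IntegrableOn (fun x => v x * φ x) Ω :=
  integrableOn_mul_of_tsupport h.locallyIntegrableOn_deriv hφ.continuous hc hs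

lemma unique (hΩ : IsOpen Ω) (h : HasWeakPartial Ω k u v) (h' : HasWeakPartial Ω k u v') :
    v =ᵐ[volume.restrict Ω] v' := by
  have key := hΩ.ae_eq_zero_of_integral_contDiff_smul_eq_zero (μ := volume)
    (f := fun x => v x - v' x) (h.locallyIntegrableOn_deriv.sub h'.locallyIntegrableOn_deriv)
    (fun φ hφ hc hs => by
      have e1 := h.integral_eq φ hφ hc hs
      have e2 := h'.integral_eq φ hφ hc hs
      have e3 : ∫ x in Ω, (v x * φ x - v' x * φ x) = 0 := by
        rw [integral_sub (h.integrable_mul hφ hc hs) (h'.integrable_mul hφ hc hs)]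
        linarith
      rw [setIntegral_eq_integral_of_forall_compl_eq_zero] at e3
      · rw [← e3]; congr 1; ext x; simp; ring
      · intro x hx
        have : φ x = 0 := image_eq_zero_of_notMem_tsupport (fun hx' => hx (hs hx'))
        simp [this])
  rw [EventuallyEq, ae_restrict_iff' hΩ.measurableSet]
  filter_upwards [key] with x hx hxΩ
  linarith [hx hxΩ]

lemma congr (hΩ : IsOpen Ω) (h : HasWeakPartial Ω k u v) (hu : u =ᵐ[volume.restrict Ω] u')
    (hv : v =ᵐ[volume.restrict Ω] v') : HasWeakPartial Ω k u' v' where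
  locallyIntegrableOn := by
    rw [locallyIntegrableOn_iff hΩ.isLocallyClosed]
    intro K hK hKc
    exact (h.locallyIntegrableOn.integrableOn_compact_subset hK hKc).congr
      (ae_mono (Measure.restrict_mono hK le_rfl) hu)
  locallyIntegrableOn_deriv := by
    rw [locallyIntegrableOn_iff hΩ.isLocallyClosed]
    intro K hK hKc
    exact (h.locallyIntegrableOn_deriv.integrableOn_compact_subset hK hKc).congr
      (ae_mono (Measure.restrict_mono hK le_rfl) hv)
  integral_eq φ hφ hc hs := by
    have e1 : ∫ x in Ω, u' x * fderiv ℝ φ x (basisVec k)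
        = ∫ x in Ω, u x * fderiv ℝ φ x (basisVec k) :=
      integral_congr_ae (by filter_upwards [hu] with x hx; rw [hx])
    have e2 : ∫ x in Ω, v' x * φ x = ∫ x in Ω, v x * φ x :=
      integral_congr_ae (by filter_upwards [hv] with x hx; rw [hx])
    rw [e1, e2, h.integral_eq φ hφ hc hs]

lemma weakPartial_self (h : HasWeakPartial Ω k u v) :
    HasWeakPartial Ω k u (weakPartial Ω k u) := by
  have h' : ∃ v, HasWeakPartial Ω k u v := ⟨v, h⟩
  rw [weakPartial, dif_pos h']
  exact h'.choose_spec

lemma weakPartial_ae_eq (hΩ : IsOpen Ω) (h : HasWeakPartial Ω k u v) :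
    weakPartial Ω k u =ᵐ[volume.restrict Ω] v :=
  unique hΩ h.weakPartial_self h

lemma add (h : HasWeakPartial Ω k u v) (h' : HasWeakPartial Ω k u' v') :
    HasWeakPartial Ω k (fun x => u x + u' x) (fun x => v x + v' x) where
  locallyIntegrableOn := h.locallyIntegrableOn.add h'.locallyIntegrableOn
  locallyIntegrableOn_deriv := h.locallyIntegrableOn_deriv.add h'.locallyIntegrableOn_deriv
  integral_eq φ hφ hc hs := by
    have e1 := h.integral_eq φ hφ hc hs
    have e2 := h'.integral_eq φ hφ hc hs
    simp only [add_mul]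
    rw [integral_add (h.integrable_mul_pderiv hφ hc hs k) (h'.integrable_mul_pderiv hφ hc hs k),
      integral_add (h.integrable_mul hφ hc hs) (h'.integrable_mul hφ hc hs), e1, e2]
    ring

lemma const_mul (h : HasWeakPartial Ω k u v) (c : ℝ) :
    HasWeakPartial Ω k (fun x => c * u x) (fun x => c * v x) where
  locallyIntegrableOn := h.locallyIntegrableOn.smul c
  locallyIntegrableOn_deriv := h.locallyIntegrableOn_deriv.smul c
  integral_eq φ hφ hc hs := by
    simp only [mul_assoc]
    rw [integral_const_mul, integral_const_mul, h.integral_eq φ hφ hc hs]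
    ring

lemma sub (h : HasWeakPartial Ω k u v) (h' : HasWeakPartial Ω k u' v') :
    HasWeakPartial Ω k (fun x => u x - u' x) (fun x => v x - v' x) := by
  have := h.add (h'.const_mul (-1))
  simpa [sub_eq_add_neg] using this

/-- Integration by parts: on `Ω`, a `C¹` function has its classical partial derivatives as weak
ones. -/
lemma of_contDiffOn (hΩ : IsOpen Ω) (hu : ContDiffOn ℝ 1 u Ω) (k : Fin 3) :
    HasWeakPartial Ω k u (pderiv k u) := by
  have hcd : ContinuousOn (pderiv k u) Ω :=
    (hu.continuousOn_fderiv_of_isOpen hΩ le_rfl).clm_apply continuousOn_const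
  have l1 := hu.continuousOn.locallyIntegrableOn (μ := volume) hΩ.measurableSet
  have l2 := hcd.locallyIntegrableOn (μ := volume) hΩ.measurableSet
  refine ⟨l1, l2, fun φ hφ hc hs => ?_⟩
  have hz : ∀ x ∉ Ω, φ x = 0 := fun x hx =>
    image_eq_zero_of_notMem_tsupport (fun hx' => hx (hs hx'))
  have hz' : ∀ x ∉ Ω, pderiv k φ x = 0 := fun x hx =>
    image_eq_zero_of_notMem_tsupport (fun hx' => hx (hs (tsupport_pderiv_subset φ k hx')))
  have i1 := integrableOn_mul_of_tsupport l1 (continuous_pderiv hφ k)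
    (hasCompactSupport_pderiv hc k) ((tsupport_pderiv_subset φ k).trans hs)
  have i2 := integrableOn_mul_of_tsupport l2 hφ.continuous hc hs
  have i0 := integrableOn_mul_of_tsupport l1 hφ.continuous hc hs
  rw [setIntegral_eq_integral_of_forall_compl_eq_zero (fun x hx => by
      change u x * pderiv k φ x = 0; rw [hz' x hx, mul_zero]),
    setIntegral_eq_integral_of_forall_compl_eq_zero (fun x hx => by rw [hz x hx, mul_zero])]
  refine integral_mul_fderiv_eq_neg_fderiv_mul_of_integrable ?_ ?_ ?_ ?_ ?_
  · exact (integrableOn_iff_integrable_of_support_subset (fun x hx => by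
      by_contra h; exact hx (by simp [hz x h]))).1 i2
  · exact (integrableOn_iff_integrable_of_support_subset (fun x hx => by
      by_contra h; exact hx (by change u x * pderiv k φ x = 0; rw [hz' x h, mul_zero]))).1 i1
  · exact (integrableOn_iff_integrable_of_support_subset (fun x hx => by
      by_contra h; exact hx (by simp [hz x h]))).1 i0
  · intro x hx
    exact (hu.differentiableOn one_ne_zero).differentiableAt (hΩ.mem_nhds (hs hx))
  · intro x _
    exact hφ.differentiable (by simp) x

/-- Leibniz rule with a smooth factor. -/
lemma smooth_mul (hΩ : IsOpen Ω) (h : HasWeakPartial Ω k u v) {φ : E3 → ℝ}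
    (hφ : ContDiff ℝ ∞ φ) :
    HasWeakPartial Ω k (fun x => φ x * u x) (fun x => pderiv k φ x * u x + φ x * v x) where
  locallyIntegrableOn := h.locallyIntegrableOn.continuousOn_mul hφ.continuous.continuousOn
    hΩ.isLocallyClosed
  locallyIntegrableOn_deriv :=
    (h.locallyIntegrableOn.continuousOn_mul (continuous_pderiv hφ k).continuousOn
      hΩ.isLocallyClosed).add
    (h.locallyIntegrableOn_deriv.continuousOn_mul hφ.continuous.continuousOn hΩ.isLocallyClosed)
  integral_eq ψ hψ hc hs := by
    have hc' : HasCompactSupport (fun x => φ x * ψ x) := hc.mul_left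
    have hs' : tsupport (fun x => φ x * ψ x) ⊆ Ω :=
      (closure_mono (fun x hx => right_ne_zero_of_mul hx)).trans hs
    have e := h.integral_eq _ (hφ.mul hψ) hc' hs'
    have i1 := h.integrable_mul_pderiv (hφ.mul hψ) hc' hs' k
    have i2 := h.integrable_mul (hφ.mul hψ) hc' hs'
    have i3 : IntegrableOn (fun x => u x * (pderiv k φ x * ψ x)) Ω :=
      integrableOn_mul_of_tsupport h.locallyIntegrableOn
        ((continuous_pderiv hφ k).mul hψ.continuous) hc.mul_left
        ((closure_mono (fun x hx => right_ne_zero_of_mul hx)).trans hs)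
    have hpd : ∀ x, pderiv k (fun x => φ x * ψ x) x
        = pderiv k φ x * ψ x + φ x * pderiv k ψ x := fun x =>
      pderiv_mul (hφ.differentiable (by simp) x) (hψ.differentiable (by simp) x) k
    calc ∫ x in Ω, φ x * u x * fderiv ℝ ψ x (basisVec k)
        = ∫ x in Ω, (u x * pderiv k (fun x => φ x * ψ x) x - u x * (pderiv k φ x * ψ x)) := by
          congr 1; ext x; rw [hpd]; simp only [pderiv]; ring
      _ = - ∫ x in Ω, (v x * (φ x * ψ x) + u x * (pderiv k φ x * ψ x)) := by
          rw [integral_sub i1 i3, integral_add i2 i3, e]; ring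
      _ = _ := by congr 2; ext x; ring

end HasWeakPartial

/-! ### Convergence and mollification in `L²` -/

lemma tendsto_integral_mul_of_tendsto_L2 {α : Type*} [MeasurableSpace α] {μ : Measure α}
    {u : α → ℝ} {un : ℕ → α → ℝ} {w : α → ℝ} (hu : MemLp u 2 μ) (hun : ∀ n, MemLp (un n) 2 μ)
    (hw : MemLp w 2 μ) (h : Tendsto (fun n => eLpNorm (fun x => un n x - u x) 2 μ) atTop (𝓝 0)) :
    Tendsto (fun n => ∫ x, un n x * w x ∂μ) atTop (𝓝 (∫ x, u x * w x ∂μ)) := by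
  refine tendsto_integral_of_L1' _ (hu.1.mul hw.1)
    (Eventually.of_forall fun n => (hun n).integrable_mul hw) ?_
  have hb : Tendsto (fun n => eLpNorm (fun x => un n x - u x) 2 μ * eLpNorm w 2 μ) atTop (𝓝 0) := by
    have := ENNReal.Tendsto.mul_const h (Or.inr hw.2.ne)
    simpa using this
  refine tendsto_of_tendsto_of_tendsto_of_le_of_le tendsto_const_nhds hb (fun n => zero_le) ?_
  intro n
  have : ((fun x => un n x * w x) - u * w) = (fun x => un n x - u x) • w := by
    ext x; simp; ring
  simp only
  rw [this]
  exact eLpNorm_smul_le_mul_eLpNorm hw.1 ((hun n).sub hu).1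

lemma memLp_restrict_of_continuous_hasCompactSupport {Ω : Set E3} {φ : E3 → ℝ} {p : ℝ≥0∞}
    (hφ : Continuous φ) (hc : HasCompactSupport φ) : MemLp φ p (volume.restrict Ω) :=
  (hφ.memLp_of_hasCompactSupport (μ := volume) hc).restrict Ω

lemma memLp_locallyIntegrableOn {Ω : Set E3} [IsFiniteMeasure (volume.restrict Ω)] {u : E3 → ℝ}
    {p : ℝ≥0∞} (hp : 1 ≤ p) (hu : MemLp u p (volume.restrict Ω)) : LocallyIntegrableOn u Ω :=
  IntegrableOn.locallyIntegrableOn (hu.integrable hp)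

/-- Weak derivatives are closed under `L²` limits. -/
lemma HasWeakPartial.of_tendsto_L2 {Ω : Set E3} [IsFiniteMeasure (volume.restrict Ω)]
    {k : Fin 3} {u v : E3 → ℝ} {un vn : ℕ → E3 → ℝ}
    (h : ∀ n, HasWeakPartial Ω k (un n) (vn n))
    (hun : ∀ n, MemLp (un n) 2 (volume.restrict Ω)) (hvn : ∀ n, MemLp (vn n) 2 (volume.restrict Ω))
    (hu : MemLp u 2 (volume.restrict Ω)) (hv : MemLp v 2 (volume.restrict Ω))
    (hut : Tendsto (fun n => eLpNorm (fun x => un n x - u x) 2 (volume.restrict Ω)) atTop (𝓝 0))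
    (hvt : Tendsto (fun n => eLpNorm (fun x => vn n x - v x) 2 (volume.restrict Ω)) atTop (𝓝 0)) :
    HasWeakPartial Ω k u v where
  locallyIntegrableOn := memLp_locallyIntegrableOn (by norm_num) hu
  locallyIntegrableOn_deriv := memLp_locallyIntegrableOn (by norm_num) hv
  integral_eq φ hφ hc hs := by
    have t1 := tendsto_integral_mul_of_tendsto_L2 hu hun
      (memLp_restrict_of_continuous_hasCompactSupport (continuous_pderiv hφ k)
        (hasCompactSupport_pderiv hc k)) hut
    have t2 := tendsto_integral_mul_of_tendsto_L2 hv hvn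
      (memLp_restrict_of_continuous_hasCompactSupport hφ.continuous hc) hvt
    refine tendsto_nhds_unique t1 ?_
    simpa only [(h _).integral_eq φ hφ hc hs] using t2.neg

/-- Multiplication by an essentially bounded function preserves `L²` convergence. -/
lemma tendsto_L2_mul_bounded {α : Type*} [MeasurableSpace α] {μ : Measure α}
    {u : α → ℝ} {un : ℕ → α → ℝ} {w : α → ℝ} (hu : MemLp u 2 μ) (hun : ∀ n, MemLp (un n) 2 μ)
    (hw : MemLp w ⊤ μ) (h : Tendsto (fun n => eLpNorm (fun x => un n x - u x) 2 μ) atTop (𝓝 0)) :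
    Tendsto (fun n => eLpNorm (fun x => un n x * w x - u x * w x) 2 μ) atTop (𝓝 0) := by
  have hb : Tendsto (fun n => eLpNorm w ⊤ μ * eLpNorm (fun x => un n x - u x) 2 μ)
      atTop (𝓝 0) := by
    have := ENNReal.Tendsto.const_mul h (Or.inr hw.2.ne)
    simpa using this
  refine tendsto_of_tendsto_of_tendsto_of_le_of_le tendsto_const_nhds hb (fun n => zero_le) ?_
  intro n
  have : (fun x => un n x * w x - u x * w x) = w • (fun x => un n x - u x) := by
    ext x; simp; ring
  simp only
  rw [this]
  exact eLpNorm_smul_le_mul_eLpNorm ((hun n).sub hu).1 hw.1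

lemma tendsto_L2_add {α : Type*} [MeasurableSpace α] {μ : Measure α}
    {u v : α → ℝ} {un vn : ℕ → α → ℝ} (hu : MemLp u 2 μ) (hun : ∀ n, MemLp (un n) 2 μ)
    (hv : MemLp v 2 μ) (hvn : ∀ n, MemLp (vn n) 2 μ)
    (h : Tendsto (fun n => eLpNorm (fun x => un n x - u x) 2 μ) atTop (𝓝 0))
    (h' : Tendsto (fun n => eLpNorm (fun x => vn n x - v x) 2 μ) atTop (𝓝 0)) :
    Tendsto (fun n => eLpNorm (fun x => (un n x + vn n x) - (u x + v x)) 2 μ) atTop (𝓝 0) := by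
  have hb := h.add h'
  rw [add_zero] at hb
  refine tendsto_of_tendsto_of_tendsto_of_le_of_le tendsto_const_nhds hb (fun n => zero_le) ?_
  intro n
  have : (fun x => (un n x + vn n x) - (u x + v x))
      = (fun x => un n x - u x) + (fun x => vn n x - v x) := by
    ext x; simp; ring
  simp only
  rw [this]
  exact eLpNorm_add_le ((hun n).sub hu).1 ((hvn n).sub hv).1 (by norm_num)

/-- Translations are continuous in `L²(ℝ³)`. -/
lemma tendsto_eLpNorm_translate {h : E3 → ℝ} (hh : MemLp h 2 volume) :
    Tendsto (fun t : E3 => eLpNorm (fun x => h (x - t) - h x) 2 volume) (𝓝 0) (𝓝 0) := by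
  have hmp : ∀ t : E3, MeasurePreserving (fun x : E3 => x - t) volume volume := fun t =>
    measurePreserving_sub_right volume t
  let g : C(E3 × E3, E3) := ⟨fun p => p.2 - p.1, by fun_prop⟩
  have hg : Continuous g.curry := g.curry.continuous
  have hc : Continuous fun t : E3 =>
      Lp.compMeasurePreserving (μ := volume) (μb := volume) (g.curry t) (hmp t) (hh.toLp h) :=
    continuous_const.compMeasurePreservingLp hg (fun t => hmp t) (by norm_num)
  have ht := hc.tendsto 0
  rw [Lp.tendsto_Lp_iff_tendsto_eLpNorm'] at ht
  refine ht.congr fun t => eLpNorm_congr_ae ?_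
  have e1 : ∀ t : E3, (Lp.compMeasurePreserving (μ := volume) (μb := volume) (g.curry t) (hmp t)
      (hh.toLp h) : E3 → ℝ) =ᵐ[volume] fun x => h (x - t) := fun t => by
    refine (Lp.coeFn_compMeasurePreserving _ (hmp t)).trans ?_
    exact (hmp t).quasiMeasurePreserving.ae_eq_comp hh.coeFn_toLp
  filter_upwards [e1 t, e1 0] with x h1 h2
  simp only [Pi.sub_apply, h1, h2, sub_zero]

/-- The convolution `h ⋆ κ` of scalar functions on `ℝ³`. -/
abbrev conv (h κ : E3 → ℝ) : E3 → ℝ := convolution h κ (ContinuousLinearMap.mul ℝ ℝ) volume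

/-- Convolution with a probability density concentrated near the origin moves a function by at most
its `L²` modulus of continuity. -/
lemma eLpNorm_conv_sub_le {h κ : E3 → ℝ} (hm : Measurable h) (hh : MemLp h 2 volume)
    (hκ : Continuous κ) (hκc : HasCompactSupport κ) (hκ0 : ∀ x, 0 ≤ κ x) (hκ1 : ∫ x, κ x = 1)
    {η : ℝ≥0∞} (hη : ∀ t, κ t ≠ 0 → eLpNorm (fun x => h (x - t) - h x) 2 volume ≤ η) :
    eLpNorm (fun x => conv h κ x - h x) 2 volume ≤ η := by
  have hκi : Integrable κ := hκ.integrable_of_hasCompactSupport hκc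
  have hκl : ∫⁻ t, ENNReal.ofReal (κ t) = 1 := by
    rw [← ofReal_integral_eq_lintegral_ofReal hκi (ae_of_all _ hκ0), hκ1, ENNReal.ofReal_one]
  have hκm : Measurable fun t => ENNReal.ofReal (κ t) := hκ.measurable.ennreal_ofReal
  set ν : Measure E3 := volume.withDensity fun t => ENNReal.ofReal (κ t) with hν
  have : IsProbabilityMeasure ν := ⟨by rw [hν, withDensity_apply _ MeasurableSet.univ]; simpa⟩
  have sq : ∀ (μ : Measure E3) (f : E3 → ℝ), eLpNorm f 2 μ ^ 2 = ∫⁻ x, ‖f x‖ₑ ^ 2 ∂μ := by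
    intro μ f
    rw [eLpNorm_eq_lintegral_rpow_enorm_toReal (by norm_num) (by norm_num), ← ENNReal.rpow_natCast,
      ← ENNReal.rpow_mul]
    simp
  -- Jensen's inequality for the probability measure `κ dt`, pointwise in `x`
  have pt : ∀ x, ‖conv h κ x - h x‖ₑ ^ 2 ≤ ∫⁻ t, ENNReal.ofReal (κ t) * ‖h (x - t) - h x‖ₑ ^ 2 := by
    intro x
    have hloc : LocallyIntegrable h volume := hh.locallyIntegrable (by norm_num)
    have i1 : Integrable fun t => h (x - t) * κ t := by
      have : Integrable fun t => h t * κ (x - t) := by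
        have := (hκc.convolutionExists_right (ContinuousLinearMap.mul ℝ ℝ) hloc hκ x)
        exact this.integrable
      have := this.comp_sub_left x
      simpa using this
    have i2 : Integrable fun t => h x * κ t := hκi.const_mul _
    have e : conv h κ x - h x = ∫ t, (h (x - t) - h x) * κ t := by
      have : ∫ t, h x * κ t = h x := by rw [integral_const_mul, hκ1, mul_one]
      simp only [sub_mul]
      rw [integral_sub i1 i2, this]
      congr 1
      exact convolution_mul_swap
    calc ‖conv h κ x - h x‖ₑ ^ 2 ≤ (∫⁻ t, ‖(h (x - t) - h x) * κ t‖ₑ) ^ 2 := by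
          rw [e]; gcongr; exact enorm_integral_le_lintegral_enorm _
      _ = (∫⁻ t, ‖h (x - t) - h x‖ₑ ∂ν) ^ 2 := by
          rw [hν, lintegral_withDensity_eq_lintegral_mul _ hκm (by fun_prop)]
          congr 2; ext t
          rw [Pi.mul_apply, enorm_mul, mul_comm, Real.enorm_eq_ofReal (hκ0 t)]
      _ ≤ (eLpNorm (fun t => h (x - t) - h x) 2 ν) ^ 2 := by
          gcongr
          rw [← eLpNorm_one_eq_lintegral_enorm]
          exact eLpNorm_le_eLpNorm_of_exponent_le (by norm_num)
            (by fun_prop : Measurable fun t => h (x - t) - h x).aestronglyMeasurable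
      _ = _ := by
          rw [sq, hν, lintegral_withDensity_eq_lintegral_mul _ hκm (by fun_prop)]
          rfl
  -- Tonelli: integrate over `x` first
  have key : eLpNorm (fun x => conv h κ x - h x) 2 volume ^ 2 ≤ η ^ 2 := by
    rw [sq]
    calc ∫⁻ x, ‖conv h κ x - h x‖ₑ ^ 2
        ≤ ∫⁻ x, ∫⁻ t, ENNReal.ofReal (κ t) * ‖h (x - t) - h x‖ₑ ^ 2 := lintegral_mono pt
      _ = ∫⁻ t, ∫⁻ x, ENNReal.ofReal (κ t) * ‖h (x - t) - h x‖ₑ ^ 2 := by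
          rw [lintegral_lintegral_swap]
          exact (by fun_prop : Measurable _).aemeasurable
      _ = ∫⁻ t, ENNReal.ofReal (κ t) * eLpNorm (fun x => h (x - t) - h x) 2 volume ^ 2 := by
          congr 1; ext t
          rw [lintegral_const_mul _ (by fun_prop), sq]
      _ ≤ ∫⁻ t, ENNReal.ofReal (κ t) * η ^ 2 := by
          refine lintegral_mono fun t => ?_
          by_cases ht : κ t = 0
          · simp [ht]
          · gcongr; exact hη t ht
      _ = η ^ 2 := by rw [lintegral_mul_const _ hκm, hκl, one_mul]
  exact (ENNReal.pow_le_pow_left_iff two_ne_zero).1 key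

lemma tendsto_conv_L2_of_measurable {h : E3 → ℝ} (hm : Measurable h) (hh : MemLp h 2 volume)
    {κ : ℕ → E3 → ℝ} (hκ : ∀ n, Continuous (κ n)) (hκc : ∀ n, HasCompactSupport (κ n))
    (hκ0 : ∀ n x, 0 ≤ κ n x) (hκ1 : ∀ n, ∫ x, κ n x = 1)
    {δ : ℕ → ℝ} (hδ : Tendsto δ atTop (𝓝 0)) (hs : ∀ n t, κ n t ≠ 0 → ‖t‖ ≤ δ n) :
    Tendsto (fun n => eLpNorm (fun x => conv h (κ n) x - h x) 2 volume) atTop (𝓝 0) := by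
  rw [ENNReal.tendsto_nhds_zero]
  intro η hη
  have ht := (ENNReal.tendsto_nhds_zero.1 (tendsto_eLpNorm_translate hh)) η hη
  obtain ⟨r, hr, hball⟩ := Metric.eventually_nhds_iff.1 ht
  filter_upwards [hδ.eventually (gt_mem_nhds hr)] with n hn
  refine eLpNorm_conv_sub_le hm hh (hκ n) (hκc n) (hκ0 n) (hκ1 n) fun t htn => hball ?_
  rw [dist_zero_right]
  exact (hs n t htn).trans_lt hn

/-- Mollification by probability densities whose supports shrink to the origin (they need not
contain it) converges in `L²(ℝ³)`. -/
lemma tendsto_conv_L2 {h : E3 → ℝ} (hh : MemLp h 2 volume)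
    {κ : ℕ → E3 → ℝ} (hκ : ∀ n, Continuous (κ n)) (hκc : ∀ n, HasCompactSupport (κ n))
    (hκ0 : ∀ n x, 0 ≤ κ n x) (hκ1 : ∀ n, ∫ x, κ n x = 1)
    {δ : ℕ → ℝ} (hδ : Tendsto δ atTop (𝓝 0)) (hs : ∀ n t, κ n t ≠ 0 → ‖t‖ ≤ δ n) :
    Tendsto (fun n => eLpNorm (fun x => conv h (κ n) x - h x) 2 volume) atTop (𝓝 0) := by
  have e : h =ᵐ[volume] hh.1.mk h := hh.1.ae_eq_mk
  have := tendsto_conv_L2_of_measurable hh.1.stronglyMeasurable_mk.measurable (hh.ae_eq e)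
    hκ hκc hκ0 hκ1 hδ hs
  refine this.congr fun n => eLpNorm_congr_ae ?_
  have ec : conv (hh.1.mk h) (κ n) = conv h (κ n) := convolution_congr _ e.symm (ae_eq_refl _)
  filter_upwards [e] with x hx
  rw [ec, hx]

/-! ### Boundary charts and partitions of unity -/

open Metric in
/-- A boundary chart of `Ω`: after the rigid motion `e`, the part of `Ω` in the ball
`ball center r` is the region strictly above the graph of the smooth function `γ`. -/
structure BoundaryChart (Ω : Set E3) where
  /-- the rigid change of coordinates -/
  e : E3 ≃ₗᵢ[ℝ] E3
  /-- the function whose graph is the boundary -/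
  γ : ℝ × ℝ → ℝ
  /-- the centre of the ball on which the chart describes `Ω` -/
  center : E3
  /-- the radius of the ball on which the chart describes `Ω` -/
  r : ℝ
  contDiff_γ : ContDiff ℝ ∞ γ
  mem_iff : ∀ x ∈ ball center r, (x ∈ Ω ↔ γ (e x 0, e x 1) < e x 2)

namespace BoundaryChart

variable {Ω : Set E3} (c : BoundaryChart Ω)

/-- The ball on which the chart describes `Ω`. -/
def dom : Set E3 := Metric.ball c.center c.r

/-- The height of a point above the boundary graph. -/
def height (x : E3) : ℝ := c.e x 2 - c.γ (c.e x 0, c.e x 1)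

/-- The two horizontal coordinates of a point. They are kept in `Fin 2 → ℝ`, where the Hausdorff
measure of the sup distance is Lebesgue measure. -/
def proj (x : E3) : Fin 2 → ℝ := ![c.e x 0, c.e x 1]

/-- The point at height `p.2` above the boundary point with horizontal coordinates `p.1`. -/
def param (p : (Fin 2 → ℝ) × ℝ) : E3 :=
  c.e.symm (WithLp.toLp 2 ![p.1 0, p.1 1, c.γ (p.1 0, p.1 1) + p.2])

/-- The vertical unit vector of the chart, pointing into `Ω`. -/
def up : E3 := c.e.symm (EuclideanSpace.single 2 1)

lemma isOpen_dom : IsOpen c.dom := Metric.isOpen_ball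

lemma mem_iff_height {x : E3} (hx : x ∈ c.dom) : x ∈ Ω ↔ 0 < c.height x := by
  rw [c.mem_iff x hx, height, sub_pos]

lemma contDiff_coord (i : Fin 3) : ContDiff ℝ ∞ fun x => c.e x i :=
  ((EuclideanSpace.proj (𝕜 := ℝ) i : E3 →L[ℝ] ℝ).contDiff).comp c.e.contDiff

lemma contDiff_height : ContDiff ℝ ∞ c.height :=
  (c.contDiff_coord 2).sub (c.contDiff_γ.comp ((c.contDiff_coord 0).prodMk (c.contDiff_coord 1)))

lemma differentiable_height : Differentiable ℝ c.height := c.contDiff_height.differentiable (by simp)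

lemma continuous_height : Continuous c.height := c.contDiff_height.continuous

lemma contDiff_param : ContDiff ℝ ∞ c.param := by
  unfold param
  refine c.e.symm.contDiff.comp (PiLp.contDiff_toLp.comp (contDiff_pi.2 fun i => ?_))
  have h0 : ContDiff ℝ ∞ fun p : (Fin 2 → ℝ) × ℝ => p.1 0 := by fun_prop
  have h1 : ContDiff ℝ ∞ fun p : (Fin 2 → ℝ) × ℝ => p.1 1 := by fun_prop
  fin_cases i
  · exact h0
  · exact h1
  · exact (c.contDiff_γ.comp (h0.prodMk h1)).add contDiff_snd

lemma continuous_param : Continuous c.param := c.contDiff_param.continuous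

lemma continuous_proj : Continuous c.proj := by
  refine continuous_pi fun i => ?_
  fin_cases i
  · exact (c.contDiff_coord 0).continuous
  · exact (c.contDiff_coord 1).continuous

@[simp] lemma height_param (p : (Fin 2 → ℝ) × ℝ) : c.height (c.param p) = p.2 := by
  simp [height, param]

@[simp] lemma proj_param (p : (Fin 2 → ℝ) × ℝ) : c.proj (c.param p) = p.1 := by
  ext i; fin_cases i <;> simp [proj, param]

@[simp] lemma param_proj_height (x : E3) : c.param (c.proj x, c.height x) = x := by
  rw [param, LinearIsometryEquiv.symm_apply_eq]
  ext i; fin_cases i <;> simp [proj, height]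

lemma height_add_smul_up (x : E3) (t : ℝ) : c.height (x + t • c.up) = c.height x + t := by
  simp [height, up]; ring

lemma fderiv_height_up (x : E3) : fderiv ℝ c.height x c.up = 1 := by
  have h1 : HasDerivAt (fun t : ℝ => c.height (x + t • c.up)) (fderiv ℝ c.height x c.up) 0 := by
    have hg : HasDerivAt (fun t : ℝ => x + t • c.up) c.up 0 := by
      simpa using ((hasDerivAt_id (0 : ℝ)).smul_const c.up).const_add x
    have hf : HasFDerivAt c.height (fderiv ℝ c.height x) (x + (0 : ℝ) • c.up) := by
      simpa using (c.differentiable_height x).hasFDerivAt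
    exact hf.comp_hasDerivAt 0 hg
  have h2 : HasDerivAt (fun t : ℝ => c.height (x + t • c.up)) 1 0 := by
    simp only [height_add_smul_up]
    simpa using (hasDerivAt_id (0 : ℝ)).const_add (c.height x)
  exact h1.unique h2

lemma lipschitzWith_proj : LipschitzWith 1 c.proj := by
  refine LipschitzWith.of_dist_le_mul fun x y => ?_
  rw [NNReal.coe_one, one_mul, dist_pi_le_iff dist_nonneg]
  have h : ∀ j : Fin 3, dist (c.e x j) (c.e y j) ≤ dist x y := fun j => by
    rw [← c.e.dist_map x y, dist_eq_norm, dist_eq_norm]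
    have := PiLp.norm_apply_le (c.e x - c.e y) j
    simpa using this
  intro i; fin_cases i
  · exact h 0
  · exact h 1

/-- The chart coordinates preserve volume: a rigid motion composed with a shear. -/
lemma measurePreserving_param : MeasurePreserving c.param volume volume := by
  have hγ : Measurable fun y : Fin 2 → ℝ => c.γ (y 0, y 1) :=
    (c.contDiff_γ.continuous.comp (by fun_prop)).measurable
  have h1 : MeasurePreserving (fun p : (Fin 2 → ℝ) × ℝ => (p.1, c.γ (p.1 0, p.1 1) + p.2))
      volume volume :=
    MeasurePreserving.skew_product (μa := volume) (μb := volume) (μc := volume) (μd := volume)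
      (f := id) (g := fun (y : Fin 2 → ℝ) (t : ℝ) => c.γ (y 0, y 1) + t)
      (MeasurePreserving.id volume)
      (by exact (hγ.comp measurable_fst).add measurable_snd)
      (ae_of_all _ fun y => map_add_left_eq_self volume _)
  have h2 : MeasurePreserving (Prod.swap : (Fin 2 → ℝ) × ℝ → ℝ × (Fin 2 → ℝ)) volume volume :=
    Measure.measurePreserving_swap
  have h3 := (volume_preserving_piFinSuccAbove (fun _ : Fin 3 => ℝ) 2).symm
  have h4 := EuclideanSpace.volume_preserving_symm_measurableEquiv_toLp (Fin 3)
  have h5 := c.e.symm.measurePreserving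
  have he : c.param = c.e.symm ∘ (MeasurableEquiv.toLp 2 (Fin 3 → ℝ)) ∘
      (MeasurableEquiv.piFinSuccAbove (fun _ : Fin 3 => ℝ) 2).symm ∘ Prod.swap ∘
      fun p : (Fin 2 → ℝ) × ℝ => (p.1, c.γ (p.1 0, p.1 1) + p.2) := by
    refine funext fun p => congrArg c.e.symm ?_
    ext i
    fin_cases i <;> rfl
  rw [he]
  exact h5.comp (h4.symm.comp (h3.comp (h2.comp h1)))

lemma measurableEmbedding_param : MeasurableEmbedding c.param := by
  refine c.continuous_param.measurableEmbedding fun p q h => ?_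
  have h1 := congrArg c.proj h
  have h2 := congrArg c.height h
  simp only [proj_param, height_param] at h1 h2
  exact Prod.ext h1 h2

lemma integral_comp_param (g : E3 → ℝ) : ∫ p, g (c.param p) = ∫ x, g x :=
  c.measurePreserving_param.integral_comp c.measurableEmbedding_param g

lemma height_eq_zero (hΩ : IsOpen Ω) {x : E3} (hx : x ∈ c.dom) (hf : x ∈ frontier Ω) :
    c.height x = 0 := by
  refine le_antisymm ?_ ?_
  · by_contra h
    have := (c.mem_iff_height hx).2 (not_le.1 h)
    rw [hΩ.frontier_eq] at hf
    exact hf.2 this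
  · by_contra h
    have h' := not_le.1 h
    have hN : {y | y ∈ c.dom ∧ c.height y < 0} ∈ 𝓝 x :=
      (c.isOpen_dom.inter (isOpen_lt c.continuous_height continuous_const)).mem_nhds ⟨hx, h'⟩
    obtain ⟨y, hy, hyΩ⟩ := mem_closure_iff_nhds.1 hf.1 _ hN
    exact absurd ((c.mem_iff_height hy.1).1 hyΩ) (not_lt.2 hy.2.le)

/-- From a point of the boundary graph, a direction in which the height increases enters `Ω`. -/
lemma eventually_mem {x v : E3} (hx : x ∈ c.dom) (h0 : c.height x = 0)
    (hv : 0 < fderiv ℝ c.height x v) : ∀ᶠ t : ℝ in 𝓝[>] 0, x + t • v ∈ Ω := by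
  have hg : HasDerivAt (fun t : ℝ => x + t • v) v 0 := by
    simpa using ((hasDerivAt_id (0 : ℝ)).smul_const v).const_add x
  have hd : HasDerivAt (fun t : ℝ => c.height (x + t • v)) (fderiv ℝ c.height x v) 0 := by
    have hf : HasFDerivAt c.height (fderiv ℝ c.height x) (x + (0 : ℝ) • v) := by
      simpa using (c.differentiable_height x).hasFDerivAt
    exact hf.comp_hasDerivAt 0 hg
  have h1 : ∀ᶠ t : ℝ in 𝓝[>] 0, 0 < c.height (x + t • v) := by
    have := (hasDerivAt_iff_tendsto_slope_zero.1 hd).eventually (lt_mem_nhds hv)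
    have h2 := this.filter_mono (nhdsGT_le_nhdsNE (0 : ℝ))
    filter_upwards [h2, self_mem_nhdsWithin] with t ht htpos
    simp only [zero_add, zero_smul, add_zero, h0, sub_zero, smul_eq_mul] at ht
    exact (mul_pos_iff_of_pos_left (inv_pos.2 htpos)).1 ht
  have h2 : ∀ᶠ t : ℝ in 𝓝[>] 0, x + t • v ∈ c.dom := by
    have : Tendsto (fun t : ℝ => x + t • v) (𝓝 0) (𝓝 x) := by
      simpa using hg.continuousAt.tendsto
    exact (this.eventually (c.isOpen_dom.mem_nhds hx)).filter_mono nhdsWithin_le_nhds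
  filter_upwards [h1, h2] with t ht1 ht2
  exact (c.mem_iff_height ht2).2 ht1

lemma mem_frontier (hΩ : IsOpen Ω) {x : E3} (hx : x ∈ c.dom) (h0 : c.height x = 0) :
    x ∈ frontier Ω := by
  rw [hΩ.frontier_eq]
  refine ⟨?_, fun h => by simpa [h0] using (c.mem_iff_height hx).1 h⟩
  have h := c.eventually_mem hx h0 (v := c.up) (by rw [fderiv_height_up]; norm_num)
  have ht : Tendsto (fun t : ℝ => x + t • c.up) (𝓝[>] 0) (𝓝 x) := by
    have : Continuous fun t : ℝ => x + t • c.up := by fun_prop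
    have := this.tendsto 0
    simp only [zero_smul, add_zero] at this
    exact this.mono_left nhdsWithin_le_nhds
  exact mem_closure_of_tendsto ht h

/-- Projecting the boundary graph onto the horizontal plane does not increase areas. -/
lemma map_param_le_hausdorff :
    Measure.map (fun y => c.param (y, 0)) volume ≤ (Measure.hausdorffMeasure 2 : Measure E3) := by
  have hm : Measurable fun y : Fin 2 → ℝ => c.param (y, 0) :=
    (c.continuous_param.comp (by fun_prop)).measurable
  refine Measure.le_iff.2 fun T hT => ?_
  rw [Measure.map_apply hm hT]
  have hvol : (volume : Measure (Fin 2 → ℝ)) = Measure.hausdorffMeasure 2 := by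
    rw [← hausdorffMeasure_pi_real]; simp
  calc volume ((fun y => c.param (y, 0)) ⁻¹' T) ≤ volume (c.proj '' T) := by
        refine measure_mono fun y hy => ⟨_, hy, by simp⟩
    _ ≤ _ := by
        rw [hvol]
        simpa using c.lipschitzWith_proj.hausdorffMeasure_image_le (d := 2) (by norm_num) T

/-- On compact parts of the chart, surface area is at most a constant times the area of the
horizontal projection. -/
lemma exists_hausdorff_le_map (hΩ : IsOpen Ω) {K : Set E3} (hK : IsCompact K) (hKd : K ⊆ c.dom) :
    ∃ C : NNReal, (Measure.hausdorffMeasure 2 : Measure E3).restrict (frontier Ω ∩ K) ≤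
      C • Measure.map (fun y => c.param (y, 0)) volume := by
  have hsm : ContDiff ℝ ∞ fun y : Fin 2 → ℝ => c.param (y, 0) :=
    c.contDiff_param.comp (contDiff_id.prodMk contDiff_const)
  obtain ⟨L, hL⟩ := LocallyLipschitzOn.exists_lipschitzOnWith_of_compact
    (hK.image c.continuous_proj)
    ((hsm.of_le (by simp)).locallyLipschitz.locallyLipschitzOn
      (s := c.proj '' K))
  refine ⟨L ^ 2, Measure.le_iff.2 fun T hT => ?_⟩
  have hvol : (volume : Measure (Fin 2 → ℝ)) = Measure.hausdorffMeasure 2 := by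
    rw [← hausdorffMeasure_pi_real]; simp
  rw [Measure.restrict_apply hT, Measure.smul_apply, Measure.map_apply hsm.continuous.measurable hT]
  set p : (Fin 2 → ℝ) → E3 := fun y => c.param (y, 0)
  calc Measure.hausdorffMeasure 2 (T ∩ (frontier Ω ∩ K))
      ≤ Measure.hausdorffMeasure 2 (p '' (p ⁻¹' T ∩ c.proj '' K)) := by
        refine measure_mono fun x hx => ?_
        have hp : p (c.proj x) = x := by
          have := c.param_proj_height x
          rwa [c.height_eq_zero hΩ (hKd hx.2.2) hx.2.1] at this
        exact ⟨c.proj x, ⟨by rw [Set.mem_preimage, hp]; exact hx.1, x, hx.2.2, rfl⟩, hp⟩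
    _ ≤ (L : ℝ≥0∞) ^ (2 : ℝ) * Measure.hausdorffMeasure 2 (p ⁻¹' T ∩ c.proj '' K) :=
        (hL.mono Set.inter_subset_right).hausdorffMeasure_image_le (by norm_num)
    _ ≤ L ^ 2 • volume (p ⁻¹' T) := by
        rw [hvol, ENNReal.smul_def, smul_eq_mul, ENNReal.coe_pow]
        gcongr
        · simp
        · exact Set.inter_subset_left

end BoundaryChart

/-- A finite smooth partition of unity on `closure Ω` adapted to the boundary: one member is
supported inside `Ω` and each of the others in the domain of a boundary chart. -/
structure BoundaryPartition (Ω : Set E3) where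
  /-- the index set of the boundary members -/
  ι : Type
  [fintype : Fintype ι]
  /-- the chart around the support of a boundary member -/
  chart : ι → BoundaryChart Ω
  /-- the interior member -/
  χ₀ : E3 → ℝ
  /-- the boundary members -/
  χ : ι → E3 → ℝ
  contDiff_χ₀ : ContDiff ℝ ∞ χ₀
  hasCompactSupport_χ₀ : HasCompactSupport χ₀
  tsupport_χ₀ : tsupport χ₀ ⊆ Ω
  contDiff_χ : ∀ i, ContDiff ℝ ∞ (χ i)
  hasCompactSupport_χ : ∀ i, HasCompactSupport (χ i)
  tsupport_χ : ∀ i, tsupport (χ i) ⊆ (chart i).dom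
  nonneg : ∀ i x, 0 ≤ χ i x
  sum_eq_one : ∀ x ∈ closure Ω, χ₀ x + ∑ i, χ i x = 1

attribute [instance] BoundaryPartition.fintype

lemma BoundaryPartition.χ₀_eq_zero {Ω : Set E3} (P : BoundaryPartition Ω) {x : E3} (hx : x ∉ Ω) :
    P.χ₀ x = 0 :=
  image_eq_zero_of_notMem_tsupport fun h => hx (P.tsupport_χ₀ h)

namespace IsSmoothBoundedDomain

variable {Ω : Set E3}

lemma isCompact_closure (hΩ : IsSmoothBoundedDomain Ω) : IsCompact (closure Ω) :=
  hΩ.isBounded.isCompact_closure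

lemma isFiniteMeasure (hΩ : IsSmoothBoundedDomain Ω) : IsFiniteMeasure (volume.restrict Ω) :=
  ⟨by rw [Measure.restrict_apply_univ]; exact hΩ.isBounded.measure_lt_top⟩

lemma exists_chart (hΩ : IsSmoothBoundedDomain Ω) (x : E3) (hx : x ∈ frontier Ω) :
    ∃ c : BoundaryChart Ω, x ∈ c.dom := by
  obtain ⟨e, γ, r, hr, hγ, h⟩ := hΩ.smoothBoundary x hx
  exact ⟨⟨e, γ, x, r, hγ, h⟩, Metric.mem_ball_self hr⟩

lemma nonempty_boundaryPartition (hΩ : IsSmoothBoundedDomain Ω) :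
    Nonempty (BoundaryPartition Ω) := by
  have hfc : IsCompact (frontier Ω) :=
    hΩ.isCompact_closure.of_isClosed_subset isClosed_frontier frontier_subset_closure
  choose c hc using fun x : frontier Ω => hΩ.exists_chart x x.2
  obtain ⟨t, htc⟩ := hfc.elim_nhds_subcover' (fun x hx => (c ⟨x, hx⟩).dom)
    fun x hx => (c ⟨x, hx⟩).isOpen_dom.mem_nhds (hc ⟨x, hx⟩)
  let U : Option t → Set E3 := fun o => o.elim Ω fun i => (c i).dom
  obtain ⟨f, hf⟩ := SmoothPartitionOfUnity.exists_isSubordinate (modelWithCornersSelf ℝ E3)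
    (s := closure Ω) isClosed_closure U
    (by rintro (_ | i); exacts [hΩ.isOpen, (c i).isOpen_dom])
    (by
      intro x hx
      by_cases hxΩ : x ∈ Ω
      · exact Set.mem_iUnion.2 ⟨none, hxΩ⟩
      · have hxf : x ∈ frontier Ω := by rw [hΩ.isOpen.frontier_eq]; exact ⟨hx, hxΩ⟩
        obtain ⟨y, hy, hxy⟩ := Set.mem_iUnion₂.1 (htc hxf)
        exact Set.mem_iUnion.2 ⟨some ⟨y, hy⟩, hxy⟩)
  refine ⟨{
    ι := t
    chart := fun i => c i
    χ₀ := f none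
    χ := fun i => f (some i)
    contDiff_χ₀ := (f none).contMDiff.contDiff
    hasCompactSupport_χ₀ := ?_
    tsupport_χ₀ := hf none
    contDiff_χ := fun i => (f (some i)).contMDiff.contDiff
    hasCompactSupport_χ := fun i => ?_
    tsupport_χ := fun i => hf (some i)
    nonneg := fun i x => f.nonneg (some i) x
    sum_eq_one := fun x hx => ?_ }⟩
  · exact Metric.isCompact_of_isClosed_isBounded (isClosed_tsupport _)
      (hΩ.isBounded.subset (hf none))
  · exact Metric.isCompact_of_isClosed_isBounded (isClosed_tsupport _)
      (Metric.isBounded_ball.subset (hf (some i)))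
  · have := f.sum_eq_one hx
    rw [finsum_eq_sum_of_fintype, Fintype.sum_option] at this
    exact this

lemma uniqueDiffOn_closure (hΩ : IsSmoothBoundedDomain Ω) : UniqueDiffOn ℝ (closure Ω) := by
  intro x hx
  by_cases hxΩ : x ∈ Ω
  · exact (hΩ.isOpen.uniqueDiffWithinAt hxΩ).mono subset_closure
  have hxf : x ∈ frontier Ω := by rw [hΩ.isOpen.frontier_eq]; exact ⟨hx, hxΩ⟩
  obtain ⟨c, hc⟩ := hΩ.exists_chart x hxf
  have h0 := c.height_eq_zero hΩ.isOpen hc hxf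
  have hT : ∀ v, 0 < fderiv ℝ c.height x v → v ∈ tangentConeAt ℝ (closure Ω) x := fun v hv =>
    tangentConeAt_mono_field (mem_posTangentConeAt_of_frequently_mem
      (((c.eventually_mem hc h0 hv).mono fun t ht => subset_closure ht).frequently))
  refine ⟨?_, subset_closure hx⟩
  -- the directions of increasing height form a half space, which spans everything
  have hspan : Submodule.span ℝ (tangentConeAt ℝ (closure Ω) x) = ⊤ := by
    rw [Submodule.eq_top_iff']
    intro w
    set a : ℝ := |fderiv ℝ c.height x w| + 1
    have h1 : w + a • c.up ∈ tangentConeAt ℝ (closure Ω) x := by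
      refine hT _ ?_
      rw [map_add, map_smul, c.fderiv_height_up, smul_eq_mul, mul_one]
      have := neg_abs_le (fderiv ℝ c.height x w)
      linarith
    have h2 : c.up ∈ tangentConeAt ℝ (closure Ω) x := hT _ (by rw [c.fderiv_height_up]; norm_num)
    have : w = (w + a • c.up) - a • c.up := by abel
    rw [this]
    exact Submodule.sub_mem _ (Submodule.subset_span h1)
      (Submodule.smul_mem _ _ (Submodule.subset_span h2))
  rw [hspan]
  exact dense_univ

end IsSmoothBoundedDomain

/-! ### The divergence theorem in a boundary chart -/

lemma deriv_smoothTransition_of_nonpos {t : ℝ} (ht : t ≤ 0) : deriv Real.smoothTransition t = 0 :=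
  IsLocalMin.deriv_eq_zero (Eventually.of_forall fun s => by
    rw [Real.smoothTransition.zero_of_nonpos ht]; exact Real.smoothTransition.nonneg s)

lemma deriv_smoothTransition_of_one_le {t : ℝ} (ht : 1 ≤ t) : deriv Real.smoothTransition t = 0 :=
  IsLocalMax.deriv_eq_zero (Eventually.of_forall fun s => by
    rw [Real.smoothTransition.one_of_one_le ht]; exact Real.smoothTransition.le_one s)

lemma continuous_deriv_smoothTransition : Continuous (deriv Real.smoothTransition) :=
  (Real.smoothTransition.contDiff (n := 1)).continuous_deriv le_rfl

lemma support_deriv_smoothTransition_subset :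
    Function.support (deriv Real.smoothTransition) ⊆ Set.Ioc 0 1 := fun t ht => by
  constructor
  · by_contra h
    exact ht (deriv_smoothTransition_of_nonpos (not_lt.1 h))
  · by_contra h
    exact ht (deriv_smoothTransition_of_one_le (not_le.1 h).le)

/-- The kernels `ε⁻¹ S'(t / ε - 1)`, where `S` is the smooth transition function, form an
approximate identity as `ε → 0`, concentrated on positive `t`. -/
lemma tendsto_integral_transition {h : ℝ → ℝ} (hh : Continuous h) :
    Tendsto (fun ε : ℝ => ∫ t, h t * (deriv Real.smoothTransition (t / ε - 1) / ε)) (𝓝[>] 0)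
      (𝓝 (h 0)) := by
  have hS := continuous_deriv_smoothTransition
  have hc : Continuous fun ε : ℝ =>
      ∫ τ in (0 : ℝ)..1, h (ε * (τ + 1)) * deriv Real.smoothTransition τ :=
    intervalIntegral.continuous_parametric_intervalIntegral_of_continuous' (by fun_prop) 0 1
  have h0 : ∫ τ in (0 : ℝ)..1, h (0 * (τ + 1)) * deriv Real.smoothTransition τ = h 0 := by
    simp only [zero_mul, intervalIntegral.integral_const_mul]
    rw [intervalIntegral.integral_deriv_eq_sub]
    · simp
    · exact fun x _ => (Real.smoothTransition.contDiff (n := 1)).differentiable (by simp) x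
    · exact hS.intervalIntegrable _ _
  have ht := hc.tendsto 0
  rw [h0] at ht
  refine (ht.mono_left nhdsWithin_le_nhds).congr' ?_
  filter_upwards [self_mem_nhdsWithin] with ε hε
  have hε : (0 : ℝ) < ε := hε
  rw [intervalIntegral.integral_eq_integral_of_support_subset
    (fun τ hτ => support_deriv_smoothTransition_subset (right_ne_zero_of_mul hτ))]
  set g : ℝ → ℝ := fun τ => h (ε * (τ + 1)) * deriv Real.smoothTransition τ with hg
  have e : ∀ t, h t * (deriv Real.smoothTransition (t / ε - 1) / ε) = ε⁻¹ * g (t / ε - 1) := by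
    intro t
    simp only [hg]
    rw [show ε * (t / ε - 1 + 1) = t by field_simp; ring]
    ring
  simp only [e]
  rw [integral_const_mul, Measure.integral_comp_div (fun t => g (t - 1)) ε,
    integral_sub_right_eq_self g 1, abs_of_pos hε, smul_eq_mul, inv_mul_cancel_left₀ hε.ne']

namespace BoundaryChart

variable {Ω : Set E3} (c : BoundaryChart Ω)

/-- The smooth cut-off `S(ρ / ε - 1)`, equal to zero where the height `ρ` is at most `ε` and to one
where it is at least `2 ε`. -/
def cutoff (ε : ℝ) (x : E3) : ℝ := Real.smoothTransition (c.height x / ε - 1)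

lemma contDiff_cutoff (ε : ℝ) : ContDiff ℝ ∞ (c.cutoff ε) :=
  Real.smoothTransition.contDiff.comp ((c.contDiff_height.div_const ε).sub contDiff_const)

lemma cutoff_nonneg (ε : ℝ) (x : E3) : 0 ≤ c.cutoff ε x := Real.smoothTransition.nonneg _

lemma cutoff_le_one (ε : ℝ) (x : E3) : c.cutoff ε x ≤ 1 := Real.smoothTransition.le_one _

lemma pderiv_cutoff (ε : ℝ) (k : Fin 3) (x : E3) :
    pderiv k (c.cutoff ε) x =
      deriv Real.smoothTransition (c.height x / ε - 1) / ε * pderiv k c.height x := by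
  have h1 : HasDerivAt Real.smoothTransition
      (deriv Real.smoothTransition (c.height x / ε - 1)) (c.height x / ε - 1) :=
    ((Real.smoothTransition.contDiff (n := 1)).differentiable (by simp) _).hasDerivAt
  have h2 : HasFDerivAt (fun x => c.height x / ε - 1) (ε⁻¹ • fderiv ℝ c.height x) x := by
    have := ((c.differentiable_height x).hasFDerivAt.const_mul ε⁻¹).sub_const 1
    refine this.congr_of_eventuallyEq (Eventually.of_forall fun y => ?_)
    simp only; ring
  have h3 : HasFDerivAt (c.cutoff ε) _ x := h1.comp_hasFDerivAt x h2
  rw [pderiv, h3.fderiv]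
  simp only [smul_apply, smul_eq_mul, pderiv]
  ring

variable {c} in
lemma tsupport_mul_cutoff_subset {χ : E3 → ℝ} (hχd : tsupport χ ⊆ c.dom) {ε : ℝ} (hε : 0 < ε) :
    tsupport (fun x => χ x * c.cutoff ε x) ⊆ Ω := by
  have hcl : IsClosed (tsupport χ ∩ {x | ε ≤ c.height x}) :=
    (isClosed_tsupport χ).inter (isClosed_le continuous_const c.continuous_height)
  have hsub : Function.support (fun x => χ x * c.cutoff ε x) ⊆
      tsupport χ ∩ {x | ε ≤ c.height x} := by
    intro x hx
    refine ⟨subset_tsupport χ (left_ne_zero_of_mul hx), ?_⟩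
    by_contra h
    refine right_ne_zero_of_mul hx (Real.smoothTransition.zero_of_nonpos ?_)
    have := (div_lt_one hε).2 (not_le.1 h)
    linarith
  intro x hx
  have hx' := closure_minimal hsub hcl hx
  exact (c.mem_iff_height (hχd hx'.1)).2 (hε.trans_le hx'.2)

/-- If `G` is continuous with compact support, its integrals over the parallel surfaces
at height `t` depend continuously on `t`. -/
lemma continuous_integral_param {G : E3 → ℝ} (hG : Continuous G) (hGc : HasCompactSupport G) :
    Continuous fun t : ℝ => ∫ y : Fin 2 → ℝ, G (c.param (y, t)) := by
  have hK : IsCompact (c.proj '' tsupport G) := IsCompact.image hGc c.continuous_proj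
  have e : ∀ t, ∫ y : Fin 2 → ℝ, G (c.param (y, t)) =
      ∫ y in c.proj '' tsupport G, G (c.param (y, t)) := by
    intro t
    refine (setIntegral_eq_integral_of_forall_compl_eq_zero fun y hy => ?_).symm
    by_contra h
    exact hy ⟨c.param (y, t), subset_tsupport G h, by simp⟩
  simp only [e]
  have hcont : Continuous (Function.uncurry fun (t : ℝ) (y : Fin 2 → ℝ) => G (c.param (y, t))) :=
    hG.comp (c.continuous_param.comp (continuous_snd.prodMk continuous_fst))
  exact continuous_parametric_integral_of_continuous hcont hK

/-- Averages over thin layers above the boundary graph converge to the integral over the graph. -/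
lemma tendsto_integral_layer {G : E3 → ℝ} (hG : Continuous G) (hGc : HasCompactSupport G) :
    Tendsto (fun ε : ℝ => ∫ x, G x * (deriv Real.smoothTransition (c.height x / ε - 1) / ε))
      (𝓝[>] 0) (𝓝 (∫ y : Fin 2 → ℝ, G (c.param (y, 0)))) := by
  refine (tendsto_integral_transition (c.continuous_integral_param hG hGc)).congr fun ε => ?_
  have hS := continuous_deriv_smoothTransition
  rw [← c.integral_comp_param]
  simp only [height_param]
  have hcs : HasCompactSupport fun x =>
      G x * (deriv Real.smoothTransition (c.height x / ε - 1) / ε) := hGc.mul_right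
  have hi : Integrable fun x =>
      G x * (deriv Real.smoothTransition (c.height x / ε - 1) / ε) :=
    (Continuous.mul hG ((hS.comp ((c.continuous_height.div_const ε).sub continuous_const)).div_const
      ε)).integrable_of_hasCompactSupport hcs
  have hi' := (c.measurePreserving_param.integrable_comp_emb c.measurableEmbedding_param).2 hi
  simp only [Function.comp_def, height_param] at hi'
  rw [Measure.volume_eq_prod] at hi' ⊢
  rw [integral_prod_symm _ hi']
  simp only [integral_mul_const]

/-- The chart identity below, for fields that are continuous on the whole space. -/
lemma chart_identity_of_continuous (hΩ : IsSmoothBoundedDomain Ω) {χ : E3 → ℝ}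
    (hχ : ContDiff ℝ ∞ χ) (hχc : HasCompactSupport χ) (hχd : tsupport χ ⊆ c.dom)
    {F D : Fin 3 → E3 → ℝ} (hF : ∀ k, Continuous (F k))
    (hD : ∀ k, HasWeakPartial Ω k (F k) (D k)) (hDi : ∀ k, IntegrableOn (D k) Ω) :
    ∫ x in Ω, ((∑ k, D k x) * χ x + ∑ k, F k x * pderiv k χ x) =
      - ∫ y : Fin 2 → ℝ, χ (c.param (y, 0)) *
          ∑ k, F k (c.param (y, 0)) * pderiv k c.height (c.param (y, 0)) := by
  set G : E3 → ℝ := fun x => χ x * ∑ k, F k x * pderiv k c.height x with hGdef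
  have hG : Continuous G := hχ.continuous.mul (continuous_finsetSum _ fun k _ =>
    (hF k).mul (continuous_pderiv c.contDiff_height k))
  have hGc : HasCompactSupport G := hχc.mul_right
  set B : E3 → ℝ := fun x => (∑ k, D k x) * χ x + ∑ k, F k x * pderiv k χ x with hB
  have hBi : IntegrableOn B Ω := by
    refine Integrable.add ?_ ?_
    · have h1 : IntegrableOn (fun x => ∑ k, D k x) Ω := integrable_finsetSum _ fun k _ => hDi k
      obtain ⟨M, hM⟩ := hχc.exists_bound_of_continuous hχ.continuous
      exact h1.mul_bdd hχ.continuous.aestronglyMeasurable (ae_of_all _ hM)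
    · refine (Continuous.integrable_of_hasCompactSupport (μ := volume)
        (continuous_finsetSum _ fun k _ =>
        (hF k).mul (continuous_pderiv hχ k)) ?_).integrableOn
      refine HasCompactSupport.intro hχc fun x hx => ?_
      refine Finset.sum_eq_zero fun k _ => ?_
      rw [Pi.mul_apply,
        image_eq_zero_of_notMem_tsupport (fun h => hx (tsupport_pderiv_subset χ k h)), mul_zero]
  -- test the weak derivatives with `χ` times the cut-off, whose support lies in `Ω`
  have key : ∀ ε : ℝ, 0 < ε → ∫ x in Ω, B x * c.cutoff ε x =
      - ∫ x, G x * (deriv Real.smoothTransition (c.height x / ε - 1) / ε) := by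
    intro ε hε
    set ψ : E3 → ℝ := fun x => χ x * c.cutoff ε x with hψ
    have hψs : ContDiff ℝ ∞ ψ := hχ.mul (c.contDiff_cutoff ε)
    have hψc : HasCompactSupport ψ := hχc.mul_right
    have hψΩ : tsupport ψ ⊆ Ω := tsupport_mul_cutoff_subset hχd hε
    have hsum : ∫ x in Ω, ∑ k, (F k x * pderiv k ψ x + D k x * ψ x) = 0 := by
      have hi : ∀ k, IntegrableOn (fun x => F k x * pderiv k ψ x + D k x * ψ x) Ω := fun k =>
        ((hD k).integrable_mul_pderiv hψs hψc hψΩ k).add ((hD k).integrable_mul hψs hψc hψΩ)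
      rw [integral_finsetSum _ fun k _ => hi k]
      refine Finset.sum_eq_zero fun k _ => ?_
      rw [integral_add ((hD k).integrable_mul_pderiv hψs hψc hψΩ k)
        ((hD k).integrable_mul hψs hψc hψΩ), (hD k).integral_eq ψ hψs hψc hψΩ]
      ring
    have hpt : ∀ x, ∑ k, (F k x * pderiv k ψ x + D k x * ψ x) = B x * c.cutoff ε x +
        G x * (deriv Real.smoothTransition (c.height x / ε - 1) / ε) := by
      intro x
      have hpd : ∀ k, pderiv k ψ x = pderiv k χ x * c.cutoff ε x + χ x *
          (deriv Real.smoothTransition (c.height x / ε - 1) / ε * pderiv k c.height x) :=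
        fun k => by
        rw [← c.pderiv_cutoff]
        exact pderiv_mul (hχ.differentiable (by simp) x)
          ((c.contDiff_cutoff ε).differentiable (by simp) x) k
      simp only [hpd]
      simp only [hB, hGdef, hψ, Fin.sum_univ_three]
      ring
    have hz : ∀ x, x ∉ Ω → G x * (deriv Real.smoothTransition (c.height x / ε - 1) / ε) = 0 := by
      intro x hx
      by_cases hxs : x ∈ tsupport χ
      · have : c.height x ≤ 0 := by
          by_contra h
          exact hx ((c.mem_iff_height (hχd hxs)).2 (not_le.1 h))
        rw [deriv_smoothTransition_of_nonpos, zero_div, mul_zero]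
        have := div_nonpos_of_nonpos_of_nonneg this hε.le
        linarith
      · simp [hGdef, image_eq_zero_of_notMem_tsupport hxs]
    have hS := continuous_deriv_smoothTransition
    have hGi : Integrable fun x =>
        G x * (deriv Real.smoothTransition (c.height x / ε - 1) / ε) :=
      (Continuous.mul hG ((hS.comp ((c.continuous_height.div_const ε).sub
        continuous_const)).div_const ε)).integrable_of_hasCompactSupport hGc.mul_right
    have hBci : IntegrableOn (fun x => B x * c.cutoff ε x) Ω :=
      hBi.mul_bdd (c := 1) (c.contDiff_cutoff ε).continuous.aestronglyMeasurable (ae_of_all _ fun x => by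
        rw [Real.norm_eq_abs, abs_of_nonneg (c.cutoff_nonneg ε x)]; exact c.cutoff_le_one ε x)
    simp only [hpt] at hsum
    rw [integral_add hBci hGi.integrableOn,
      setIntegral_eq_integral_of_forall_compl_eq_zero hz] at hsum
    linarith
  have lim1 : Tendsto (fun ε : ℝ => ∫ x in Ω, B x * c.cutoff ε x) (𝓝[>] 0)
      (𝓝 (∫ x in Ω, B x)) := by
    refine tendsto_integral_filter_of_dominated_convergence (fun x => ‖B x‖) ?_ ?_ hBi.norm ?_
    · exact Eventually.of_forall fun ε =>
        hBi.aestronglyMeasurable.mul (c.contDiff_cutoff ε).continuous.aestronglyMeasurable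
    · refine Eventually.of_forall fun ε => ae_of_all _ fun x => ?_
      rw [norm_mul, Real.norm_eq_abs (c.cutoff ε x), abs_of_nonneg (c.cutoff_nonneg ε x)]
      exact mul_le_of_le_one_right (norm_nonneg _) (c.cutoff_le_one ε x)
    · refine (ae_restrict_iff' hΩ.isOpen.measurableSet).2 (ae_of_all _ fun x hx => ?_)
      by_cases hxs : x ∈ tsupport χ
      · have hh := (c.mem_iff_height (hχd hxs)).1 hx
        refine tendsto_const_nhds.congr' ?_
        have : ∀ᶠ ε : ℝ in 𝓝[>] 0, ε < c.height x / 2 :=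
          (gt_mem_nhds (half_pos hh)).filter_mono nhdsWithin_le_nhds
        filter_upwards [this, self_mem_nhdsWithin] with ε hε hε0
        have hε0 : (0 : ℝ) < ε := hε0
        rw [cutoff, Real.smoothTransition.one_of_one_le, mul_one]
        have : 2 ≤ c.height x / ε := by rw [le_div_iff₀ hε0]; linarith
        linarith
      · have hB0 : B x = 0 := by
          have h0 : ∀ k, pderiv k χ x = 0 := fun k =>
            image_eq_zero_of_notMem_tsupport (fun h => hxs (tsupport_pderiv_subset χ k h))
          simp only [hB, h0, image_eq_zero_of_notMem_tsupport hxs]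
          simp
        simp [hB0]
  have lim2 := (c.tendsto_integral_layer hG hGc).neg
  refine tendsto_nhds_unique lim1 (lim2.congr' ?_)
  filter_upwards [self_mem_nhdsWithin] with ε hε
  exact (key ε hε).symm

/-- The divergence theorem in a boundary chart, localized by `χ`. Since `ρ = height` satisfies
`∂₃ρ = 1` in chart coordinates, `∇ρ dy` is the inward normal times the surface element. -/
lemma chart_identity (hΩ : IsSmoothBoundedDomain Ω) {χ : E3 → ℝ}
    (hχ : ContDiff ℝ ∞ χ) (hχc : HasCompactSupport χ) (hχd : tsupport χ ⊆ c.dom)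
    {F D : Fin 3 → E3 → ℝ} (hF : ∀ k, ContinuousOn (F k) (closure Ω))
    (hD : ∀ k, HasWeakPartial Ω k (F k) (D k)) (hDi : ∀ k, IntegrableOn (D k) Ω) :
    ∫ x in Ω, ((∑ k, D k x) * χ x + ∑ k, F k x * pderiv k χ x) =
      - ∫ y : Fin 2 → ℝ, χ (c.param (y, 0)) *
          ∑ k, F k (c.param (y, 0)) * pderiv k c.height (c.param (y, 0)) := by
  -- Tietze extension of the field to the whole space
  have hext : ∀ k, ∃ g : C(E3, ℝ), ∀ x ∈ closure Ω, g x = F k x := fun k => by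
    obtain ⟨g, hg⟩ := ContinuousMap.exists_restrict_eq (isClosed_closure (s := Ω))
      ⟨_, (hF k).domRestrict⟩
    exact ⟨g, fun x hx => by simpa using DFunLike.congr_fun hg ⟨x, hx⟩⟩
  choose g hg using hext
  have hgΩ : ∀ k, F k =ᵐ[volume.restrict Ω] g k := fun k =>
    (ae_restrict_iff' hΩ.isOpen.measurableSet).2
      (ae_of_all _ fun x hx => (hg k x (subset_closure hx)).symm)
  have := c.chart_identity_of_continuous hΩ hχ hχc hχd (fun k => (g k).continuous)
    (fun k => (hD k).congr hΩ.isOpen (hgΩ k) (ae_eq_refl _)) hDi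
  calc _ = ∫ x in Ω, ((∑ k, D k x) * χ x + ∑ k, g k x * pderiv k χ x) :=
        setIntegral_congr_fun hΩ.isOpen.measurableSet fun x hx => by
          simp only [hg _ x (subset_closure hx)]
    _ = _ := this
    _ = _ := by
        congr 2
        ext y
        by_cases hy : c.param (y, 0) ∈ tsupport χ
        · have : c.param (y, 0) ∈ closure Ω := frontier_subset_closure
            (c.mem_frontier hΩ.isOpen (hχd hy) (by simp))
          simp only [hg _ _ this]
        · simp [image_eq_zero_of_notMem_tsupport hy]

end BoundaryChart

/-! ### Density of smooth functions in `H¹` -/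

lemma BoundaryPartition.pderiv_sum_eq_zero {Ω : Set E3} (P : BoundaryPartition Ω) (hΩ : IsOpen Ω)
    {x : E3} (hx : x ∈ Ω) (k : Fin 3) :
    pderiv k P.χ₀ x + ∑ i, pderiv k (P.χ i) x = 0 := by
  have h1 : HasFDerivAt (fun y => P.χ₀ y + ∑ i, P.χ i y)
      (fderiv ℝ P.χ₀ x + ∑ i, fderiv ℝ (P.χ i) x) x :=
    ((P.contDiff_χ₀.differentiable (by simp) x).hasFDerivAt).add
      (HasFDerivAt.fun_sum fun i _ => ((P.contDiff_χ i).differentiable (by simp) x).hasFDerivAt)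
  have h2 : HasFDerivAt (fun y => P.χ₀ y + ∑ i, P.χ i y) (0 : E3 →L[ℝ] ℝ) x := by
    refine (hasFDerivAt_const (1 : ℝ) x).congr_of_eventuallyEq ?_
    filter_upwards [hΩ.mem_nhds hx] with y hy
    exact P.sum_eq_one y (subset_closure hy)
  have := congrArg (fun L : E3 →L[ℝ] ℝ => L (basisVec k)) (h1.unique h2)
  simpa using this

/-- On `Ω`, the mollification of `χ f`, extended by zero outside `Ω`, is differentiated by
differentiating `χ f`, as long as the mollifier at the point in question only sees points of `Ω`. -/
lemma pderiv_conv {Ω : Set E3} (hΩ : IsOpen Ω) {k : Fin 3} {f v χ κ : E3 → ℝ}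
    (hf : HasWeakPartial Ω k f v) (hfi : IntegrableOn f Ω) (hχ : ContDiff ℝ ∞ χ) (hχc : HasCompactSupport χ)
    (hκ : ContDiff ℝ ∞ κ) (hκc : HasCompactSupport κ)
    (hloc : LocallyIntegrable (Ω.indicator fun t => χ t * f t) volume) {x : E3}
    (hx : tsupport (fun t => χ t * κ (x - t)) ⊆ Ω) :
    pderiv k (conv (Ω.indicator fun t => χ t * f t) κ) x =
      conv (Ω.indicator fun t => pderiv k χ t * f t + χ t * v t) κ x := by
  have hder := hκc.hasFDerivAt_convolution_right (ContinuousLinearMap.mul ℝ ℝ) hloc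
    (hκ.of_le (by simp)) x
  have e1 : pderiv k (conv (Ω.indicator fun t => χ t * f t) κ) x =
      ∫ t, (Ω.indicator (fun t => χ t * f t) t) * pderiv k κ (x - t) := by
    rw [pderiv, hder.fderiv, convolution_precompR_apply (ContinuousLinearMap.mul ℝ ℝ) hloc
      (hκc.fderiv (𝕜 := ℝ)) (hκ.continuous_fderiv (by simp))]
    rfl
  have hsub : ContDiff ℝ ∞ fun t => κ (x - t) := hκ.comp (contDiff_const.sub contDiff_id)
  set ψ : E3 → ℝ := fun t => χ t * κ (x - t) with hψ
  have hψs : ContDiff ℝ ∞ ψ := hχ.mul hsub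
  have hψc : HasCompactSupport ψ := hχc.mul_right
  have hpd : ∀ t, pderiv k ψ t = pderiv k χ t * κ (x - t) - χ t * pderiv k κ (x - t) := by
    intro t
    have h1 := pderiv_mul (hχ.differentiable (by simp) t) (hsub.differentiable (by simp) t) k
    have h2 : pderiv k (fun t => κ (x - t)) t = - pderiv k κ (x - t) := by
      have : HasFDerivAt (fun t => κ (x - t)) _ t :=
        ((hκ.differentiable (by simp) (x - t)).hasFDerivAt).comp t
          ((hasFDerivAt_id t).const_sub x)
      rw [pderiv, HasFDerivAt.fderiv this]
      simp [pderiv]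
    rw [hψ, h1, h2]; ring
  have i1 := hf.integrable_mul_pderiv hψs hψc hx k
  have i2 := hf.integrable_mul hψs hψc hx
  have i3 : IntegrableOn (fun t => f t * (pderiv k χ t * κ (x - t))) Ω := by
    have hcs : HasCompactSupport fun t => pderiv k χ t * κ (x - t) :=
      (hasCompactSupport_pderiv hχc k).mul_right
    have hcont : Continuous fun t => pderiv k χ t * κ (x - t) :=
      (continuous_pderiv hχ k).mul hsub.continuous
    obtain ⟨M, hM⟩ := hcs.exists_bound_of_continuous hcont
    exact hfi.mul_bdd hcont.aestronglyMeasurable (ae_of_all _ hM)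
  have ei := hf.integral_eq ψ hψs hψc hx
  rw [e1]
  have e2 : ∫ t, (Ω.indicator (fun t => χ t * f t) t) * pderiv k κ (x - t) =
      ∫ t in Ω, χ t * f t * pderiv k κ (x - t) := by
    rw [← integral_indicator hΩ.measurableSet]
    congr 1; ext t
    by_cases ht : t ∈ Ω <;> simp [ht]
  have e3 : conv (Ω.indicator fun t => pderiv k χ t * f t + χ t * v t) κ x =
      ∫ t in Ω, (pderiv k χ t * f t + χ t * v t) * κ (x - t) := by
    rw [← integral_indicator hΩ.measurableSet]
    refine integral_congr_ae (ae_of_all _ fun t => ?_)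
    by_cases ht : t ∈ Ω <;> simp [ht, add_mul]
  rw [e2, e3]
  calc ∫ t in Ω, χ t * f t * pderiv k κ (x - t)
      = ∫ t in Ω, (f t * (pderiv k χ t * κ (x - t)) - f t * pderiv k ψ t) := by
        congr 1; ext t; rw [hpd]; ring
    _ = ∫ t in Ω, (f t * (pderiv k χ t * κ (x - t)) + v t * ψ t) := by
        rw [integral_sub i3 i1, integral_add i3 i2]
        have : ∫ t in Ω, f t * pderiv k ψ t = - ∫ t in Ω, v t * ψ t := ei
        rw [this]; ring
    _ = _ := by congr 1; ext t; rw [hψ]; ring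

/-- `u` is the `H¹(Ω)`-limit of smooth functions on the whole space, with weak gradient `v`. -/
def SmoothlyApproximable (Ω : Set E3) (u : E3 → ℝ) (v : Fin 3 → E3 → ℝ) : Prop :=
  MemLp u 2 (volume.restrict Ω) ∧ (∀ k, MemLp (v k) 2 (volume.restrict Ω)) ∧
  ∃ φ : ℕ → E3 → ℝ, (∀ n, ContDiff ℝ ∞ (φ n)) ∧ (∀ n, HasCompactSupport (φ n)) ∧
    Tendsto (fun n => eLpNorm (fun x => φ n x - u x) 2 (volume.restrict Ω)) atTop (𝓝 0) ∧
    ∀ k, Tendsto (fun n => eLpNorm (fun x => pderiv k (φ n) x - v k x) 2 (volume.restrict Ω))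
      atTop (𝓝 0)

namespace SmoothlyApproximable

variable {Ω : Set E3}

lemma zero : SmoothlyApproximable Ω (fun _ => 0) fun _ _ => 0 :=
  ⟨by simp, by simp, fun _ _ => 0, fun _ => contDiff_const, fun _ => HasCompactSupport.zero,
    by simp, by simp [pderiv]⟩

lemma add {u u' : E3 → ℝ} {v v' : Fin 3 → E3 → ℝ} (h : SmoothlyApproximable Ω u v)
    (h' : SmoothlyApproximable Ω u' v') :
    SmoothlyApproximable Ω (fun x => u x + u' x) fun k x => v k x + v' k x := by
  obtain ⟨hu, hv, φ, hφ, hφc, h1, h2⟩ := h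
  obtain ⟨hu', hv', φ', hφ', hφc', h1', h2'⟩ := h'
  have m : ∀ {φ : E3 → ℝ}, ContDiff ℝ ∞ φ → HasCompactSupport φ →
      MemLp φ 2 (volume.restrict Ω) := fun hφ hc =>
    memLp_restrict_of_continuous_hasCompactSupport hφ.continuous hc
  have m' : ∀ {φ : E3 → ℝ} (k : Fin 3), ContDiff ℝ ∞ φ → HasCompactSupport φ →
      MemLp (pderiv k φ) 2 (volume.restrict Ω) := fun k hφ hc =>
    memLp_restrict_of_continuous_hasCompactSupport (continuous_pderiv hφ k)
      (hasCompactSupport_pderiv hc k)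
  refine ⟨hu.add hu', fun k => (hv k).add (hv' k), fun n x => φ n x + φ' n x,
    fun n => (hφ n).add (hφ' n), fun n => (hφc n).add (hφc' n),
    tendsto_L2_add hu (fun n => m (hφ n) (hφc n)) hu' (fun n => m (hφ' n) (hφc' n)) h1 h1',
    fun k => ?_⟩
  have := tendsto_L2_add (hv k) (fun n => m' k (hφ n) (hφc n)) (hv' k)
    (fun n => m' k (hφ' n) (hφc' n)) (h2 k) (h2' k)
  refine this.congr fun n => ?_
  congr 1; ext x
  have : pderiv k (fun x => φ n x + φ' n x) x = pderiv k (φ n) x + pderiv k (φ' n) x := by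
    simp only [pderiv]
    rw [fderiv_fun_add ((hφ n).differentiable (by simp) x) ((hφ' n).differentiable (by simp) x)]
    rfl
  rw [this]

lemma sum {ι : Type*} (s : Finset ι) {u : ι → E3 → ℝ} {v : ι → Fin 3 → E3 → ℝ}
    (h : ∀ i ∈ s, SmoothlyApproximable Ω (u i) (v i)) :
    SmoothlyApproximable Ω (fun x => ∑ i ∈ s, u i x) fun k x => ∑ i ∈ s, v i k x := by
  classical
  induction s using Finset.induction_on with
  | empty => simpa using zero
  | insert a s ha ih =>
    simp only [Finset.sum_insert ha]
    exact (h a (Finset.mem_insert_self a s)).add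
      (ih fun i hi => h i (Finset.mem_insert_of_mem hi))

lemma congr {u u' : E3 → ℝ} {v v' : Fin 3 → E3 → ℝ} (h : SmoothlyApproximable Ω u v)
    (hu : u =ᵐ[volume.restrict Ω] u') (hv : ∀ k, v k =ᵐ[volume.restrict Ω] v' k) :
    SmoothlyApproximable Ω u' v' := by
  obtain ⟨h0, h1, φ, hφ, hφc, h2, h3⟩ := h
  refine ⟨h0.ae_eq hu, fun k => (h1 k).ae_eq (hv k), φ, hφ, hφc, h2.congr fun n => ?_,
    fun k => (h3 k).congr fun n => ?_⟩
  · exact eLpNorm_congr_ae (by filter_upwards [hu] with x hx; rw [hx])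
  · exact eLpNorm_congr_ae (by filter_upwards [hv k] with x hx; rw [hx])

/-- If all points of `tsupport χ` in the shifted ball `closedBall (x + ε a) ε` belong to `Ω`
whenever `x` does, then mollifying `χ f` with bumps supported in that ball gives smooth
approximations up to the boundary. -/
lemma of_cone (hΩ : IsOpen Ω) [IsFiniteMeasure (volume.restrict Ω)] {f : E3 → ℝ}
    {v : Fin 3 → E3 → ℝ} (hf : MemLp f 2 (volume.restrict Ω))
    (hv : ∀ k, MemLp (v k) 2 (volume.restrict Ω)) (hfv : ∀ k, HasWeakPartial Ω k f (v k))
    {χ : E3 → ℝ} (hχ : ContDiff ℝ ∞ χ) (hχc : HasCompactSupport χ) (a : E3) {ε₀ : ℝ}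
    (hε₀ : 0 < ε₀) (hcone : ∀ ε, 0 < ε → ε < ε₀ → ∀ x ∈ Ω, ∀ t ∈ tsupport χ,
      dist t (x + ε • a) ≤ ε → t ∈ Ω) :
    SmoothlyApproximable Ω (fun x => χ x * f x)
      fun k x => pderiv k χ x * f x + χ x * v k x := by
  have bdd : ∀ {w g : E3 → ℝ}, Continuous w → HasCompactSupport w →
      MemLp g 2 (volume.restrict Ω) → MemLp (fun x => w x * g x) 2 (volume.restrict Ω) := by
    intro w g hw hwc hg
    exact hg.mul (p := ⊤) (q := 2) (memLp_restrict_of_continuous_hasCompactSupport hw hwc)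
  have hu : MemLp (fun x => χ x * f x) 2 (volume.restrict Ω) := bdd hχ.continuous hχc hf
  have hw : ∀ k, MemLp (fun x => pderiv k χ x * f x + χ x * v k x) 2 (volume.restrict Ω) :=
    fun k => (bdd (continuous_pderiv hχ k) (hasCompactSupport_pderiv hχc k) hf).add
      (bdd hχ.continuous hχc (hv k))
  have hu' := (memLp_indicator_iff_restrict hΩ.measurableSet).2 hu
  have hw' := fun k => (memLp_indicator_iff_restrict hΩ.measurableSet).2 (hw k)
  set ε : ℕ → ℝ := fun n => ε₀ / (n + 2) with hε
  have hεpos : ∀ n, 0 < ε n := fun n => by positivity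
  have hεlt : ∀ n, ε n < ε₀ := fun n => by
    rw [hε]; simp only
    rw [div_lt_iff₀ (by positivity)]
    have : (0 : ℝ) ≤ n := n.cast_nonneg
    nlinarith
  have hεt : Tendsto ε atTop (𝓝 0) := by
    have h1 : Tendsto (fun n : ℕ => (n : ℝ) + 2) atTop atTop :=
      tendsto_atTop_add_const_right _ _ tendsto_natCast_atTop_atTop
    exact h1.const_div_atTop ε₀
  -- kernels centred at `-ε a`, so that the mollified function at `x` sees only points near `x + ε a`
  let bump : ∀ n, ContDiffBump (-(ε n • a)) := fun n =>
    ⟨ε n / 2, ε n, half_pos (hεpos n), half_lt_self (hεpos n)⟩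
  set κ : ℕ → E3 → ℝ := fun n => (bump n).normed volume with hκ
  have hκs : ∀ n, ContDiff ℝ ∞ (κ n) := fun n => (bump n).contDiff_normed
  have hκc : ∀ n, HasCompactSupport (κ n) := fun n => (bump n).hasCompactSupport_normed
  have hκ0 : ∀ n x, 0 ≤ κ n x := fun n x => (bump n).nonneg_normed x
  have hκ1 : ∀ n, ∫ x, κ n x = 1 := fun n => (bump n).integral_normed
  have hδ : Tendsto (fun n => ε n * (1 + ‖a‖)) atTop (𝓝 0) := by
    simpa using hεt.mul_const (1 + ‖a‖)
  have hsupp : ∀ n t, κ n t ≠ 0 → ‖t + ε n • a‖ ≤ ε n := by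
    intro n t ht
    have : t ∈ Function.support ((bump n).normed volume) := ht
    rw [(bump n).support_normed_eq, Metric.mem_ball, dist_eq_norm, sub_neg_eq_add] at this
    exact this.le
  have hs : ∀ n t, κ n t ≠ 0 → ‖t‖ ≤ ε n * (1 + ‖a‖) := by
    intro n t ht
    calc ‖t‖ = ‖(t + ε n • a) - ε n • a‖ := by rw [add_sub_cancel_right]
      _ ≤ ‖t + ε n • a‖ + ‖ε n • a‖ := norm_sub_le _ _
      _ ≤ ε n + ε n * ‖a‖ := by
          rw [norm_smul, Real.norm_of_nonneg (hεpos n).le]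
          linarith [hsupp n t ht]
      _ = _ := by ring
  have hloc := hu'.locallyIntegrable (by norm_num)
  have res : ∀ {h : E3 → ℝ}, Tendsto (fun n => eLpNorm (fun x => conv (Ω.indicator h) (κ n) x -
      Ω.indicator h x) 2 volume) atTop (𝓝 0) → Tendsto (fun n => eLpNorm (fun x =>
      conv (Ω.indicator h) (κ n) x - h x) 2 (volume.restrict Ω)) atTop (𝓝 0) := by
    intro h hh
    refine tendsto_of_tendsto_of_tendsto_of_le_of_le tendsto_const_nhds hh (fun n => zero_le) ?_
    intro n
    have : eLpNorm (fun x => conv (Ω.indicator h) (κ n) x - h x) 2 (volume.restrict Ω) =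
        eLpNorm (fun x => conv (Ω.indicator h) (κ n) x - Ω.indicator h x) 2
          (volume.restrict Ω) :=
      eLpNorm_congr_ae ((ae_restrict_iff' hΩ.measurableSet).2 (ae_of_all _ fun x hx => by
        simp [hx]))
    simp only
    rw [this]
    exact eLpNorm_mono_measure _ Measure.restrict_le_self
  have hindc : HasCompactSupport (Ω.indicator fun x => χ x * f x) :=
    HasCompactSupport.intro hχc fun x hx => by
      by_cases hxΩ : x ∈ Ω <;> simp [hxΩ, image_eq_zero_of_notMem_tsupport hx]
  refine ⟨hu, hw, fun n => conv (Ω.indicator fun x => χ x * f x) (κ n), fun n => ?_, fun n => ?_,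
    ?_, fun k => ?_⟩
  · exact (hκc n).contDiff_convolution_right (n := ⊤) _ hloc (hκs n)
  · exact hindc.convolution _ (hκc n)
  · exact res (tendsto_conv_L2 hu' (fun n => (hκs n).continuous) hκc hκ0 hκ1 hδ hs)
  · have := res (tendsto_conv_L2 (hw' k) (fun n => (hκs n).continuous) hκc hκ0 hκ1 hδ hs)
    refine this.congr fun n => ?_
    refine eLpNorm_congr_ae ((ae_restrict_iff' hΩ.measurableSet).2 (ae_of_all _ fun x hx => ?_))
    simp only
    rw [pderiv_conv hΩ (hfv k) (hf.integrable (by norm_num)) hχ hχc (hκs n) (hκc n) hloc]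
    have hcl : IsClosed (tsupport χ ∩ {t | dist t (x + ε n • a) ≤ ε n}) :=
      (isClosed_tsupport χ).inter (isClosed_le (by fun_prop) continuous_const)
    have hsub : Function.support (fun t => χ t * κ n (x - t)) ⊆
        tsupport χ ∩ {t | dist t (x + ε n • a) ≤ ε n} := fun t ht => by
      refine ⟨subset_tsupport χ (left_ne_zero_of_mul ht), ?_⟩
      have := hsupp n _ (right_ne_zero_of_mul ht)
      rw [Set.mem_ofPred_eq, dist_comm, dist_eq_norm]
      rwa [show x + ε n • a - t = x - t + ε n • a by abel]
    intro t ht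
    have ht' := closure_minimal hsub hcl ht
    exact hcone _ (hεpos n) (hεlt n) x hx t ht'.1 ht'.2

end SmoothlyApproximable

/-- Uniform interior cone property: moving up by `ε L`, with `L` a Lipschitz constant of the height,
keeps the ball of radius `ε` inside `Ω`. -/
lemma BoundaryChart.exists_cone {Ω : Set E3} (c : BoundaryChart Ω) {K : Set E3} (hK : IsCompact K)
    (hKd : K ⊆ c.dom) : ∃ (a : E3) (ε₀ : ℝ), 0 < ε₀ ∧ ∀ ε, 0 < ε → ε < ε₀ → ∀ x ∈ Ω, ∀ t ∈ K,
      dist t (x + ε • a) ≤ ε → t ∈ Ω := by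
  obtain ⟨δ, hδ, hδd⟩ := hK.exists_cthickening_subset_open c.isOpen_dom hKd
  obtain ⟨L, hL⟩ := LocallyLipschitzOn.exists_lipschitzOnWith_of_compact
    (hK.cthickening (r := δ))
    ((c.contDiff_height.of_le (by simp)).locallyLipschitz.locallyLipschitzOn
      (s := Metric.cthickening δ K))
  have hup : ‖c.up‖ = 1 := by simp [up]
  have hL0 : (0 : ℝ) ≤ L := L.2
  refine ⟨(L : ℝ) • c.up, δ / (L + 1), by positivity, fun ε hε hε₀ x hx t ht htx => ?_⟩
  rw [lt_div_iff₀ (by positivity)] at hε₀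
  have hn : ‖ε • (L : ℝ) • c.up‖ = ε * L := by
    rw [norm_smul, norm_smul, hup, Real.norm_of_nonneg hε.le, Real.norm_of_nonneg hL0, mul_one]
  have hz : dist (t - ε • (L : ℝ) • c.up) x ≤ ε := by
    rw [dist_eq_norm] at htx ⊢
    convert htx using 2; abel
  have hx1 : x ∈ Metric.cthickening δ K := Metric.mem_cthickening_of_dist_le x t δ K ht (by
    calc dist x t ≤ dist x (x + ε • (L : ℝ) • c.up) + dist (x + ε • (L : ℝ) • c.up) t :=
          dist_triangle _ _ _
      _ ≤ ε * L + ε := by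
          rw [dist_self_add_right, hn, dist_comm _ t]; linarith
      _ ≤ δ := by linarith)
  have hz1 : t - ε • (L : ℝ) • c.up ∈ Metric.cthickening δ K :=
    Metric.mem_cthickening_of_dist_le _ t δ K ht (by
      rw [dist_comm, dist_self_sub_right, hn]; linarith)
  have h1 := hL.dist_le_mul _ hz1 _ hx1
  have h2 : c.height t = c.height (t - ε • (L : ℝ) • c.up) + ε * L := by
    rw [← c.height_add_smul_up]; congr 1; rw [smul_smul]; abel
  have h3 := (c.mem_iff_height (hδd hx1)).1 hx
  rw [Real.dist_eq] at h1
  have h4 := neg_abs_le (c.height (t - ε • (L : ℝ) • c.up) - c.height x)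
  have h5 : (L : ℝ) * dist (t - ε • (L : ℝ) • c.up) x ≤ L * ε := by gcongr
  refine (c.mem_iff_height (hKd ht)).2 ?_
  linarith

/-- **Density of smooth functions.** On a smooth bounded domain, every `H¹` function is an `H¹` limit
of smooth functions on the whole space. -/
theorem IsSmoothBoundedDomain.smoothlyApproximable {Ω : Set E3} (hΩ : IsSmoothBoundedDomain Ω)
    {f : E3 → ℝ} {v : Fin 3 → E3 → ℝ} (hf : MemLp f 2 (volume.restrict Ω))
    (hv : ∀ k, MemLp (v k) 2 (volume.restrict Ω)) (hfv : ∀ k, HasWeakPartial Ω k f (v k)) :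
    SmoothlyApproximable Ω f v := by
  have := hΩ.isFiniteMeasure
  obtain ⟨P⟩ := hΩ.nonempty_boundaryPartition
  have h0 : SmoothlyApproximable Ω _ _ := SmoothlyApproximable.of_cone hΩ.isOpen hf hv hfv
    P.contDiff_χ₀ P.hasCompactSupport_χ₀ 0 one_pos
    fun _ _ _ _ _ t ht _ => P.tsupport_χ₀ ht
  have h1 : ∀ i, SmoothlyApproximable Ω (fun x => P.χ i x * f x)
      fun k x => pderiv k (P.χ i) x * f x + P.χ i x * v k x := fun i => by
    obtain ⟨a, ε₀, hε₀, h⟩ := (P.chart i).exists_cone (P.hasCompactSupport_χ i) (P.tsupport_χ i)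
    exact SmoothlyApproximable.of_cone hΩ.isOpen hf hv hfv (P.contDiff_χ i)
      (P.hasCompactSupport_χ i) a hε₀ h
  refine (h0.add (SmoothlyApproximable.sum Finset.univ fun i _ => h1 i)).congr ?_ fun k => ?_
  · refine (ae_restrict_iff' hΩ.isOpen.measurableSet).2 (ae_of_all _ fun x hx => ?_)
    beta_reduce
    rw [← Finset.sum_mul, ← add_mul, P.sum_eq_one x (subset_closure hx), one_mul]
  · refine (ae_restrict_iff' hΩ.isOpen.measurableSet).2 (ae_of_all _ fun x hx => ?_)
    have e1 := P.sum_eq_one x (subset_closure hx)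
    have e2 := P.pderiv_sum_eq_zero hΩ.isOpen hx k
    calc _ = (pderiv k P.χ₀ x + ∑ i, pderiv k (P.χ i) x) * f x +
          (P.χ₀ x + ∑ i, P.χ i x) * v k x := by
          beta_reduce
          rw [Finset.sum_add_distrib, ← Finset.sum_mul, ← Finset.sum_mul]; ring
      _ = _ := by rw [e1, e2]; ring

/-! ### The trace inequality -/

lemma sum_mul_basisVec (v : E3) : ∑ k, v k • basisVec k = v := by
  ext i
  fin_cases i <;> simp [Fin.sum_univ_three, basisVec]

lemma sum_coord_mul_fderiv (L : E3 →L[ℝ] ℝ) (v : E3) : ∑ k, v k * L (basisVec k) = L v := by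
  conv_rhs => rw [← sum_mul_basisVec v]
  simp

lemma ofReal_integral_sq {α : Type*} [MeasurableSpace α] {μ : Measure α} {w : α → ℝ}
    (hw : MemLp w 2 μ) : ENNReal.ofReal (∫ x, w x ^ 2 ∂μ) = eLpNorm w 2 μ ^ 2 := by
  rw [ofReal_integral_eq_lintegral_ofReal hw.integrable_sq (ae_of_all _ fun x => sq_nonneg _),
    eLpNorm_eq_lintegral_rpow_enorm_toReal (by norm_num) (by norm_num), ← ENNReal.rpow_natCast,
    ← ENNReal.rpow_mul]
  simp only [ENNReal.toReal_ofNat, Nat.cast_ofNat]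
  rw [show (1 / 2 * 2 : ℝ) = 1 by norm_num, ENNReal.rpow_one]
  congr 1; ext x
  rw [Real.enorm_eq_ofReal_abs, ENNReal.ofReal_rpow_of_nonneg (abs_nonneg _) (by norm_num)]
  simp

lemma lintegral_ofReal_sq {α : Type*} [MeasurableSpace α] {μ : Measure α} (w : α → ℝ) :
    ∫⁻ x, ENNReal.ofReal (w x ^ 2) ∂μ = eLpNorm w 2 μ ^ 2 := by
  rw [eLpNorm_eq_lintegral_rpow_enorm_toReal (by norm_num) (by norm_num), ← ENNReal.rpow_natCast,
    ← ENNReal.rpow_mul]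
  simp only [ENNReal.toReal_ofNat, Nat.cast_ofNat]
  rw [show (1 / 2 * 2 : ℝ) = 1 by norm_num, ENNReal.rpow_one]
  congr 1; ext x
  rw [Real.enorm_eq_ofReal_abs, ENNReal.ofReal_rpow_of_nonneg (abs_nonneg _) (by norm_num)]
  simp

/-- Surface measure on a compact part of a chart is at most a constant times the area of the
horizontal projection. -/
lemma BoundaryChart.exists_surfaceMeasure_le {Ω : Set E3} (c : BoundaryChart Ω) (hΩ : IsOpen Ω)
    {K : Set E3} (hK : IsCompact K) (hKd : K ⊆ c.dom) :
    ∃ C : NNReal, surfaceMeasure.restrict (frontier Ω ∩ K) ≤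
      C • Measure.map (fun y => c.param (y, 0)) volume := by
  obtain ⟨C, hC⟩ := c.exists_hausdorff_le_map hΩ hK hKd
  refine ⟨Real.toNNReal (Real.pi / 4) * C, ?_⟩
  refine Measure.le_iff.2 fun T hT => ?_
  rw [surfaceMeasure, Measure.restrict_smul, mul_smul, Measure.smul_apply, Measure.smul_apply,
    ENNReal.smul_def, smul_eq_mul, smul_eq_mul]
  exact mul_le_mul_right (Measure.le_iff.1 hC T hT) _

namespace IsSmoothBoundedDomain

variable {Ω : Set E3}

/-- In a chart, the integral of `χ φ²` over the graph is the flux of `χ φ² e₃`, hence controlled by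
the `H¹` norm of `φ`. -/
lemma exists_chart_trace_bound (hΩ : IsSmoothBoundedDomain Ω) (c : BoundaryChart Ω) {χ : E3 → ℝ}
    (hχ : ContDiff ℝ ∞ χ) (hχc : HasCompactSupport χ) (hχd : tsupport χ ⊆ c.dom) :
    ∃ C : ℝ, 0 ≤ C ∧ ∀ φ : E3 → ℝ, ContDiff ℝ ∞ φ → HasCompactSupport φ →
      ∫ y : Fin 2 → ℝ, χ (c.param (y, 0)) * φ (c.param (y, 0)) ^ 2 ≤
        C * ∫ x in Ω, (φ x ^ 2 + ∑ k, pderiv k φ x ^ 2) := by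
  obtain ⟨M, hM⟩ := hχc.exists_bound_of_continuous hχ.continuous
  have hM' : ∀ k, ∃ M, ∀ x, ‖pderiv k χ x‖ ≤ M := fun k =>
    (hasCompactSupport_pderiv hχc k).exists_bound_of_continuous (continuous_pderiv hχ k)
  choose N hN using hM'
  have hM0 : 0 ≤ M := (norm_nonneg _).trans (hM 0)
  have hN0 : ∀ k, 0 ≤ N k := fun k => (norm_nonneg _).trans (hN k 0)
  have hup : ‖c.up‖ = 1 := by simp [BoundaryChart.up]
  have hupk : ∀ k, |c.up k| ≤ 1 := fun k => by
    rw [← hup]; exact PiLp.norm_apply_le c.up k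
  refine ⟨3 * M + ∑ k, N k, add_nonneg (by positivity) (Finset.sum_nonneg fun k _ => hN0 k),
    fun φ hφ hφc => ?_⟩
  set F : Fin 3 → E3 → ℝ := fun k x => c.up k * φ x ^ 2
  have hFs : ∀ k, ContDiff ℝ ∞ (F k) := fun k => contDiff_const.mul (hφ.pow 2)
  have hFc : ∀ k, HasCompactSupport (F k) := fun k => by
    have : HasCompactSupport fun x => φ x ^ 2 := by
      simp only [pow_two]; exact hφc.mul_left
    exact this.mul_left
  have hpF : ∀ k x, pderiv k (F k) x = c.up k * (2 * φ x * pderiv k φ x) := fun k x => by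
    have h1 : HasFDerivAt (F k) _ x :=
      ((hφ.differentiable (by simp) x).hasFDerivAt.pow 2).const_mul (c.up k)
    rw [pderiv, h1.fderiv]; simp [pderiv]
  have key := c.chart_identity hΩ hχ hχc hχd (F := F) (D := fun k => pderiv k (F k))
    (fun k => (hFs k).continuous.continuousOn)
    (fun k => HasWeakPartial.of_contDiffOn hΩ.isOpen ((hFs k).of_le (by simp)).contDiffOn k)
    (fun k => ((continuous_pderiv (hFs k) k).integrable_of_hasCompactSupport
      (hasCompactSupport_pderiv (hFc k) k)).integrableOn)
  -- `e₃·∇ρ = 1`, so the flux of `φ² e₃` has density `φ²` with respect to `dy`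
  have e1 : ∀ y : Fin 2 → ℝ, χ (c.param (y, 0)) * φ (c.param (y, 0)) ^ 2 =
      χ (c.param (y, 0)) * ∑ k, F k (c.param (y, 0)) * pderiv k c.height (c.param (y, 0)) := by
    intro y
    have h1 := sum_coord_mul_fderiv (fderiv ℝ c.height (c.param (y, 0))) c.up
    rw [c.fderiv_height_up] at h1
    calc _ = χ (c.param (y, 0)) * (φ (c.param (y, 0)) ^ 2 *
          ∑ k, c.up k * fderiv ℝ c.height (c.param (y, 0)) (basisVec k)) := by rw [h1, mul_one]
      _ = _ := by
          rw [Finset.mul_sum]; congr 1; refine Finset.sum_congr rfl fun k _ => ?_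
          simp only [F, pderiv]; ring
  rw [integral_congr_ae (ae_of_all _ e1), ← neg_eq_iff_eq_neg.2 key, ← integral_neg,
    ← integral_const_mul]
  have hφ2 : Continuous fun x => φ x ^ 2 + ∑ k, pderiv k φ x ^ 2 :=
    (hφ.continuous.pow 2).add (continuous_finsetSum _ fun k _ => (continuous_pderiv hφ k).pow 2)
  have hφ2c : HasCompactSupport fun x => φ x ^ 2 + ∑ k, pderiv k φ x ^ 2 :=
    HasCompactSupport.intro hφc fun x hx => by
      have : ∀ k, pderiv k φ x = 0 := fun k =>
        image_eq_zero_of_notMem_tsupport fun h => hx (tsupport_pderiv_subset φ k h)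
      simp [image_eq_zero_of_notMem_tsupport hx, this]
  refine integral_mono ?_ ((hφ2.integrable_of_hasCompactSupport hφ2c).integrableOn.const_mul _) ?_
  · refine Integrable.neg (Continuous.integrable_of_hasCompactSupport (μ := volume) ?_ ?_).integrableOn
    · exact (Continuous.mul (continuous_finsetSum _ fun k _ => continuous_pderiv (hFs k) k)
        hχ.continuous).add (continuous_finsetSum _ fun k _ =>
          (hFs k).continuous.mul (continuous_pderiv hχ k))
    · refine HasCompactSupport.intro hχc fun x hx => ?_
      have : ∀ k, pderiv k χ x = 0 := fun k =>
        image_eq_zero_of_notMem_tsupport fun h => hx (tsupport_pderiv_subset χ k h)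
      simp [image_eq_zero_of_notMem_tsupport hx, this]
  · intro x
    simp only [hpF]
    set q := φ x
    set p := fun k => pderiv k φ x with hp
    set S := ∑ k, p k ^ 2 with hS
    have hS0 : 0 ≤ S := Finset.sum_nonneg fun k _ => sq_nonneg _
    have t1 : ∀ k, -(c.up k * (2 * q * p k) * χ x) ≤ M * (q ^ 2 + p k ^ 2) := fun k => by
      have h1 : |c.up k * (2 * q * p k) * χ x| ≤ 1 * (q ^ 2 + p k ^ 2) * M := by
        rw [abs_mul, abs_mul]
        have := hM x
        rw [Real.norm_eq_abs] at this
        have h2 : |2 * q * p k| ≤ q ^ 2 + p k ^ 2 := by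
          rw [abs_le]; constructor <;> nlinarith [sq_nonneg (q + p k), sq_nonneg (q - p k)]
        gcongr
        exact hupk k
      linarith [neg_abs_le (c.up k * (2 * q * p k) * χ x)]
    have t2 : ∀ k, -(c.up k * q ^ 2 * pderiv k χ x) ≤ N k * q ^ 2 := fun k => by
      have h1 : |c.up k * q ^ 2 * pderiv k χ x| ≤ 1 * q ^ 2 * N k := by
        rw [abs_mul, abs_mul, abs_of_nonneg (sq_nonneg q)]
        have := hN k x
        rw [Real.norm_eq_abs] at this
        gcongr
        exact hupk k
      linarith [neg_abs_le (c.up k * q ^ 2 * pderiv k χ x)]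
    have s1 := Finset.sum_le_sum fun k (_ : k ∈ Finset.univ) => t1 k
    have s2 := Finset.sum_le_sum fun k (_ : k ∈ Finset.univ) => t2 k
    calc -((∑ k, c.up k * (2 * q * p k)) * χ x + ∑ k, c.up k * q ^ 2 * pderiv k χ x)
        = ∑ k, -(c.up k * (2 * q * p k) * χ x) + ∑ k, -(c.up k * q ^ 2 * pderiv k χ x) := by
          rw [Finset.sum_mul, Finset.sum_neg_distrib, Finset.sum_neg_distrib]; ring
      _ ≤ ∑ k, M * (q ^ 2 + p k ^ 2) + ∑ k, N k * q ^ 2 := add_le_add s1 s2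
      _ = M * (3 * q ^ 2 + S) + (∑ k, N k) * q ^ 2 := by
          rw [← Finset.mul_sum, ← Finset.sum_mul, Finset.sum_add_distrib]; simp [hS]
      _ ≤ (3 * M + ∑ k, N k) * (q ^ 2 + S) := by
          have : 0 ≤ ∑ k, N k := Finset.sum_nonneg fun k _ => hN0 k
          nlinarith [mul_nonneg this hS0, mul_nonneg hM0 hS0]

/-- **Trace inequality** for smooth functions. -/
theorem exists_trace_bound (hΩ : IsSmoothBoundedDomain Ω) :
    ∃ C : ℝ, 0 ≤ C ∧ ∀ φ : E3 → ℝ, ContDiff ℝ ∞ φ → HasCompactSupport φ →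
      eLpNorm φ 2 (surfaceMeasure.restrict (frontier Ω)) ^ 2 ≤
        ENNReal.ofReal (C * ∫ x in Ω, (φ x ^ 2 + ∑ k, pderiv k φ x ^ 2)) := by
  obtain ⟨P⟩ := hΩ.nonempty_boundaryPartition
  choose C hC0 hC using fun i => hΩ.exists_chart_trace_bound (P.chart i) (P.contDiff_χ i)
    (P.hasCompactSupport_χ i) (P.tsupport_χ i)
  choose L hL using fun i => (P.chart i).exists_surfaceMeasure_le hΩ.isOpen
    (P.hasCompactSupport_χ i) (P.tsupport_χ i)
  refine ⟨∑ i, L i * C i, Finset.sum_nonneg fun i _ => mul_nonneg (L i).2 (hC0 i),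
    fun φ hφ hφc => ?_⟩
  rw [← lintegral_ofReal_sq]
  have hfm : MeasurableSet (frontier Ω) := isClosed_frontier.measurableSet
  have hpt : ∀ x ∈ frontier Ω, ENNReal.ofReal (φ x ^ 2) =
      ∑ i, ENNReal.ofReal (P.χ i x * φ x ^ 2) := by
    intro x hx
    have hx0 : P.χ₀ x = 0 := P.χ₀_eq_zero fun h => by
      rw [hΩ.isOpen.frontier_eq] at hx; exact hx.2 h
    have h1 := P.sum_eq_one x (frontier_subset_closure hx)
    rw [hx0, zero_add] at h1
    rw [← ENNReal.ofReal_sum_of_nonneg fun i _ => mul_nonneg (P.nonneg i x) (sq_nonneg _),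
      ← Finset.sum_mul, h1, one_mul]
  have hmeas : ∀ i, Measurable fun x => ENNReal.ofReal (P.χ i x * φ x ^ 2) := fun i =>
    ((P.contDiff_χ i).continuous.mul (hφ.continuous.pow 2)).measurable.ennreal_ofReal
  rw [setLIntegral_congr_fun hfm hpt, lintegral_finsetSum _ fun i _ => hmeas i, Finset.sum_mul,
    ENNReal.ofReal_sum_of_nonneg fun i _ => ?_]
  swap
  · exact mul_nonneg (mul_nonneg (L i).2 (hC0 i))
      (integral_nonneg fun x => add_nonneg (sq_nonneg _) (Finset.sum_nonneg fun k _ => sq_nonneg _))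
  refine Finset.sum_le_sum fun i _ => ?_
  have hpm : Continuous fun y : Fin 2 → ℝ => (P.chart i).param (y, 0) :=
    (P.chart i).continuous_param.comp (by fun_prop)
  have hcont : Continuous fun y : Fin 2 → ℝ => P.χ i ((P.chart i).param (y, 0)) *
      φ ((P.chart i).param (y, 0)) ^ 2 :=
    ((P.contDiff_χ i).continuous.comp hpm).mul ((hφ.continuous.comp hpm).pow 2)
  calc ∫⁻ x in frontier Ω, ENNReal.ofReal (P.χ i x * φ x ^ 2) ∂surfaceMeasure
      = ∫⁻ x in frontier Ω ∩ tsupport (P.χ i), ENNReal.ofReal (P.χ i x * φ x ^ 2)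
          ∂surfaceMeasure := by
        rw [← lintegral_indicator hfm,
          ← lintegral_indicator (hfm.inter (isClosed_tsupport _).measurableSet)]
        congr 1; ext x
        by_cases hx : x ∈ frontier Ω <;> by_cases hx' : x ∈ tsupport (P.χ i) <;>
          simp [hx, hx', image_eq_zero_of_notMem_tsupport]
    _ ≤ ∫⁻ x, ENNReal.ofReal (P.χ i x * φ x ^ 2)
          ∂(L i • Measure.map (fun y => (P.chart i).param (y, 0)) volume) :=
        lintegral_mono' (hL i) le_rfl
    _ = L i * ∫⁻ y, ENNReal.ofReal (P.χ i ((P.chart i).param (y, 0)) *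
          φ ((P.chart i).param (y, 0)) ^ 2) := by
        rw [lintegral_smul_measure, lintegral_map (hmeas i) hpm.measurable]; rfl
    _ = L i * ENNReal.ofReal (∫ y, P.χ i ((P.chart i).param (y, 0)) *
          φ ((P.chart i).param (y, 0)) ^ 2) := by
        rw [ofReal_integral_eq_lintegral_ofReal]
        · refine hcont.integrable_of_hasCompactSupport (HasCompactSupport.intro
            (IsCompact.image (P.hasCompactSupport_χ i) (P.chart i).continuous_proj)
            fun y hy => ?_)
          have : P.χ i ((P.chart i).param (y, 0)) = 0 :=
            image_eq_zero_of_notMem_tsupport fun h => hy ⟨_, h, by simp⟩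
          rw [this, zero_mul]
        · exact ae_of_all _ fun y => mul_nonneg (P.nonneg i _) (sq_nonneg _)
    _ ≤ L i * ENNReal.ofReal (C i * ∫ x in Ω, (φ x ^ 2 + ∑ k, pderiv k φ x ^ 2)) := by
        gcongr; exact hC i φ hφ hφc
    _ = _ := by
        rw [mul_assoc, ENNReal.ofReal_mul (NNReal.coe_nonneg (L i)), ENNReal.ofReal_coe_nnreal]

/-- The trace inequality in terms of `L²` norms. -/
lemma exists_trace_bound_eLpNorm (hΩ : IsSmoothBoundedDomain Ω) :
    ∃ C : ℝ, ∀ φ : E3 → ℝ, ContDiff ℝ ∞ φ → HasCompactSupport φ →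
      eLpNorm φ 2 (surfaceMeasure.restrict (frontier Ω)) ^ 2 ≤
        ENNReal.ofReal C * (eLpNorm φ 2 (volume.restrict Ω) ^ 2 +
          ∑ k, eLpNorm (pderiv k φ) 2 (volume.restrict Ω) ^ 2) := by
  obtain ⟨C, hC0, hC⟩ := hΩ.exists_trace_bound
  refine ⟨C, fun φ hφ hφc => (hC φ hφ hφc).trans_eq ?_⟩
  have m0 : MemLp φ 2 (volume.restrict Ω) :=
    memLp_restrict_of_continuous_hasCompactSupport hφ.continuous hφc
  have m1 : ∀ k, MemLp (pderiv k φ) 2 (volume.restrict Ω) := fun k =>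
    memLp_restrict_of_continuous_hasCompactSupport (continuous_pderiv hφ k)
      (hasCompactSupport_pderiv hφc k)
  rw [ENNReal.ofReal_mul hC0, integral_add m0.integrable_sq
    (integrable_finsetSum _ fun k _ => (m1 k).integrable_sq),
    integral_finsetSum _ fun k _ => (m1 k).integrable_sq,
    ENNReal.ofReal_add (integral_nonneg fun x => sq_nonneg _)
      (Finset.sum_nonneg fun k _ => integral_nonneg fun x => sq_nonneg _),
    ENNReal.ofReal_sum_of_nonneg fun k _ => integral_nonneg fun x => sq_nonneg _,
    ofReal_integral_sq m0]
  simp only [fun k => ofReal_integral_sq (m1 k)]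

lemma memLp_frontier_of_smooth (hΩ : IsSmoothBoundedDomain Ω) {φ : E3 → ℝ}
    (hφ : ContDiff ℝ ∞ φ) (hφc : HasCompactSupport φ) :
    MemLp φ 2 (surfaceMeasure.restrict (frontier Ω)) := by
  obtain ⟨C, hC0, hC⟩ := hΩ.exists_trace_bound
  refine ⟨hφ.continuous.aestronglyMeasurable, ?_⟩
  have := (hC φ hφ hφc).trans_lt ENNReal.ofReal_lt_top
  exact (ENNReal.pow_lt_top_iff.1 this).resolve_right two_ne_zero

lemma surfaceMeasure_frontier_lt_top (hΩ : IsSmoothBoundedDomain Ω) :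
    surfaceMeasure (frontier Ω) < ⊤ := by
  obtain ⟨R, hR, hsub⟩ := hΩ.isCompact_closure.isBounded.subset_closedBall_lt 0 (0 : E3)
  let bump : ContDiffBump (0 : E3) := ⟨R, R + 1, hR, by linarith⟩
  have h := hΩ.memLp_frontier_of_smooth bump.contDiff bump.hasCompactSupport
  have h2 := (eLpNorm_lt_top_iff_lintegral_rpow_enorm_lt_top (by norm_num) (by norm_num)).1 h.2
  have h3 : ∫⁻ _ in frontier Ω, 1 ∂surfaceMeasure =
      ∫⁻ x in frontier Ω, ‖bump x‖ₑ ^ (2 : ℝ≥0∞).toReal ∂surfaceMeasure :=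
    setLIntegral_congr_fun isClosed_frontier.measurableSet fun x hx => by
      have : bump x = 1 := bump.one_of_mem_closedBall (hsub (frontier_subset_closure hx))
      simp [this]
  rw [← h3] at h2
  simpa using h2

end IsSmoothBoundedDomain

/-! ### Products in Sobolev spaces and existence of traces -/

namespace MemSobolev

variable {Ω : Set E3} {p : ℝ≥0∞} {f g : E3 → ℝ}

lemma memLp {m : ℕ} (h : MemSobolev Ω p m f) : MemLp f p (volume.restrict Ω) := by
  cases m with
  | zero => exact h
  | succ m => exact h.1

lemma congr (hΩ : IsOpen Ω) {m : ℕ} (h : MemSobolev Ω p m f) (hfg : f =ᵐ[volume.restrict Ω] g) :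
    MemSobolev Ω p m g := by
  cases m with
  | zero => exact MemLp.ae_eq hfg h
  | succ m =>
    refine ⟨h.1.ae_eq hfg, fun k => ?_⟩
    obtain ⟨v, hv, hvm⟩ := h.2 k
    exact ⟨v, hv.congr hΩ hfg (ae_eq_refl v), hvm⟩

lemma hasWeakPartial {m : ℕ} (h : MemSobolev Ω p (m + 1) f) (k : Fin 3) :
    HasWeakPartial Ω k f (weakPartial Ω k f) := by
  obtain ⟨v, hv, -⟩ := h.2 k
  exact hv.weakPartial_self

lemma weakPartial (hΩ : IsOpen Ω) {m : ℕ} (h : MemSobolev Ω p (m + 1) f) (k : Fin 3) :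
    MemSobolev Ω p m (weakPartial Ω k f) := by
  obtain ⟨v, hv, hvm⟩ := h.2 k
  exact hvm.congr hΩ (hv.weakPartial_ae_eq hΩ).symm

lemma of_succ {m : ℕ} : ∀ {f : E3 → ℝ}, MemSobolev Ω p (m + 1) f → MemSobolev Ω p m f := by
  induction m with
  | zero => exact fun h => h.1
  | succ m ih =>
    refine fun h => ⟨h.1, fun k => ?_⟩
    obtain ⟨v, hv, hvm⟩ := h.2 k
    exact ⟨v, hv, ih hvm⟩

lemma of_top [IsFiniteMeasure (volume.restrict Ω)] {m : ℕ} :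
    ∀ {f : E3 → ℝ}, MemSobolev Ω ⊤ m f → MemSobolev Ω p m f := by
  induction m with
  | zero => exact fun h => MemLp.mono_exponent h le_top
  | succ m ih =>
    refine fun h => ⟨h.1.mono_exponent le_top, fun k => ?_⟩
    obtain ⟨v, hv, hvm⟩ := h.2 k
    exact ⟨v, hv, ih hvm⟩

lemma add (hf : MemSobolev Ω p 1 f) (hg : MemSobolev Ω p 1 g) :
    MemSobolev Ω p 1 fun x => f x + g x := by
  refine ⟨hf.1.add hg.1, fun k => ?_⟩
  obtain ⟨v, hv, hvm⟩ := hf.2 k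
  obtain ⟨w, hw, hwm⟩ := hg.2 k
  exact ⟨_, hv.add hw, MemLp.add hvm hwm⟩

lemma sub (hf : MemSobolev Ω p 1 f) (hg : MemSobolev Ω p 1 g) :
    MemSobolev Ω p 1 fun x => f x - g x := by
  refine ⟨hf.1.sub hg.1, fun k => ?_⟩
  obtain ⟨v, hv, hvm⟩ := hf.2 k
  obtain ⟨w, hw, hwm⟩ := hg.2 k
  exact ⟨_, hv.sub hw, MemLp.sub hvm hwm⟩

end MemSobolev

namespace IsSmoothBoundedDomain

variable {Ω : Set E3} {f w : E3 → ℝ}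

lemma smoothlyApproximable_weakPartial (hΩ : IsSmoothBoundedDomain Ω)
    (hf : MemSobolev Ω 2 1 f) : SmoothlyApproximable Ω f fun k => weakPartial Ω k f :=
  hΩ.smoothlyApproximable hf.1 (fun k => hf.weakPartial hΩ.isOpen k) fun k => hf.hasWeakPartial k

/-- Leibniz rule for the product of an `H¹` function and a `W^{1,∞}` function. -/
lemma hasWeakPartial_mul (hΩ : IsSmoothBoundedDomain Ω) (hf : MemSobolev Ω 2 1 f)
    (hw : MemSobolev Ω ⊤ 1 w) (k : Fin 3) :
    HasWeakPartial Ω k (fun x => f x * w x)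
      fun x => weakPartial Ω k f x * w x + f x * weakPartial Ω k w x := by
  have := hΩ.isFiniteMeasure
  obtain ⟨hf0, hf1, φ, hφ, hφc, h1, h2⟩ := hΩ.smoothlyApproximable_weakPartial hf
  have hw0 : MemLp w ⊤ (volume.restrict Ω) := hw.1
  have hw1 : MemLp (weakPartial Ω k w) ⊤ (volume.restrict Ω) := hw.weakPartial hΩ.isOpen k
  have m0 : ∀ n, MemLp (φ n) 2 (volume.restrict Ω) := fun n =>
    memLp_restrict_of_continuous_hasCompactSupport (hφ n).continuous (hφc n)
  have m1 : ∀ n, MemLp (pderiv k (φ n)) 2 (volume.restrict Ω) := fun n =>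
    memLp_restrict_of_continuous_hasCompactSupport (continuous_pderiv (hφ n) k)
      (hasCompactSupport_pderiv (hφc n) k)
  have mul2 : ∀ {a b : E3 → ℝ}, MemLp a 2 (volume.restrict Ω) → MemLp b ⊤ (volume.restrict Ω) →
      MemLp (fun x => a x * b x) 2 (volume.restrict Ω) := fun ha hb =>
    hb.mul (p := 2) (q := ⊤) ha
  refine HasWeakPartial.of_tendsto_L2
    (fun n => (hw.hasWeakPartial k).smooth_mul hΩ.isOpen (hφ n)) (fun n => mul2 (m0 n) hw0)
    (fun n => (mul2 (m1 n) hw0).add (mul2 (m0 n) hw1)) (mul2 hf0 hw0)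
    ((mul2 (hf1 k) hw0).add (mul2 hf0 hw1)) (tendsto_L2_mul_bounded hf0 m0 hw0 h1) ?_
  exact tendsto_L2_add (mul2 (hf1 k) hw0) (fun n => mul2 (m1 n) hw0) (mul2 hf0 hw1)
    (fun n => mul2 (m0 n) hw1) (tendsto_L2_mul_bounded (hf1 k) m1 hw0 (h2 k))
    (tendsto_L2_mul_bounded hf0 m0 hw1 h1)

/-- `W^{1,∞}(Ω)` is closed under products. -/
lemma memSobolev_mul (hΩ : IsSmoothBoundedDomain Ω) (hf : MemSobolev Ω ⊤ 1 f)
    (hw : MemSobolev Ω ⊤ 1 w) : MemSobolev Ω ⊤ 1 fun x => f x * w x := by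
  have := hΩ.isFiniteMeasure
  have hmul : ∀ {a b : E3 → ℝ}, MemLp a ⊤ (volume.restrict Ω) → MemLp b ⊤ (volume.restrict Ω) →
      MemLp (fun x => a x * b x) ⊤ (volume.restrict Ω) := fun ha hb =>
    hb.mul (p := ⊤) (q := ⊤) ha
  refine ⟨hmul hf.1 hw.1, fun k => ⟨_, hΩ.hasWeakPartial_mul hf.of_top hw k, ?_⟩⟩
  exact (hmul (hf.weakPartial hΩ.isOpen k) hw.1).add (hmul hf.1 (hw.weakPartial hΩ.isOpen k))

/-- The product of an `H¹` function and a `W^{1,∞}` function is in `H¹`. -/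
lemma memSobolev_two_mul (hΩ : IsSmoothBoundedDomain Ω) (hf : MemSobolev Ω 2 1 f)
    (hw : MemSobolev Ω ⊤ 1 w) : MemSobolev Ω 2 1 fun x => f x * w x := by
  have hmul : ∀ {a b : E3 → ℝ}, MemLp a 2 (volume.restrict Ω) → MemLp b ⊤ (volume.restrict Ω) →
      MemLp (fun x => a x * b x) 2 (volume.restrict Ω) := fun ha hb =>
    hb.mul (p := 2) (q := ⊤) ha
  refine ⟨hmul hf.1 hw.1, fun k => ⟨_, hΩ.hasWeakPartial_mul hf hw k, ?_⟩⟩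
  exact (hmul (hf.weakPartial hΩ.isOpen k) hw.1).add (hmul hf.1 (hw.weakPartial hΩ.isOpen k))

lemma exists_bound (hΩ : IsSmoothBoundedDomain Ω) (hf : ContinuousOn f (closure Ω)) :
    ∃ M, 0 ≤ M ∧ ∀ x ∈ closure Ω, |f x| ≤ M := by
  obtain ⟨M, hM⟩ := hΩ.isCompact_closure.exists_bound_of_continuousOn hf
  exact ⟨max M 0, le_max_right _ _, fun x hx => (hM x hx).trans (le_max_left _ _)⟩

lemma memLp_of_continuousOn (hΩ : IsSmoothBoundedDomain Ω) (hf : ContinuousOn f (closure Ω))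
    {p : ℝ≥0∞} : MemLp f p (volume.restrict Ω) := by
  have := hΩ.isFiniteMeasure
  obtain ⟨M, -, hM⟩ := hΩ.exists_bound hf
  exact MemLp.of_bound ((hf.mono subset_closure).aestronglyMeasurable hΩ.isOpen.measurableSet) M
    ((ae_restrict_iff' hΩ.isOpen.measurableSet).2 (ae_of_all _ fun x hx => hM x (subset_closure hx)))

lemma isFiniteMeasure_surface (hΩ : IsSmoothBoundedDomain Ω) :
    IsFiniteMeasure (surfaceMeasure.restrict (frontier Ω)) :=
  ⟨by rw [Measure.restrict_apply_univ]; exact hΩ.surfaceMeasure_frontier_lt_top⟩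

lemma memLp_frontier_of_continuousOn (hΩ : IsSmoothBoundedDomain Ω)
    (hf : ContinuousOn f (closure Ω)) {p : ℝ≥0∞} :
    MemLp f p (surfaceMeasure.restrict (frontier Ω)) := by
  have := hΩ.isFiniteMeasure_surface
  obtain ⟨M, -, hM⟩ := hΩ.exists_bound hf
  exact MemLp.of_bound ((hf.mono frontier_subset_closure).aestronglyMeasurable
    isClosed_frontier.measurableSet) M ((ae_restrict_iff' isClosed_frontier.measurableSet).2
      (ae_of_all _ fun x hx => hM x (frontier_subset_closure hx)))

/-- A function that is `C¹` up to the boundary is in `W^{1,∞}`. -/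
lemma memSobolev_of_contDiffOn (hΩ : IsSmoothBoundedDomain Ω)
    (hf : ContDiffOn ℝ 1 f (closure Ω)) : MemSobolev Ω ⊤ 1 f := by
  have hc : ∀ k, ContinuousOn (fun x => fderivWithin ℝ f (closure Ω) x (basisVec k))
      (closure Ω) := fun k =>
    (hf.continuousOn_fderivWithin hΩ.uniqueDiffOn_closure le_rfl).clm_apply continuousOn_const
  refine ⟨hΩ.memLp_of_continuousOn hf.continuousOn, fun k => ⟨_,
    HasWeakPartial.of_contDiffOn hΩ.isOpen (hf.mono subset_closure) k, ?_⟩⟩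
  refine (hΩ.memLp_of_continuousOn (hc k)).ae_eq
    ((ae_restrict_iff' hΩ.isOpen.measurableSet).2 (ae_of_all _ fun x hx => ?_))
  beta_reduce
  rw [fderivWithin_of_mem_nhds (mem_of_superset (hΩ.isOpen.mem_nhds hx) subset_closure)]

/-- Every `H¹` function on a smooth bounded domain has a boundary trace. -/
theorem exists_isTrace (hΩ : IsSmoothBoundedDomain Ω) (hf : MemSobolev Ω 2 1 f) :
    ∃ τ, IsTrace Ω f τ := by
  obtain ⟨hf0, hf1, φ, hφ, hφc, h1, h2⟩ := hΩ.smoothlyApproximable_weakPartial hf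
  obtain ⟨C, hC⟩ := hΩ.exists_trace_bound_eLpNorm
  set σ := surfaceMeasure.restrict (frontier Ω)
  have hm : ∀ n, MemLp (φ n) 2 σ := fun n => hΩ.memLp_frontier_of_smooth (hφ n) (hφc n)
  have hfst : Tendsto (Prod.fst : ℕ × ℕ → ℕ) atTop atTop := by
    rw [← prod_atTop_atTop_eq]; exact tendsto_fst
  have hsnd : Tendsto (Prod.snd : ℕ × ℕ → ℕ) atTop atTop := by
    rw [← prod_atTop_atTop_eq]; exact tendsto_snd
  have cauchy : ∀ {u : E3 → ℝ} {un : ℕ → E3 → ℝ}, MemLp u 2 (volume.restrict Ω) →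
      (∀ n, MemLp (un n) 2 (volume.restrict Ω)) →
      Tendsto (fun n => eLpNorm (fun x => un n x - u x) 2 (volume.restrict Ω)) atTop (𝓝 0) →
      Tendsto (fun n : ℕ × ℕ => eLpNorm (fun x => un n.1 x - un n.2 x) 2 (volume.restrict Ω))
        atTop (𝓝 0) := by
    intro u un hu hun h
    have h' : Tendsto (fun n : ℕ × ℕ => eLpNorm (fun x => un n.1 x - u x) 2 (volume.restrict Ω) +
        eLpNorm (fun x => un n.2 x - u x) 2 (volume.restrict Ω)) atTop (𝓝 0) := by
      have := (h.comp hfst).add (h.comp hsnd)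
      simpa using this
    refine tendsto_of_tendsto_of_tendsto_of_le_of_le tendsto_const_nhds h' (fun n => zero_le) ?_
    intro n
    have e : (fun x => un n.1 x - un n.2 x) =
        (fun x => un n.1 x - u x) - (fun x => un n.2 x - u x) := by ext x; simp
    beta_reduce
    rw [e]
    exact eLpNorm_sub_le ((hun n.1).sub hu).1 ((hun n.2).sub hu).1 (by norm_num)
  have c0 := cauchy hf0 (fun n => memLp_restrict_of_continuous_hasCompactSupport
    (hφ n).continuous (hφc n)) h1
  have c1 := fun k => cauchy (hf1 k) (fun n => memLp_restrict_of_continuous_hasCompactSupport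
    (continuous_pderiv (hφ n) k) (hasCompactSupport_pderiv (hφc n) k)) (h2 k)
  -- the trace inequality applied to differences makes the boundary values Cauchy in `L²(σ)`
  have hcσ : Tendsto (fun n : ℕ × ℕ => eLpNorm (fun x => φ n.1 x - φ n.2 x) 2 σ ^ 2)
      atTop (𝓝 0) := by
    have hb : Tendsto (fun n : ℕ × ℕ => ENNReal.ofReal C *
        (eLpNorm (fun x => φ n.1 x - φ n.2 x) 2 (volume.restrict Ω) ^ 2 +
          ∑ k, eLpNorm (fun x => pderiv k (φ n.1) x - pderiv k (φ n.2) x) 2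
            (volume.restrict Ω) ^ 2)) atTop (𝓝 0) := by
      have h0 := ((ENNReal.continuous_pow 2).tendsto 0).comp c0
      have h3 := tendsto_finsetSum Finset.univ
        fun k (_ : k ∈ Finset.univ) => ((ENNReal.continuous_pow 2).tendsto 0).comp (c1 k)
      have := ENNReal.Tendsto.const_mul (h0.add h3) (Or.inr (ENNReal.ofReal_ne_top (r := C)))
      simpa using this
    refine tendsto_of_tendsto_of_tendsto_of_le_of_le tendsto_const_nhds hb (fun n => zero_le) ?_
    intro n
    refine (hC _ ((hφ n.1).sub (hφ n.2)) ((hφc n.1).sub (hφc n.2))).trans_eq ?_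
    have : ∀ k x, pderiv k (fun x => φ n.1 x - φ n.2 x) x =
        pderiv k (φ n.1) x - pderiv k (φ n.2) x := fun k x => by
      simp only [pderiv]
      rw [fderiv_fun_sub ((hφ _).differentiable (by simp) x) ((hφ _).differentiable (by simp) x)]
      rfl
    simp only [← this]
  have hcσ' : Tendsto (fun n : ℕ × ℕ => eLpNorm (fun x => φ n.1 x - φ n.2 x) 2 σ)
      atTop (𝓝 0) := by
    have := ((ENNReal.continuous_rpow_const (y := 1 / 2)).tendsto 0).comp hcσ
    simp only [Function.comp_def, ← ENNReal.rpow_natCast, ← ENNReal.rpow_mul] at this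
    simpa using this
  have hcs : CauchySeq fun n => (hm n).toLp (φ n) := by
    rw [Lp.cauchySeq_Lp_iff_cauchySeq_eLpNorm]
    refine hcσ'.congr fun n => eLpNorm_congr_ae ?_
    filter_upwards [(hm n.1).coeFn_toLp, (hm n.2).coeFn_toLp] with x h1 h2
    rw [Pi.sub_apply, h1, h2]
  obtain ⟨τ, hτ⟩ := cauchySeq_tendsto_of_complete hcs
  refine ⟨τ, Lp.memLp τ, φ, hφ, h1, h2, ?_⟩
  rw [Lp.tendsto_Lp_iff_tendsto_eLpNorm'] at hτ
  refine hτ.congr fun n => eLpNorm_congr_ae ?_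
  filter_upwards [(hm n).coeFn_toLp] with x h1
  rw [Pi.sub_apply, h1]

lemma isTrace_trace (hΩ : IsSmoothBoundedDomain Ω) (hf : MemSobolev Ω 2 1 f) :
    IsTrace Ω f (trace Ω f) := by
  have h := hΩ.exists_isTrace hf
  rw [trace, dif_pos h]
  exact h.choose_spec

end IsSmoothBoundedDomain

/-! ### A divergence inequality with one-sided boundary terms -/

namespace IsSmoothBoundedDomain

variable {Ω : Set E3}

lemma exists_continuous_nonneg_extension {u : E3 → ℝ} (hu : ContinuousOn u (closure Ω))
    (hu0 : ∀ x ∈ closure Ω, 0 ≤ u x) :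
    ∃ w : E3 → ℝ, Continuous w ∧ (∀ x, 0 ≤ w x) ∧ ∀ x ∈ closure Ω, w x = u x := by
  obtain ⟨g, hg⟩ := ContinuousMap.exists_restrict_eq (isClosed_closure (s := Ω))
    ⟨_, hu.domRestrict⟩
  refine ⟨fun x => max (g x) 0, g.continuous.max continuous_const, fun x => le_max_right _ _,
    fun x hx => ?_⟩
  have : g x = u x := by simpa using DFunLike.congr_fun hg ⟨x, hx⟩
  beta_reduce
  rw [this, max_eq_left (hu0 x hx)]

/-- The flux of `χ u X` through the boundary graph of a chart, where `X` may point out of `Ω` only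
on `S`, is at most a constant times the integral of `u` over `S`. -/
lemma exists_chart_flux_bound (hΩ : IsSmoothBoundedDomain Ω) (c : BoundaryChart Ω) {χ : E3 → ℝ}
    (hχ : Continuous χ) (hχc : HasCompactSupport χ) (hχd : tsupport χ ⊆ c.dom)
    (hχ0 : ∀ x, 0 ≤ χ x) (hχ1 : ∀ x ∈ frontier Ω, χ x ≤ 1) {X : Fin 3 → E3 → ℝ}
    (hX : ∀ k, ContinuousOn (X k) (closure Ω)) {S : Set E3} (hS : MeasurableSet S)
    (hSf : S ⊆ frontier Ω)
    (hsign : ∀ x ∈ c.dom, x ∈ frontier Ω → x ∉ S → 0 ≤ ∑ k, X k x * pderiv k c.height x) :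
    ∃ C : ℝ, 0 ≤ C ∧ ∀ u : E3 → ℝ, Continuous u → (∀ x, 0 ≤ u x) →
      - ∫ y : Fin 2 → ℝ, χ (c.param (y, 0)) *
          ∑ k, u (c.param (y, 0)) * X k (c.param (y, 0)) * pderiv k c.height (c.param (y, 0)) ≤
        C * ∫ x in S, u x ∂surfaceMeasure := by
  obtain ⟨M, hM0, hM⟩ := hΩ.exists_bound (f := fun x => ∑ k, X k x * pderiv k c.height x)
    (continuousOn_finsetSum _ fun k _ =>
      (hX k).mul (continuous_pderiv c.contDiff_height k).continuousOn)
  have hπ : 0 < Real.pi / 4 := by positivity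
  refine ⟨M * (Real.pi / 4)⁻¹, by positivity, fun u hu hu0 => ?_⟩
  set g : E3 → ℝ := S.indicator fun x => χ x * u x with hg
  have hg0 : ∀ x, 0 ≤ g x := fun x => Set.indicator_nonneg (fun x _ => mul_nonneg (hχ0 x) (hu0 x)) x
  have hgm : Measurable g := (hχ.mul hu).measurable.indicator hS
  have hp : Continuous fun y : Fin 2 → ℝ => c.param (y, 0) := c.continuous_param.comp (by fun_prop)
  have hgi : Integrable fun y : Fin 2 → ℝ => g (c.param (y, 0)) := by
    have h1 : Integrable fun y : Fin 2 → ℝ => χ (c.param (y, 0)) * u (c.param (y, 0)) := by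
      refine ((hχ.comp hp).mul (hu.comp hp)).integrable_of_hasCompactSupport
        (HasCompactSupport.intro (IsCompact.image hχc c.continuous_proj) fun y hy => ?_)
      have : χ (c.param (y, 0)) = 0 :=
        image_eq_zero_of_notMem_tsupport fun h => hy ⟨_, h, by simp⟩
      simp [this]
    refine h1.mono (hgm.comp hp.measurable).aestronglyMeasurable (ae_of_all _ fun y => ?_)
    exact norm_indicator_le_norm_self _ _
  have step1 : - ∫ y : Fin 2 → ℝ, χ (c.param (y, 0)) *
      ∑ k, u (c.param (y, 0)) * X k (c.param (y, 0)) * pderiv k c.height (c.param (y, 0)) ≤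
      M * ∫ y : Fin 2 → ℝ, g (c.param (y, 0)) := by
    rw [← integral_neg, ← integral_const_mul]
    -- a non-integrable left side has integral zero and needs no estimate
    by_cases hint : Integrable fun y : Fin 2 → ℝ => -(χ (c.param (y, 0)) *
      ∑ k, u (c.param (y, 0)) * X k (c.param (y, 0)) * pderiv k c.height (c.param (y, 0)))
    swap
    · rw [integral_undef hint]
      exact integral_nonneg fun y => mul_nonneg hM0 (hg0 _)
    refine integral_mono hint (hgi.const_mul M) fun y => ?_
    beta_reduce
    set x := c.param (y, 0)
    by_cases hx : x ∈ tsupport χ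
    swap
    · have : χ x = 0 := image_eq_zero_of_notMem_tsupport hx
      simp only [this, zero_mul, neg_zero]
      exact mul_nonneg hM0 (hg0 x)
    have hxf : x ∈ frontier Ω := c.mem_frontier hΩ.isOpen (hχd hx) (by simp [x])
    have e : χ x * ∑ k, u x * X k x * pderiv k c.height x =
        χ x * u x * ∑ k, X k x * pderiv k c.height x := by
      rw [mul_assoc, Finset.mul_sum (a := u x)]; simp only [mul_assoc]
    have hχu : 0 ≤ χ x * u x := mul_nonneg (hχ0 x) (hu0 x)
    rw [e]
    by_cases hxS : x ∈ S
    · have h1 := hM x (frontier_subset_closure hxf)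
      have h2 := neg_abs_le (∑ k, X k x * pderiv k c.height x)
      rw [hg, Set.indicator_of_mem hxS]
      nlinarith
    · have h1 := hsign x (hχd hx) hxf hxS
      rw [hg, Set.indicator_of_notMem hxS, mul_zero]
      nlinarith [mul_nonneg hχu h1]
  have hne : ENNReal.ofReal (Real.pi / 4) ≠ 0 := (ENNReal.ofReal_pos.2 hπ).ne'
  have hint : ∀ {w : E3 → ℝ}, Continuous w → IntegrableOn w S (Measure.hausdorffMeasure 2) := by
    intro w hw
    have h1 : IntegrableOn w (frontier Ω) surfaceMeasure :=
      memLp_one_iff_integrable.1 (hΩ.memLp_frontier_of_continuousOn hw.continuousOn)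
    have h2 : IntegrableOn w S surfaceMeasure := h1.mono_set hSf
    rw [IntegrableOn, surfaceMeasure, Measure.restrict_smul,
      integrable_smul_measure hne ENNReal.ofReal_ne_top] at h2
    exact h2
  -- the projected area is at most the surface area
  have step2 : ∫ y : Fin 2 → ℝ, g (c.param (y, 0)) ≤
      ∫ x in S, u x ∂(Measure.hausdorffMeasure 2) := by
    have hGi : Integrable g (Measure.hausdorffMeasure 2) :=
      (integrable_indicator_iff hS).2 (hint (hχ.mul hu))
    calc ∫ y : Fin 2 → ℝ, g (c.param (y, 0))
        = ∫ x, g x ∂(Measure.map (fun y => c.param (y, 0)) volume) :=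
          (integral_map hp.measurable.aemeasurable hgm.aestronglyMeasurable).symm
      _ ≤ ∫ x, g x ∂(Measure.hausdorffMeasure 2) :=
          integral_mono_measure c.map_param_le_hausdorff (ae_of_all _ hg0) hGi
      _ = ∫ x in S, χ x * u x ∂(Measure.hausdorffMeasure 2) := integral_indicator hS
      _ ≤ _ := by
          refine setIntegral_mono_on (hint (hχ.mul hu)) (hint hu) hS fun x hx => ?_
          exact mul_le_of_le_one_left (hu0 x) (hχ1 x (hSf hx))
  have e : ∫ x in S, u x ∂surfaceMeasure =
      Real.pi / 4 * ∫ x in S, u x ∂(Measure.hausdorffMeasure 2) := by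
    rw [surfaceMeasure, Measure.restrict_smul, integral_smul_measure,
      ENNReal.toReal_ofReal hπ.le, smul_eq_mul]
  rw [e, mul_assoc, inv_mul_cancel_left₀ hπ.ne']
  exact step1.trans (mul_le_mul_of_nonneg_left step2 hM0)

/-- **Divergence inequality.** If the field `X` points into `Ω` at all boundary points outside `S`,
then `∫_Ω div (u X)` is at most a constant times `∫_S u dσ` for all `u ≥ 0`. -/
theorem exists_div_bound (hΩ : IsSmoothBoundedDomain Ω) {X : Fin 3 → E3 → ℝ}
    (hXc : ∀ k, ContinuousOn (X k) (closure Ω)) (hX : ∀ k, MemSobolev Ω ⊤ 1 (X k)) {S : Set E3}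
    (hS : MeasurableSet S) (hSf : S ⊆ frontier Ω)
    (hsign : ∀ (c : BoundaryChart Ω), ∀ x ∈ c.dom, x ∈ frontier Ω → x ∉ S →
      0 ≤ ∑ k, X k x * pderiv k c.height x) :
    ∃ C : ℝ, 0 ≤ C ∧ ∀ u : E3 → ℝ, ContinuousOn u (closure Ω) → (∀ x ∈ closure Ω, 0 ≤ u x) →
      MemSobolev Ω ⊤ 1 u →
      ∫ x in Ω, ∑ k, (weakPartial Ω k u x * X k x + u x * weakPartial Ω k (X k) x) ≤
        C * ∫ x in S, u x ∂surfaceMeasure := by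
  have := hΩ.isFiniteMeasure
  obtain ⟨P⟩ := hΩ.nonempty_boundaryPartition
  have hχ1 : ∀ i, ∀ x ∈ frontier Ω, P.χ i x ≤ 1 := fun i x hx => by
    have hx0 : P.χ₀ x = 0 := P.χ₀_eq_zero fun h => by
      rw [hΩ.isOpen.frontier_eq] at hx; exact hx.2 h
    have h1 := P.sum_eq_one x (frontier_subset_closure hx)
    rw [hx0, zero_add] at h1
    rw [← h1]
    exact Finset.single_le_sum (f := fun i => P.χ i x) (fun j _ => P.nonneg j x)
      (Finset.mem_univ i)
  choose C hC0 hC using fun i => hΩ.exists_chart_flux_bound (P.chart i)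
    (P.contDiff_χ i).continuous (P.hasCompactSupport_χ i) (P.tsupport_χ i) (P.nonneg i) (hχ1 i)
    hXc hS hSf (hsign (P.chart i))
  refine ⟨∑ i, C i, Finset.sum_nonneg fun i _ => hC0 i, fun u huc hu0 hu => ?_⟩
  obtain ⟨w, hwc, hw0, hwu⟩ := exists_continuous_nonneg_extension huc hu0
  set D : Fin 3 → E3 → ℝ := fun k x => weakPartial Ω k u x * X k x + u x * weakPartial Ω k (X k) x
  have hD : ∀ k, HasWeakPartial Ω k (fun x => u x * X k x) (D k) := fun k =>
    hΩ.hasWeakPartial_mul hu.of_top (hX k) k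
  have hDt : ∀ k, MemLp (D k) ⊤ (volume.restrict Ω) := fun k => by
    have hmul : ∀ {a b : E3 → ℝ}, MemLp a ⊤ (volume.restrict Ω) →
        MemLp b ⊤ (volume.restrict Ω) → MemLp (fun x => a x * b x) ⊤ (volume.restrict Ω) :=
      fun ha hb => hb.mul (p := ⊤) (q := ⊤) ha
    exact (hmul (hu.weakPartial hΩ.isOpen k) (hX k).1).add
      (hmul hu.1 ((hX k).weakPartial hΩ.isOpen k))
  have hDi : ∀ k, IntegrableOn (D k) Ω := fun k => (hDt k).integrable le_top
  have hFc : ∀ k, ContinuousOn (fun x => u x * X k x) (closure Ω) := fun k => huc.mul (hXc k)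
  -- the localized divergences
  set T : (E3 → ℝ) → E3 → ℝ := fun χ x =>
    (∑ k, D k x) * χ x + ∑ k, u x * X k x * pderiv k χ x with hT
  have hTi : ∀ {χ : E3 → ℝ}, ContDiff ℝ ∞ χ → HasCompactSupport χ → IntegrableOn (T χ) Ω := by
    intro χ hχ hχc
    refine Integrable.add ?_ (integrable_finsetSum _ fun k _ => ?_)
    · obtain ⟨M, hM⟩ := hχc.exists_bound_of_continuous hχ.continuous
      exact (integrable_finsetSum _ fun k _ => hDi k).mul_bdd
        hχ.continuous.aestronglyMeasurable (ae_of_all _ hM)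
    · exact (hΩ.memLp_of_continuousOn ((hFc k).mul
        (continuous_pderiv hχ k).continuousOn)).integrable le_top
  have hT0 : ∫ x in Ω, T P.χ₀ x = 0 := by
    have e : ∀ k, ∫ x in Ω, (D k x * P.χ₀ x + u x * X k x * pderiv k P.χ₀ x) = 0 := fun k => by
      rw [integral_add ((hD k).integrable_mul P.contDiff_χ₀ P.hasCompactSupport_χ₀ P.tsupport_χ₀)
        ((hD k).integrable_mul_pderiv P.contDiff_χ₀ P.hasCompactSupport_χ₀ P.tsupport_χ₀ k),
        (hD k).integral_eq _ P.contDiff_χ₀ P.hasCompactSupport_χ₀ P.tsupport_χ₀]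
      ring
    have hi : ∀ k, IntegrableOn (fun x => D k x * P.χ₀ x + u x * X k x * pderiv k P.χ₀ x) Ω :=
      fun k =>
      ((hD k).integrable_mul P.contDiff_χ₀ P.hasCompactSupport_χ₀ P.tsupport_χ₀).add
        ((hD k).integrable_mul_pderiv P.contDiff_χ₀ P.hasCompactSupport_χ₀ P.tsupport_χ₀ k)
    simp only [hT, Finset.sum_mul, ← Finset.sum_add_distrib]
    rw [integral_finsetSum _ fun k _ => hi k]
    exact Finset.sum_eq_zero fun k _ => e k
  have hTb : ∀ i, ∫ x in Ω, T (P.χ i) x ≤ C i * ∫ x in S, u x ∂surfaceMeasure := fun i => by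
    have hSu : ∫ x in S, u x ∂surfaceMeasure = ∫ x in S, w x ∂surfaceMeasure :=
      setIntegral_congr_fun hS fun x hx => (hwu x (frontier_subset_closure (hSf hx))).symm
    rw [hSu, (P.chart i).chart_identity hΩ (P.contDiff_χ i) (P.hasCompactSupport_χ i)
      (P.tsupport_χ i) hFc hD hDi]
    refine le_trans (le_of_eq ?_) (hC i w hwc hw0)
    congr 2; ext y
    by_cases hy : (P.chart i).param (y, 0) ∈ tsupport (P.χ i)
    · rw [hwu _ (frontier_subset_closure ((P.chart i).mem_frontier hΩ.isOpen (P.tsupport_χ i hy)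
        (by simp)))]
    · simp [image_eq_zero_of_notMem_tsupport hy]
  have hsum : ∀ x ∈ Ω, ∑ k, D k x = T P.χ₀ x + ∑ i, T (P.χ i) x := by
    intro x hx
    have e1 := P.sum_eq_one x (subset_closure hx)
    have e2 := P.pderiv_sum_eq_zero hΩ.isOpen hx
    calc ∑ k, D k x = (∑ k, D k x) * (P.χ₀ x + ∑ i, P.χ i x) +
          ∑ k, u x * X k x * (pderiv k P.χ₀ x + ∑ i, pderiv k (P.χ i) x) := by
          simp only [e1, e2]; simp
      _ = _ := by
          simp only [hT, mul_add, Finset.sum_add_distrib]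
          rw [Finset.mul_sum]
          simp only [Finset.mul_sum]
          rw [Finset.sum_comm (s := Finset.univ (α := Fin 3)) (t := Finset.univ (α := P.ι))]
          ring
  rw [setIntegral_congr_fun hΩ.isOpen.measurableSet hsum,
    integral_add (hTi P.contDiff_χ₀ P.hasCompactSupport_χ₀) (integrable_finsetSum _ fun i _ =>
      hTi (P.contDiff_χ i) (P.hasCompactSupport_χ i)), hT0, zero_add,
    integral_finsetSum _ fun i _ => hTi (P.contDiff_χ i) (P.hasCompactSupport_χ i), Finset.sum_mul]
  exact Finset.sum_le_sum fun i _ => hTb i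

end IsSmoothBoundedDomain

/-! ### The Carleman estimate for transport operators -/

/-- A function in `L^∞` is essentially bounded by some constant. -/
lemma exists_ae_abs_le {α : Type*} [MeasurableSpace α] {μ : Measure α} {w : α → ℝ}
    (hw : MemLp w ⊤ μ) : ∃ M, 0 ≤ M ∧ ∀ᵐ x ∂μ, |w x| ≤ M := by
  refine ⟨(eLpNorm w ⊤ μ).toReal, ENNReal.toReal_nonneg, ?_⟩
  filter_upwards [ae_le_eLpNormEssSup (f := w) (μ := μ)] with x hx
  rw [← Real.norm_eq_abs, ← toReal_enorm, eLpNorm_exponent_top]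
  exact ENNReal.toReal_mono (by rw [← eLpNorm_exponent_top]; exact hw.2.ne) hx

lemma tendsto_integral_weight_sq {α : Type*} [MeasurableSpace α] {μ : Measure α} {w : α → ℝ}
    {e : ℕ → α → ℝ} (hw : MemLp w ⊤ μ) (he : ∀ n, MemLp (e n) 2 μ)
    (h : Tendsto (fun n => eLpNorm (e n) 2 μ) atTop (𝓝 0)) :
    Tendsto (fun n => ∫ x, w x * e n x ^ 2 ∂μ) atTop (𝓝 0) := by
  obtain ⟨M, -, hM⟩ := exists_ae_abs_le hw
  have h2 : Tendsto (fun n => ∫ x, e n x ^ 2 ∂μ) atTop (𝓝 0) := by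
    have h1 := (ENNReal.tendsto_toReal (by simp)).comp (((ENNReal.continuous_pow 2).tendsto 0).comp h)
    simp only [ne_eq, OfNat.ofNat_ne_zero, not_false_eq_true, zero_pow, ENNReal.toReal_zero] at h1
    refine h1.congr fun n => ?_
    simp only [Function.comp_apply]
    rw [← ofReal_integral_sq (he n), ENNReal.toReal_ofReal (integral_nonneg fun x => sq_nonneg _)]
  have h3 := h2.const_mul M
  rw [mul_zero] at h3
  refine squeeze_zero_norm (fun n => ?_) h3
  rw [← integral_const_mul]
  refine norm_integral_le_of_norm_le ((he n).integrable_sq.const_mul _) ?_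
  filter_upwards [hM] with x hx
  rw [norm_mul, Real.norm_eq_abs (w x), Real.norm_of_nonneg (sq_nonneg (e n x))]
  gcongr

lemma integrable_weight_mul_sq {α : Type*} [MeasurableSpace α] {μ : Measure α} {w e : α → ℝ}
    (hw : MemLp w ⊤ μ) (he : MemLp e 2 μ) : Integrable (fun x => w x * e x ^ 2) μ := by
  refine memLp_one_iff_integrable.1 ?_
  exact MemLp.mul (p := ⊤) (q := 1) (memLp_one_iff_integrable.2 he.integrable_sq) hw

namespace IsSmoothBoundedDomain

variable {Ω : Set E3}

/-- A Carleman estimate for smooth functions, for the transport operator `X·∇` and a weight `W(d)`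
that grows fast compared to its size: integrate `div (W(d) φ² X)`, whose leading term is
`W'(d) (X·∇d) φ²`. -/
lemma exists_carleman_smooth (hΩ : IsSmoothBoundedDomain Ω) {d : E3 → ℝ}
    (hd : ContDiffOn ℝ 1 d (closure Ω)) (hd0 : ∀ x ∈ closure Ω, 0 ≤ d x) {X : Fin 3 → E3 → ℝ}
    (hXc : ∀ k, ContinuousOn (X k) (closure Ω)) (hX : ∀ k, MemSobolev Ω ⊤ 1 (X k)) {S : Set E3}
    (hS : MeasurableSet S) (hSf : S ⊆ frontier Ω)
    (hsign : ∀ (c : BoundaryChart Ω), ∀ x ∈ c.dom, x ∈ frontier Ω → x ∉ S →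
      0 ≤ ∑ k, X k x * pderiv k c.height x)
    {c₀ : ℝ} (hc₀ : 0 < c₀) (hXd : ∀ x ∈ Ω, c₀ ≤ ∑ k, X k x * pderiv k d x) :
    ∃ C m₀ : ℝ, 0 < C ∧ 0 < m₀ ∧ ∀ W : ℝ → ℝ, ContDiff ℝ 1 W → (∀ t, 0 < W t) →
      (∀ t, 0 ≤ t → m₀ * W t ≤ deriv W t) → ∀ φ : E3 → ℝ, ContDiff ℝ ∞ φ →
      ∫ x in Ω, deriv W (d x) * φ x ^ 2 ≤
        C * (∫ x in Ω, W (d x) ^ 2 / deriv W (d x) * (∑ k, X k x * pderiv k φ x) ^ 2) +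
        C * ∫ x in S, W (d x) * φ x ^ 2 ∂surfaceMeasure := by
  have := hΩ.isFiniteMeasure
  obtain ⟨C, hC0, hC⟩ := hΩ.exists_div_bound hXc hX hS hSf hsign
  have hdiv : MemLp (fun x => ∑ k, weakPartial Ω k (X k) x) ⊤ (volume.restrict Ω) :=
    memLp_finsetSum _ fun k _ => (hX k).weakPartial hΩ.isOpen k
  obtain ⟨M, -, hM⟩ := exists_ae_abs_le hdiv
  set m₀ : ℝ := 4 * |M| / c₀ + 1 with hm₀
  refine ⟨8 / c₀ ^ 2 + 2 * C / c₀, m₀, by positivity, by positivity,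
    fun W hW hW0 hWm φ hφ => ?_⟩
  have hdW : ∀ x ∈ closure Ω, 0 < deriv W (d x) := fun x hx =>
    lt_of_lt_of_le (mul_pos (by positivity) (hW0 _)) (hWm _ (hd0 x hx))
  have hW' : Continuous (deriv W) := hW.continuous_deriv le_rfl
  set u : E3 → ℝ := fun x => W (d x) * φ x ^ 2 with hu
  have hus : ContDiffOn ℝ 1 u (closure Ω) :=
    (hW.comp_contDiffOn hd).mul ((hφ.pow 2).of_le (by simp)).contDiffOn
  have h1 := hC u hus.continuousOn (fun x _ => mul_nonneg (hW0 _).le (sq_nonneg _))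
    (hΩ.memSobolev_of_contDiffOn hus)
  have hup : ∀ k, weakPartial Ω k u =ᵐ[volume.restrict Ω] pderiv k u := fun k =>
    (HasWeakPartial.of_contDiffOn hΩ.isOpen (hus.mono subset_closure) k).weakPartial_ae_eq
      hΩ.isOpen
  have hpu : ∀ x ∈ Ω, ∀ k, pderiv k u x =
      deriv W (d x) * pderiv k d x * φ x ^ 2 + W (d x) * (2 * φ x * pderiv k φ x) := by
    intro x hx k
    have hdx : DifferentiableAt ℝ d x :=
      ((hd.mono subset_closure).differentiableOn one_ne_zero).differentiableAt
        (hΩ.isOpen.mem_nhds hx)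
    have e1 : HasFDerivAt (fun x => W (d x)) (deriv W (d x) • fderiv ℝ d x) x :=
      ((hW.differentiable one_ne_zero (d x)).hasDerivAt).comp_hasFDerivAt x hdx.hasFDerivAt
    have e2 : HasFDerivAt u _ x := e1.mul ((hφ.differentiable (by simp) x).hasFDerivAt.pow 2)
    rw [pderiv, e2.fderiv]
    simp [pderiv]; ring
  set a : E3 → ℝ := fun x => deriv W (d x) * φ x ^ 2
  set b : E3 → ℝ := fun x => W (d x) ^ 2 / deriv W (d x) * (∑ k, X k x * pderiv k φ x) ^ 2
  have hac : ContinuousOn a (closure Ω) :=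
    (hW'.comp_continuousOn hd.continuousOn).mul (hφ.continuous.pow 2).continuousOn
  have hbc : ContinuousOn b (closure Ω) := by
    refine ContinuousOn.mul (ContinuousOn.div
      ((hW.continuous.comp_continuousOn hd.continuousOn).pow 2)
      (hW'.comp_continuousOn hd.continuousOn) fun x hx => (hdW x hx).ne') ?_
    exact (continuousOn_finsetSum _ fun k _ =>
      (hXc k).mul (continuous_pderiv hφ k).continuousOn).pow 2
  have hai : IntegrableOn a Ω := (hΩ.memLp_of_continuousOn hac).integrable le_top
  have hbi : IntegrableOn b Ω := (hΩ.memLp_of_continuousOn hbc).integrable le_top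
  have hDi : IntegrableOn (fun x => ∑ k, (weakPartial Ω k u x * X k x +
      u x * weakPartial Ω k (X k) x)) Ω := by
    refine integrable_finsetSum _ fun k _ => ?_
    have hmul : ∀ {a b : E3 → ℝ}, MemLp a ⊤ (volume.restrict Ω) →
        MemLp b ⊤ (volume.restrict Ω) → MemLp (fun x => a x * b x) ⊤ (volume.restrict Ω) :=
      fun ha hb => hb.mul (p := ⊤) (q := ⊤) ha
    have hu' := hΩ.memSobolev_of_contDiffOn hus
    exact ((hmul (hu'.weakPartial hΩ.isOpen k) (hX k).1).add
      (hmul hu'.1 ((hX k).weakPartial hΩ.isOpen k))).integrable le_top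
  have h2 : ∫ x in Ω, (c₀ / 2 * a x - 4 / c₀ * b x) ≤
      ∫ x in Ω, ∑ k, (weakPartial Ω k u x * X k x + u x * weakPartial Ω k (X k) x) := by
    refine integral_mono_ae ((hai.const_mul _).sub (hbi.const_mul _)) hDi ?_
    filter_upwards [hM, hup 0, hup 1, hup 2, ae_restrict_mem hΩ.isOpen.measurableSet]
      with x hMx hx0 hx1 hx2 hx
    have hxk : ∀ k, weakPartial Ω k u x = pderiv k u x := fun k => by fin_cases k <;> assumption
    set V := W (d x)
    set V' := deriv W (d x)
    have hV : 0 < V := hW0 _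
    have hV' : 0 < V' := hdW x (subset_closure hx)
    have hVV : m₀ * V ≤ V' := hWm _ (hd0 x (subset_closure hx))
    have e : ∑ k, (weakPartial Ω k u x * X k x + u x * weakPartial Ω k (X k) x) =
        V' * φ x ^ 2 * (∑ k, X k x * pderiv k d x) +
        2 * V * φ x * (∑ k, X k x * pderiv k φ x) +
        V * φ x ^ 2 * ∑ k, weakPartial Ω k (X k) x := by
      simp only [hxk]
      simp only [hpu x hx]
      simp only [Fin.sum_univ_three, hu, V, V']
      ring
    have hdx := hXd x hx
    rw [e]
    set p := ∑ k, X k x * pderiv k d x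
    set q := ∑ k, X k x * pderiv k φ x with hq
    set r := ∑ k, weakPartial Ω k (X k) x
    have hb : b x = V ^ 2 / V' * q ^ 2 := rfl
    have ha : a x = V' * φ x ^ 2 := rfl
    rw [ha, hb]
    have t1 : c₀ * (V' * φ x ^ 2) ≤ V' * φ x ^ 2 * p := by
      nlinarith [mul_nonneg hV'.le (sq_nonneg (φ x))]
    have t2 : -(c₀ / 4 * (V' * φ x ^ 2)) - 4 / c₀ * (V ^ 2 / V' * q ^ 2) ≤ 2 * V * φ x * q := by
      have h := sq_nonneg (c₀ * V' * φ x + 4 * V * q)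
      have : 0 ≤ (c₀ * V' * φ x + 4 * V * q) ^ 2 / (4 * c₀ * V') := by positivity
      have e2 : (c₀ * V' * φ x + 4 * V * q) ^ 2 / (4 * c₀ * V') =
          c₀ / 4 * (V' * φ x ^ 2) + 4 / c₀ * (V ^ 2 / V' * q ^ 2) + 2 * V * φ x * q := by
        field_simp; ring
      linarith
    have t3 : -(c₀ / 4 * (V' * φ x ^ 2)) ≤ V * φ x ^ 2 * r := by
      have h3 : |r| ≤ |M| := hMx.trans (le_abs_self M)
      have h4 : |M| * V ≤ c₀ / 4 * V' := by
        have : c₀ / 4 * (m₀ * V) ≤ c₀ / 4 * V' := by gcongr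
        have e3 : c₀ / 4 * (m₀ * V) = |M| * V + c₀ / 4 * V := by rw [hm₀]; field_simp
        nlinarith [mul_pos hc₀ hV]
      have h5 := neg_abs_le r
      have h6 : 0 ≤ V * φ x ^ 2 := by positivity
      nlinarith [mul_nonneg h6 (abs_nonneg r), sq_nonneg (φ x),
        mul_le_mul_of_nonneg_right h4 (sq_nonneg (φ x)), mul_le_mul_of_nonneg_left h3 h6,
        mul_le_mul_of_nonneg_left h5 h6]
    linarith
  rw [integral_sub (hai.const_mul _) (hbi.const_mul _), integral_const_mul,
    integral_const_mul] at h2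
  have h3 := h2.trans h1
  have hI0 : 0 ≤ ∫ x in S, u x ∂surfaceMeasure :=
    integral_nonneg fun x => mul_nonneg (hW0 _).le (sq_nonneg _)
  have hb0 : 0 ≤ ∫ x in Ω, b x := setIntegral_nonneg hΩ.isOpen.measurableSet fun x hx =>
    mul_nonneg (div_nonneg (sq_nonneg _) (hdW x (subset_closure hx)).le) (sq_nonneg _)
  set Ia := ∫ x in Ω, a x
  set Ib := ∫ x in Ω, b x
  set Iu := ∫ x in S, u x ∂surfaceMeasure
  have h4 : Ia ≤ 2 / c₀ * (4 / c₀ * Ib + C * Iu) := by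
    have : c₀ / 2 * Ia ≤ 4 / c₀ * Ib + C * Iu := by linarith
    calc Ia = 2 / c₀ * (c₀ / 2 * Ia) := by field_simp
      _ ≤ _ := by gcongr
  have h5 : 2 / c₀ * (4 / c₀ * Ib + C * Iu) = 8 / c₀ ^ 2 * Ib + 2 * C / c₀ * Iu := by
    field_simp; ring
  have h6 : 0 ≤ 2 * C / c₀ * Ib := by positivity
  have h7 : 0 ≤ 8 / c₀ ^ 2 * Iu := by positivity
  linarith

/-- The Carleman estimate for `X·∇` on `H¹(Ω)`, with the boundary term on the trace. -/
theorem exists_carleman (hΩ : IsSmoothBoundedDomain Ω) {d : E3 → ℝ}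
    (hd : ContDiffOn ℝ 1 d (closure Ω)) (hd0 : ∀ x ∈ closure Ω, 0 ≤ d x) {X : Fin 3 → E3 → ℝ}
    (hXc : ∀ k, ContinuousOn (X k) (closure Ω)) (hX : ∀ k, MemSobolev Ω ⊤ 1 (X k)) {S : Set E3}
    (hS : MeasurableSet S) (hSf : S ⊆ frontier Ω)
    (hsign : ∀ (c : BoundaryChart Ω), ∀ x ∈ c.dom, x ∈ frontier Ω → x ∉ S →
      0 ≤ ∑ k, X k x * pderiv k c.height x)
    {c₀ : ℝ} (hc₀ : 0 < c₀) (hXd : ∀ x ∈ Ω, c₀ ≤ ∑ k, X k x * pderiv k d x) :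
    ∃ C m₀ : ℝ, 0 < C ∧ 0 < m₀ ∧ ∀ W : ℝ → ℝ, ContDiff ℝ 1 W → (∀ t, 0 < W t) →
      (∀ t, 0 ≤ t → m₀ * W t ≤ deriv W t) → ∀ f : E3 → ℝ, MemSobolev Ω 2 1 f →
      ∫ x in Ω, deriv W (d x) * f x ^ 2 ≤
        C * (∫ x in Ω, W (d x) ^ 2 / deriv W (d x) * (∑ k, X k x * weakPartial Ω k f x) ^ 2) +
        C * ∫ x in S, W (d x) * trace Ω f x ^ 2 ∂surfaceMeasure := by
  obtain ⟨C, m₀, hC, hm₀, hest⟩ :=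
    hΩ.exists_carleman_smooth hd hd0 hXc hX hS hSf hsign hc₀ hXd
  refine ⟨4 * C, m₀, by positivity, hm₀, fun W hW hW0 hWm f hf => ?_⟩
  obtain ⟨hτ, φ, hφ, h0, h1, hτt⟩ := hΩ.isTrace_trace hf
  set τ := trace Ω f
  have hdW : ∀ x ∈ closure Ω, 0 < deriv W (d x) := fun x hx =>
    lt_of_lt_of_le (mul_pos hm₀ (hW0 _)) (hWm _ (hd0 x hx))
  have hWd : ContinuousOn (fun x => W (d x)) (closure Ω) :=
    hW.continuous.comp_continuousOn hd.continuousOn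
  have hW'd : ContinuousOn (fun x => deriv W (d x)) (closure Ω) :=
    (hW.continuous_deriv le_rfl).comp_continuousOn hd.continuousOn
  have hqd : ContinuousOn (fun x => W (d x) ^ 2 / deriv W (d x)) (closure Ω) :=
    (hWd.pow 2).div hW'd fun x hx => (hdW x hx).ne'
  have hWdΩ : ∀ {w : E3 → ℝ}, ContinuousOn w (closure Ω) → MemLp w ⊤ (volume.restrict Ω) :=
    fun hw => hΩ.memLp_of_continuousOn hw
  have hσS : surfaceMeasure.restrict S ≤ surfaceMeasure.restrict (frontier Ω) :=
    Measure.restrict_mono hSf le_rfl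
  have hWS : MemLp (fun x => W (d x)) ⊤ (surfaceMeasure.restrict S) :=
    (hΩ.memLp_frontier_of_continuousOn hWd).mono_measure hσS
  -- the approximation errors and their weighted integrals
  have m0 : ∀ n, MemLp (fun x => φ n x - f x) 2 (volume.restrict Ω) := fun n =>
    (hΩ.memLp_of_continuousOn (hφ n).continuous.continuousOn).sub hf.1
  have m1 : ∀ k n, MemLp (fun x => pderiv k (φ n) x - weakPartial Ω k f x) 2
      (volume.restrict Ω) := fun k n =>
    (hΩ.memLp_of_continuousOn (continuous_pderiv (hφ n) k).continuousOn).sub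
      (hf.weakPartial hΩ.isOpen k)
  have m2 : ∀ n, MemLp (fun x => φ n x - τ x) 2 (surfaceMeasure.restrict S) := fun n =>
    ((hΩ.memLp_frontier_of_continuousOn (hφ n).continuous.continuousOn).sub hτ).mono_measure hσS
  have e0 := tendsto_integral_weight_sq (hWdΩ hW'd) m0 h0
  have hwk : ∀ k, ContinuousOn (fun x => 3 * (W (d x) ^ 2 / deriv W (d x)) * X k x ^ 2)
      (closure Ω) := fun k => (continuousOn_const.mul hqd).mul ((hXc k).pow 2)
  have e1 := fun k => tendsto_integral_weight_sq (hWdΩ (hwk k)) (m1 k) (h1 k)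
  have e2 := tendsto_integral_weight_sq hWS m2
    (tendsto_of_tendsto_of_tendsto_of_le_of_le tendsto_const_nhds hτt (fun n => zero_le)
      fun n => eLpNorm_mono_measure _ hσS)
  have hsum := tendsto_finsetSum Finset.univ fun k (_ : k ∈ Finset.univ) => e1 k
  have herr := (((hsum.const_mul (4 * C)).add (e2.const_mul (4 * C))).add
    (e0.const_mul 2)).const_add (4 * C * (∫ x in Ω, W (d x) ^ 2 / deriv W (d x) *
      (∑ k, X k x * weakPartial Ω k f x) ^ 2) + 4 * C * ∫ x in S, W (d x) * τ x ^ 2 ∂surfaceMeasure)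
  simp only [Finset.sum_const_zero, mul_zero, add_zero] at herr
  refine ge_of_tendsto' herr fun n => ?_
  have hn := hest W hW hW0 hWm (φ n) (hφ n)
  -- splitting each square as `a² ≤ 2 b² + 2 (b - a)²`
  have s0 : ∫ x in Ω, deriv W (d x) * f x ^ 2 ≤ 2 * (∫ x in Ω, deriv W (d x) * φ n x ^ 2) +
      2 * ∫ x in Ω, deriv W (d x) * (φ n x - f x) ^ 2 := by
    have i1 := integrable_weight_mul_sq (hWdΩ hW'd)
      (hΩ.memLp_of_continuousOn (p := 2) (hφ n).continuous.continuousOn)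
    have i2 := integrable_weight_mul_sq (hWdΩ hW'd) (m0 n)
    rw [← integral_const_mul, ← integral_const_mul,
      ← integral_add (i1.const_mul 2) (i2.const_mul 2)]
    refine setIntegral_mono_on (integrable_weight_mul_sq (hWdΩ hW'd) hf.1)
      ((i1.const_mul 2).add (i2.const_mul 2)) hΩ.isOpen.measurableSet fun x hx => ?_
    have := hdW x (subset_closure hx)
    nlinarith [mul_nonneg this.le (sq_nonneg (2 * φ n x - f x))]
  have s1 : ∫ x in Ω, W (d x) ^ 2 / deriv W (d x) * (∑ k, X k x * pderiv k (φ n) x) ^ 2 ≤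
      2 * (∫ x in Ω, W (d x) ^ 2 / deriv W (d x) * (∑ k, X k x * weakPartial Ω k f x) ^ 2) +
      2 * ∑ k, ∫ x in Ω, 3 * (W (d x) ^ 2 / deriv W (d x)) * X k x ^ 2 *
        (pderiv k (φ n) x - weakPartial Ω k f x) ^ 2 := by
    have mX : MemLp (fun x => ∑ k, X k x * weakPartial Ω k f x) 2 (volume.restrict Ω) :=
      memLp_finsetSum _ fun k _ =>
        (hf.weakPartial hΩ.isOpen k).memLp.mul (p := ⊤) (q := 2) (hX k).1
    have mY : MemLp (fun x => ∑ k, X k x * pderiv k (φ n) x) 2 (volume.restrict Ω) :=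
      hΩ.memLp_of_continuousOn (continuousOn_finsetSum _ fun k _ =>
        (hXc k).mul (continuous_pderiv (hφ n) k).continuousOn)
    have i0 := integrable_weight_mul_sq (hWdΩ hqd) mY
    have i1 := integrable_weight_mul_sq (hWdΩ hqd) mX
    have i2 := fun k => integrable_weight_mul_sq (hWdΩ (hwk k)) (m1 k n)
    have i3 := integrable_finsetSum Finset.univ fun k (_ : k ∈ Finset.univ) => i2 k
    rw [← integral_const_mul, ← integral_finsetSum _ fun k _ => i2 k, ← integral_const_mul,
      ← integral_add (i1.const_mul 2) (i3.const_mul 2)]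
    refine setIntegral_mono_on i0 ((i1.const_mul 2).add (i3.const_mul 2))
      hΩ.isOpen.measurableSet fun x hx => ?_
    have hw : 0 ≤ W (d x) ^ 2 / deriv W (d x) :=
      div_nonneg (sq_nonneg _) (hdW x (subset_closure hx)).le
    simp only [Fin.sum_univ_three]
    set w := W (d x) ^ 2 / deriv W (d x)
    set a0 := X 0 x * weakPartial Ω 0 f x with ha0
    set a1 := X 1 x * weakPartial Ω 1 f x with ha1
    set a2 := X 2 x * weakPartial Ω 2 f x with ha2
    set b0 := X 0 x * pderiv 0 (φ n) x with hb0
    set b1 := X 1 x * pderiv 1 (φ n) x with hb1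
    set b2 := X 2 x * pderiv 2 (φ n) x with hb2
    have e : 3 * w * X 0 x ^ 2 * (pderiv 0 (φ n) x - weakPartial Ω 0 f x) ^ 2 +
        3 * w * X 1 x ^ 2 * (pderiv 1 (φ n) x - weakPartial Ω 1 f x) ^ 2 +
        3 * w * X 2 x ^ 2 * (pderiv 2 (φ n) x - weakPartial Ω 2 f x) ^ 2 =
        w * (3 * ((b0 - a0) ^ 2 + (b1 - a1) ^ 2 + (b2 - a2) ^ 2)) := by
      rw [ha0, ha1, ha2, hb0, hb1, hb2]; ring
    rw [e]
    have h3 : (b0 + b1 + b2) ^ 2 ≤ 2 * (a0 + a1 + a2) ^ 2 +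
        2 * (3 * ((b0 - a0) ^ 2 + (b1 - a1) ^ 2 + (b2 - a2) ^ 2)) := by
      nlinarith [sq_nonneg ((b0 + b1 + b2) - 2 * (a0 + a1 + a2)),
        sq_nonneg ((b0 - a0) - (b1 - a1)), sq_nonneg ((b0 - a0) - (b2 - a2)),
        sq_nonneg ((b1 - a1) - (b2 - a2))]
    nlinarith [mul_le_mul_of_nonneg_left h3 hw]
  have s2 : ∫ x in S, W (d x) * φ n x ^ 2 ∂surfaceMeasure ≤
      2 * (∫ x in S, W (d x) * τ x ^ 2 ∂surfaceMeasure) +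
      2 * ∫ x in S, W (d x) * (φ n x - τ x) ^ 2 ∂surfaceMeasure := by
    have i0 := integrable_weight_mul_sq hWS ((hΩ.memLp_frontier_of_continuousOn (p := 2)
      (hφ n).continuous.continuousOn).mono_measure hσS)
    have i1 := integrable_weight_mul_sq hWS (hτ.mono_measure hσS)
    have i2 := integrable_weight_mul_sq hWS (m2 n)
    rw [← integral_const_mul, ← integral_const_mul,
      ← integral_add (i1.const_mul 2) (i2.const_mul 2)]
    refine setIntegral_mono_on i0 ((i1.const_mul 2).add (i2.const_mul 2)) hS fun x hx => ?_
    nlinarith [mul_nonneg (hW0 (d x)).le (sq_nonneg (φ n x - 2 * τ x))]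
  have s1' := mul_le_mul_of_nonneg_left s1 (by positivity : 0 ≤ 2 * C)
  have s2' := mul_le_mul_of_nonneg_left s2 (by positivity : 0 ≤ 2 * C)
  linarith

end IsSmoothBoundedDomain

/-! ### Second weak derivatives and the gradient of the weight function -/

lemma normSq_nonneg (v : Fin 3 → ℝ) : 0 ≤ normSq v := Finset.sum_nonneg fun i _ => sq_nonneg (v i)

lemma sq_le_normSq (v : Fin 3 → ℝ) (k : Fin 3) : v k ^ 2 ≤ normSq v :=
  Finset.single_le_sum (f := fun i => v i ^ 2) (fun i _ => sq_nonneg (v i)) (Finset.mem_univ k)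

lemma sq_sum_mul_le_normSq_mul (a v : Fin 3 → ℝ) :
    (∑ k, a k * v k) ^ 2 ≤ normSq a * normSq v :=
  Finset.sum_mul_sq_le_sq_mul_sq _ _ _

/-- A finite family of functions in `L^∞` has a common essential bound. -/
lemma exists_ae_forall_abs_le {α ι : Type*} [MeasurableSpace α] [Fintype ι] {μ : Measure α}
    {w : ι → α → ℝ} (hw : ∀ i, MemLp (w i) ⊤ μ) :
    ∃ M, 0 ≤ M ∧ ∀ᵐ x ∂μ, ∀ i, |w i x| ≤ M := by
  choose M hM0 hM using fun i => exists_ae_abs_le (hw i)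
  refine ⟨∑ i, M i, Finset.sum_nonneg fun i _ => hM0 i, ?_⟩
  filter_upwards [ae_all_iff.2 hM] with x hx i
  exact (hx i).trans (Finset.single_le_sum (fun j _ => hM0 j) (Finset.mem_univ i))

lemma pderiv_comm {φ : E3 → ℝ} (hφ : ContDiff ℝ ∞ φ) (i j : Fin 3) (x : E3) :
    pderiv i (pderiv j φ) x = pderiv j (pderiv i φ) x := by
  have h2 : (2 : WithTop ℕ∞) ≤ ((⊤ : ℕ∞) : WithTop ℕ∞) := WithTop.coe_le_coe.2 le_top
  have hd : DifferentiableAt ℝ (fderiv ℝ φ) x :=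
    ((hφ.of_le (m := 2) h2).fderiv_right (m := 1)
      (by norm_num)).differentiable one_ne_zero x
  have key : ∀ k l : Fin 3, pderiv k (pderiv l φ) x =
      fderiv ℝ (fderiv ℝ φ) x (basisVec k) (basisVec l) := fun k l => by
    have h := hd.hasFDerivAt.clm_apply (hasFDerivAt_const (basisVec l) x)
    change fderiv ℝ (fun y => fderiv ℝ φ y (basisVec l)) x (basisVec k) = _
    rw [h.fderiv]
    simp
  rw [key, key]
  exact (hφ.contDiffAt.isSymmSndFDerivAt (by simpa using h2)) _ _

/-- If `∂ᵢ g` and `∂ⱼ g` exist weakly, then so does `∂ᵢ ∂ⱼ g` once `∂ⱼ ∂ᵢ g` does, and they agree. -/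
lemma HasWeakPartial.symm {Ω : Set E3} {g gi gj gji : E3 → ℝ} {i j : Fin 3}
    (hi : HasWeakPartial Ω i g gi) (hj : HasWeakPartial Ω j g gj)
    (hji : HasWeakPartial Ω j gi gji) : HasWeakPartial Ω i gj gji := by
  refine ⟨hj.locallyIntegrableOn_deriv, hji.locallyIntegrableOn_deriv, fun φ hφ hφc hφΩ => ?_⟩
  have h1 := hj.integral_eq (pderiv i φ) (contDiff_pderiv hφ i) (hasCompactSupport_pderiv hφc i)
    ((tsupport_pderiv_subset φ i).trans hφΩ)
  have h2 := hi.integral_eq (pderiv j φ) (contDiff_pderiv hφ j) (hasCompactSupport_pderiv hφc j)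
    ((tsupport_pderiv_subset φ j).trans hφΩ)
  have h3 := hji.integral_eq φ hφ hφc hφΩ
  have h4 : ∫ x in Ω, g x * pderiv j (pderiv i φ) x = ∫ x in Ω, g x * pderiv i (pderiv j φ) x := by
    simp only [pderiv_comm hφ j i]
  simp only [pderiv] at *
  linarith

/-- Weak second derivatives commute. -/
lemma MemSobolev.weakPartial_comm {Ω : Set E3} (hΩ : IsOpen Ω) {p : ℝ≥0∞} {g : E3 → ℝ}
    (hg : MemSobolev Ω p 2 g) (i j : Fin 3) :
    Carleman.weakPartial Ω i (Carleman.weakPartial Ω j g) =ᵐ[volume.restrict Ω]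
      Carleman.weakPartial Ω j (Carleman.weakPartial Ω i g) :=
  ((hg.hasWeakPartial i).symm (hg.hasWeakPartial j)
    ((hg.weakPartial hΩ i).hasWeakPartial j)).weakPartial_ae_eq hΩ

namespace IsSmoothBoundedDomain

variable {Ω : Set E3} {d f w : E3 → ℝ}

lemma exists_pos_lower_bound (hΩ : IsSmoothBoundedDomain Ω) (hf : ContinuousOn f (closure Ω))
    (hpos : ∀ x ∈ closure Ω, 0 < f x) : ∃ c, 0 < c ∧ ∀ x ∈ closure Ω, c ≤ f x := by
  obtain ⟨x, hx, hmin⟩ := hΩ.isCompact_closure.exists_isMinOn hΩ.isConnected.nonempty.closure hf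
  exact ⟨f x, hpos x hx, fun y hy => hmin hy⟩

lemma closureGrad_eq (hΩ : IsSmoothBoundedDomain Ω) {x : E3} (hx : x ∈ Ω) (k : Fin 3) :
    closureGrad Ω d x k = pderiv k d x := by
  rw [closureGrad, fderivWithin_of_mem_nhds (mem_of_superset (hΩ.isOpen.mem_nhds hx) subset_closure)]

lemma contDiffOn_closureGrad (hΩ : IsSmoothBoundedDomain Ω) (hd : ContDiffOn ℝ 2 d (closure Ω))
    (k : Fin 3) : ContDiffOn ℝ 1 (fun x => closureGrad Ω d x k) (closure Ω) :=
  (hd.fderivWithin hΩ.uniqueDiffOn_closure (by norm_num)).clm_apply contDiffOn_const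

lemma nonneg_of_pos (hd : ContinuousOn d (closure Ω)) (hpos : ∀ x ∈ Ω, 0 < d x) :
    ∀ x ∈ closure Ω, 0 ≤ d x := fun x hx => by
  have : Set.MapsTo d (closure Ω) (closure (Set.Ici 0)) :=
    Set.MapsTo.closure_of_continuousOn (fun y hy => (hpos y hy).le) hd
  simpa using this hx

/-- At a boundary point where `d` attains its minimum `0`, the gradient of `d` points into the
domain. -/
lemma closureGrad_inner_nonneg (hΩ : IsSmoothBoundedDomain Ω)
    (hd0 : ∀ x ∈ closure Ω, 0 ≤ d x) (c : BoundaryChart Ω) {x : E3} (hx : x ∈ c.dom)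
    (hxf : x ∈ frontier Ω) (hdx : d x = 0) :
    0 ≤ ∑ k, closureGrad Ω d x k * pderiv k c.height x := by
  -- the gradient `N` of the height is an inner normal, hence tangent to `closure Ω`
  set N : E3 := WithLp.toLp 2 fun k => pderiv k c.height x
  have hN : ∀ k, N k = pderiv k c.height x := fun k => rfl
  have hpos : 0 < fderiv ℝ c.height x N := by
    rw [← sum_coord_mul_fderiv]
    refine lt_of_le_of_ne (Finset.sum_nonneg fun k _ => mul_self_nonneg _) fun h0 => ?_
    have hz : ∀ k, pderiv k c.height x = 0 := fun k => by
      have := (Finset.sum_eq_zero_iff_of_nonneg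
        (fun k _ => mul_self_nonneg (pderiv k c.height x))).1 h0.symm k (Finset.mem_univ k)
      exact mul_self_eq_zero.1 this
    have h1 := c.fderiv_height_up x
    rw [← sum_coord_mul_fderiv] at h1
    simp only [pderiv] at hz
    simp [hz] at h1
  have hev := c.eventually_mem hx (c.height_eq_zero hΩ.isOpen hx hxf) hpos
  have hcone : N ∈ posTangentConeAt (closure Ω) x :=
    mem_posTangentConeAt_of_frequently_mem
      (hev.mono fun t ht => subset_closure ht).frequently
  have hmin : IsLocalMinOn d (closure Ω) x := by
    filter_upwards [self_mem_nhdsWithin] with y hy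
    rw [hdx]; exact hd0 y hy
  have := hmin.fderivWithin_nonneg hcone
  rw [← sum_coord_mul_fderiv] at this
  convert this using 2 with k
  rw [hN, mul_comm]; rfl

end IsSmoothBoundedDomain

/-! ### Exponential weights -/

lemma phi0_pos (d : E3 → ℝ) (lam : ℝ) (x : E3) : 0 < phi0 d lam x := Real.exp_pos _

lemma one_le_phi0 {d : E3 → ℝ} {lam : ℝ} {x : E3} (hl : 0 ≤ lam) (hd : 0 ≤ d x) :
    1 ≤ phi0 d lam x := Real.one_le_exp (mul_nonneg hl hd)

namespace IsSmoothBoundedDomain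

variable {Ω : Set E3} {d w f : E3 → ℝ}

lemma continuousOn_phi0 (hd : ContinuousOn d (closure Ω)) (lam : ℝ) :
    ContinuousOn (phi0 d lam) (closure Ω) :=
  Real.continuous_exp.comp_continuousOn (continuousOn_const.mul hd)

lemma continuousOn_exp_phi0 (hd : ContinuousOn d (closure Ω)) (lam s : ℝ) :
    ContinuousOn (fun x => Real.exp (2 * s * phi0 d lam x)) (closure Ω) :=
  Real.continuous_exp.comp_continuousOn (continuousOn_const.mul (continuousOn_phi0 hd lam))

lemma integrableOn_weight_sq (hΩ : IsSmoothBoundedDomain Ω) (hw : ContinuousOn w (closure Ω))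
    (hf : MemLp f 2 (volume.restrict Ω)) : IntegrableOn (fun x => w x * f x ^ 2) Ω :=
  integrable_weight_mul_sq (hΩ.memLp_of_continuousOn hw) hf

lemma integrableOn_frontier_weight_sq (hΩ : IsSmoothBoundedDomain Ω)
    (hw : ContinuousOn w (closure Ω)) {S : Set E3} (hS : S ⊆ frontier Ω)
    (hf : MemLp f 2 (surfaceMeasure.restrict (frontier Ω))) :
    IntegrableOn (fun x => w x * f x ^ 2) S surfaceMeasure :=
  (show IntegrableOn (fun x => w x * f x ^ 2) (frontier Ω) surfaceMeasure from
    integrable_weight_mul_sq (hΩ.memLp_frontier_of_continuousOn hw) hf).mono_set hS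

/-- The Carleman estimate with the weight `W(d) = exp (q λ d + 2 s e^{λ d})`, for which
`W'(d) = (q λ + 2 s λ φ₀) W(d)` is comparable to `s λ φ₀ W(d)`. -/
lemma exists_carleman_exp (hΩ : IsSmoothBoundedDomain Ω)
    (hd : ContDiffOn ℝ 1 d (closure Ω)) (hd0 : ∀ x ∈ closure Ω, 0 ≤ d x) {X : Fin 3 → E3 → ℝ}
    (hXc : ∀ k, ContinuousOn (X k) (closure Ω)) (hX : ∀ k, MemSobolev Ω ⊤ 1 (X k)) {S : Set E3}
    (hS : MeasurableSet S) (hSf : S ⊆ frontier Ω)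
    (hsign : ∀ (c : BoundaryChart Ω), ∀ x ∈ c.dom, x ∈ frontier Ω → x ∉ S →
      0 ≤ ∑ k, X k x * pderiv k c.height x)
    {c₀ : ℝ} (hc₀ : 0 < c₀) (hXd : ∀ x ∈ Ω, c₀ ≤ ∑ k, X k x * pderiv k d x) :
    ∃ C Λ : ℝ, 0 < C ∧ 1 ≤ Λ ∧ ∀ q : ℝ, |q| ≤ 1 → ∀ lam s : ℝ, Λ ≤ lam → 1 ≤ s →
      ∀ f : E3 → ℝ, MemSobolev Ω 2 1 f →
      ∫ x in Ω, s * lam * phi0 d lam x *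
          (Real.exp (q * lam * d x) * Real.exp (2 * s * phi0 d lam x)) * f x ^ 2 ≤
        C * (∫ x in Ω, 1 / (s * lam * phi0 d lam x) *
          (Real.exp (q * lam * d x) * Real.exp (2 * s * phi0 d lam x)) *
            (∑ k, X k x * weakPartial Ω k f x) ^ 2) +
        C * ∫ x in S, Real.exp (q * lam * d x) * Real.exp (2 * s * phi0 d lam x) *
          trace Ω f x ^ 2 ∂surfaceMeasure := by
  obtain ⟨C, m₀, hC, hm₀, hest⟩ := hΩ.exists_carleman hd hd0 hXc hX hS hSf hsign hc₀ hXd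
  refine ⟨C, max m₀ 1, hC, le_max_right _ _, fun q hq lam s hl hs f hf => ?_⟩
  have hl1 : 1 ≤ lam := (le_max_right _ _).trans hl
  have hlm : m₀ ≤ lam := (le_max_left _ _).trans hl
  set W : ℝ → ℝ := fun t => Real.exp (q * lam * t + 2 * s * Real.exp (lam * t)) with hW
  have hWs : ContDiff ℝ 1 W := by rw [hW]; fun_prop
  have hWd : ∀ t, deriv W t = (q * lam + 2 * s * lam * Real.exp (lam * t)) * W t := fun t => by
    have h1 : HasDerivAt (fun t : ℝ => q * lam * t) (q * lam) t := by
      simpa using (hasDerivAt_id t).const_mul (q * lam)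
    have h2 : HasDerivAt (fun t : ℝ => lam * t) lam t := by
      simpa using (hasDerivAt_id t).const_mul lam
    have h3 : HasDerivAt W _ t := (h1.add (h2.exp.const_mul (2 * s))).exp
    rw [h3.deriv, hW]
    simp only [Pi.add_apply]
    ring
  have hlow : ∀ t, 0 ≤ t → s * lam * Real.exp (lam * t) * W t ≤ deriv W t := fun t ht => by
    rw [hWd]
    have hW0 : 0 < W t := Real.exp_pos _
    have h1 : 1 ≤ Real.exp (lam * t) := Real.one_le_exp (by positivity)
    have h2 : lam * 1 ≤ lam * (s * Real.exp (lam * t)) := by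
      gcongr; nlinarith
    have h3 : -lam ≤ q * lam := by nlinarith [(abs_le.1 hq).1]
    gcongr
    nlinarith
  have hm : ∀ t, 0 ≤ t → m₀ * W t ≤ deriv W t := fun t ht => by
    refine le_trans ?_ (hlow t ht)
    have hW0 : 0 < W t := Real.exp_pos _
    have h1 : 1 ≤ Real.exp (lam * t) := Real.one_le_exp (by positivity)
    gcongr
    have h2 : lam * 1 ≤ lam * (s * Real.exp (lam * t)) := by
      gcongr; nlinarith
    nlinarith
  have h := hest W hWs (fun t => Real.exp_pos _) hm f hf
  have hWx : ∀ x, W (d x) = Real.exp (q * lam * d x) * Real.exp (2 * s * phi0 d lam x) :=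
    fun x => by rw [hW, phi0, ← Real.exp_add]
  simp only [← hWx]
  have hcW : ContinuousOn (fun x => W (d x)) (closure Ω) :=
    hWs.continuous.comp_continuousOn hd.continuousOn
  have hcW' : ContinuousOn (fun x => deriv W (d x)) (closure Ω) :=
    (hWs.continuous_deriv le_rfl).comp_continuousOn hd.continuousOn
  have hcp := continuousOn_phi0 hd.continuousOn lam
  have hW0 : ∀ x, 0 < W (d x) := fun x => Real.exp_pos _
  have hmu : ∀ x, 0 < s * lam * phi0 d lam x := fun x => by
    have := phi0_pos d lam x
    positivity
  have hdW : ∀ x ∈ closure Ω, 0 < deriv W (d x) := fun x hx =>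
    lt_of_lt_of_le (mul_pos (hmu x) (hW0 x)) (hlow _ (hd0 x hx))
  have mX : MemLp (fun x => ∑ k, X k x * weakPartial Ω k f x) 2 (volume.restrict Ω) :=
    memLp_finsetSum _ fun k _ =>
      (hf.weakPartial hΩ.isOpen k).memLp.mul (p := ⊤) (q := 2) (hX k).1
  refine (setIntegral_mono_on
    (hΩ.integrableOn_weight_sq ((continuousOn_const.mul hcp).mul hcW) hf.1)
    (hΩ.integrableOn_weight_sq hcW' hf.1) hΩ.isOpen.measurableSet fun x hx => ?_).trans
    (h.trans (add_le_add_left (mul_le_mul_of_nonneg_left ?_ hC.le) _))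
  · exact mul_le_mul_of_nonneg_right (hlow _ (hd0 x (subset_closure hx))) (sq_nonneg _)
  · refine setIntegral_mono_on
      (hΩ.integrableOn_weight_sq ((hcW.pow 2).div hcW' fun x hx => (hdW x hx).ne') mX)
      (hΩ.integrableOn_weight_sq ((continuousOn_const.div (continuousOn_const.mul hcp)
        fun x hx => (hmu x).ne').mul hcW) mX) hΩ.isOpen.measurableSet fun x hx => ?_
    have hx' := subset_closure hx
    have := hW0 x
    have h1 := hmu x
    refine mul_le_mul_of_nonneg_right ?_ (sq_nonneg _)
    rw [div_le_iff₀ (hdW x hx')]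
    calc W (d x) ^ 2 = 1 / (s * lam * phi0 d lam x) * W (d x) *
          (s * lam * phi0 d lam x * W (d x)) := by
            rw [show 1 / (s * lam * phi0 d lam x) * W (d x) * (s * lam * phi0 d lam x * W (d x)) =
              (s * lam * phi0 d lam x) / (s * lam * phi0 d lam x) * W (d x) ^ 2 by ring,
              div_self h1.ne', one_mul]
      _ ≤ _ := by gcongr; exact hlow _ (hd0 x hx')

/-- The Carleman estimates for `X·∇` in the two scalings used below, with the factor `s λ φ₀`
respectively its inverse on the boundary. -/
lemma exists_carleman_pair (hΩ : IsSmoothBoundedDomain Ω)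
    (hd : ContDiffOn ℝ 1 d (closure Ω)) (hd0 : ∀ x ∈ closure Ω, 0 ≤ d x) {X : Fin 3 → E3 → ℝ}
    (hXc : ∀ k, ContinuousOn (X k) (closure Ω)) (hX : ∀ k, MemSobolev Ω ⊤ 1 (X k)) {S : Set E3}
    (hS : MeasurableSet S) (hSf : S ⊆ frontier Ω)
    (hsign : ∀ (c : BoundaryChart Ω), ∀ x ∈ c.dom, x ∈ frontier Ω → x ∉ S →
      0 ≤ ∑ k, X k x * pderiv k c.height x)
    {c₀ : ℝ} (hc₀ : 0 < c₀) (hXd : ∀ x ∈ Ω, c₀ ≤ ∑ k, X k x * pderiv k d x) :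
    ∃ C Λ : ℝ, 0 < C ∧ 1 ≤ Λ ∧ ∀ lam s : ℝ, Λ ≤ lam → 1 ≤ s →
      ∀ f : E3 → ℝ, MemSobolev Ω 2 1 f →
      (∫ x in Ω, s ^ 2 * lam ^ 2 * phi0 d lam x ^ 2 * Real.exp (2 * s * phi0 d lam x) * f x ^ 2 ≤
        C * (∫ x in Ω, Real.exp (2 * s * phi0 d lam x) *
            (∑ k, X k x * weakPartial Ω k f x) ^ 2) +
        C * ∫ x in S, s * lam * phi0 d lam x * Real.exp (2 * s * phi0 d lam x) *
          trace Ω f x ^ 2 ∂surfaceMeasure) ∧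
      (∫ x in Ω, Real.exp (2 * s * phi0 d lam x) * f x ^ 2 ≤
        C * (∫ x in Ω, 1 / (s ^ 2 * lam ^ 2 * phi0 d lam x ^ 2) *
            Real.exp (2 * s * phi0 d lam x) * (∑ k, X k x * weakPartial Ω k f x) ^ 2) +
        C * ∫ x in S, 1 / (s * lam * phi0 d lam x) * Real.exp (2 * s * phi0 d lam x) *
          trace Ω f x ^ 2 ∂surfaceMeasure) := by
  obtain ⟨C, Λ, hC, hΛ, hest⟩ := hΩ.exists_carleman_exp hd hd0 hXc hX hS hSf hsign hc₀ hXd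
  refine ⟨C, Λ, hC, hΛ, fun lam s hl hs f hf => ?_⟩
  have hsl : 0 < s * lam := mul_pos (by linarith) (by linarith)
  have hs0 : s ≠ 0 := by linarith
  have hl0 : lam ≠ 0 := by linarith
  constructor
  · have h := mul_le_mul_of_nonneg_left (hest 1 (by simp) lam s hl hs f hf) hsl.le
    have e : ∀ x, Real.exp (1 * lam * d x) = phi0 d lam x := fun x => by rw [one_mul, phi0]
    simp only [e, mul_add, mul_left_comm (s * lam) C, ← integral_const_mul (s * lam)] at h
    refine le_of_eq_of_le (integral_congr_ae (ae_of_all _ fun x => ?_)) (h.trans_eq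
      (congrArg₂ (· + ·)
        (congrArg (C * ·) (integral_congr_ae (ae_of_all _ fun x => ?_)))
        (congrArg (C * ·) (integral_congr_ae (ae_of_all _ fun x => ?_)))))
    all_goals
      have := (phi0_pos d lam x).ne'
      beta_reduce
      field_simp
  · have h := mul_le_mul_of_nonneg_left (hest (-1) (by simp) lam s hl hs f hf)
      (inv_pos.2 hsl).le
    have e : ∀ x, Real.exp (-1 * lam * d x) = (phi0 d lam x)⁻¹ := fun x => by
      rw [phi0, ← Real.exp_neg]; congr 1; ring
    simp only [e, mul_add, mul_left_comm (s * lam)⁻¹ C, ← integral_const_mul (s * lam)⁻¹] at h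
    refine le_of_eq_of_le (integral_congr_ae (ae_of_all _ fun x => ?_)) (h.trans_eq
      (congrArg₂ (· + ·)
        (congrArg (C * ·) (integral_congr_ae (ae_of_all _ fun x => ?_)))
        (congrArg (C * ·) (integral_congr_ae (ae_of_all _ fun x => ?_)))))
    all_goals
      have := (phi0_pos d lam x).ne'
      beta_reduce
      field_simp

end IsSmoothBoundedDomain

/-! ### The operator `P` -/

namespace IsSmoothBoundedDomain

variable {Ω Γ : Set E3} {d w f : E3 → ℝ} {A : E3 → Matrix (Fin 3) (Fin 3) ℝ}

lemma integrableOn_weight_normSq (hΩ : IsSmoothBoundedDomain Ω) (hw : ContinuousOn w (closure Ω))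
    {v : E3 → Fin 3 → ℝ} (hv : ∀ k, MemLp (fun x => v x k) 2 (volume.restrict Ω)) :
    IntegrableOn (fun x => w x * normSq (v x)) Ω := by
  simp only [normSq, Finset.mul_sum]
  exact integrable_finsetSum _ fun k _ => hΩ.integrableOn_weight_sq hw (hv k)

lemma integrableOn_frontier_weight_normSq (hΩ : IsSmoothBoundedDomain Ω)
    (hw : ContinuousOn w (closure Ω)) {v : E3 → Fin 3 → ℝ}
    (hv : ∀ k, MemLp (fun x => v x k) 2 (surfaceMeasure.restrict (frontier Ω))) :
    IntegrableOn (fun x => w x * normSq (v x)) (frontier Ω) surfaceMeasure := by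
  simp only [normSq, Finset.mul_sum]
  exact integrable_finsetSum _ fun k _ =>
    hΩ.integrableOn_frontier_weight_sq hw subset_rfl (hv k)

lemma opP_ae_eq (hΩ : IsSmoothBoundedDomain Ω) (hA : ∀ k j, MemSobolev Ω ⊤ 1 (fun x => A x k j))
    (hf : MemSobolev Ω 2 1 f) :
    ∀ᵐ x ∂(volume.restrict Ω), ∀ k, opP Ω A f x k =
      ∑ j, (weakPartial Ω j f x * A x k j + f x * weakPartial Ω j (fun y => A y k j) x) := by
  have h : ∀ k j, ∀ᵐ x ∂(volume.restrict Ω), weakPartial Ω j (fun y => (f y • A y) k j) x =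
      weakPartial Ω j f x * A x k j + f x * weakPartial Ω j (fun y => A y k j) x := fun k j =>
    (hΩ.hasWeakPartial_mul hf (hA k j) j).weakPartial_ae_eq hΩ.isOpen
  filter_upwards [ae_all_iff.2 fun k => ae_all_iff.2 (h k)] with x hx k
  change ∑ j, weakPartial Ω j (fun y => (f y • A y) k j) x = _
  exact Finset.sum_congr rfl fun j _ => hx k j

lemma memLp_opP (hΩ : IsSmoothBoundedDomain Ω) (hA : ∀ k j, MemSobolev Ω ⊤ 1 (fun x => A x k j))
    (hf : MemSobolev Ω 2 1 f) (k : Fin 3) :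
    MemLp (fun x => opP Ω A f x k) 2 (volume.restrict Ω) := by
  change MemLp (fun x => ∑ j, weakPartial Ω j (fun y => f y * A y k j) x) 2 _
  exact memLp_finsetSum _ fun j _ => (hΩ.memSobolev_two_mul hf (hA k j)).weakPartial hΩ.isOpen j

/-- As `A` is invertible, `Pf = A ∇f + f div A` controls `∇f` up to a multiple of `f`. -/
lemma exists_weakGrad_le_opP (hΩ : IsSmoothBoundedDomain Ω)
    (hA : ∀ k j, MemSobolev Ω ⊤ 1 (fun x => A x k j)) (hAc : ContinuousOn A (closure Ω))
    (hdet : ∀ x ∈ closure Ω, (A x).det ≠ 0) :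
    ∃ K, 0 < K ∧ ∀ f : E3 → ℝ, MemSobolev Ω 2 1 f → ∀ᵐ x ∂(volume.restrict Ω),
      normSq (weakGrad Ω f x) ≤ K * (normSq (opP Ω A f x) + f x ^ 2) := by
  have hdetc : ContinuousOn (fun x => (A x).det) (closure Ω) :=
    (continuous_id.matrix_det).comp_continuousOn hAc
  have hadj : ContinuousOn (fun x => (A x).adjugate) (closure Ω) :=
    (continuous_id.matrix_adjugate).comp_continuousOn hAc
  have hadjc : ∀ i j, ContinuousOn (fun x => (A x).adjugate i j) (closure Ω) := fun i j =>
    (continuous_apply_apply i j).comp_continuousOn hadj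
  have hNc : ContinuousOn (fun x => ∑ k, normSq (fun j => (A x)⁻¹ k j)) (closure Ω) := by
    simp only [normSq, Matrix.inv_def, Ring.inverse_eq_inv', Matrix.smul_apply, smul_eq_mul]
    exact continuousOn_finsetSum _ fun k _ => continuousOn_finsetSum _ fun j _ =>
      ((hdetc.inv₀ hdet).mul (hadjc k j)).pow 2
  obtain ⟨N, hN0, hN⟩ := hΩ.exists_bound hNc
  obtain ⟨M, hM0, hM⟩ := exists_ae_abs_le (μ := volume.restrict Ω)
    (w := fun x => ∑ k, (∑ j, weakPartial Ω j (fun y => A y k j) x) ^ 2) (by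
      refine memLp_finsetSum _ fun k _ => ?_
      have h : MemLp (fun x => ∑ j, weakPartial Ω j (fun y => A y k j) x) ⊤
          (volume.restrict Ω) :=
        memLp_finsetSum _ fun j _ => (hA k j).weakPartial hΩ.isOpen j
      simp only [pow_two]
      exact h.mul (p := ⊤) (q := ⊤) h)
  refine ⟨2 * N * (1 + M) + 1, by positivity, fun f hf => ?_⟩
  filter_upwards [hM, hΩ.opP_ae_eq hA hf, ae_restrict_mem hΩ.isOpen.measurableSet]
    with x hMx hPx hx
  have hx' := subset_closure hx
  set D : Fin 3 → ℝ := fun k => ∑ j, weakPartial Ω j (fun y => A y k j) x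
  set v : Fin 3 → ℝ := fun k => opP Ω A f x k - f x * D k with hv
  have hAv : A x *ᵥ weakGrad Ω f x = v := by
    ext k
    simp only [hv, hPx k, Matrix.mulVec, dotProduct, weakGrad, D, Finset.sum_add_distrib,
      ← Finset.mul_sum, add_sub_cancel_right]
    exact Finset.sum_congr rfl fun j _ => mul_comm _ _
  have hg : weakGrad Ω f x = (A x)⁻¹ *ᵥ v := by
    rw [← hAv, Matrix.mulVec_mulVec, Matrix.nonsing_inv_mul _ (isUnit_iff_ne_zero.2 (hdet x hx')),
      Matrix.one_mulVec]
  have h1 : normSq (weakGrad Ω f x) ≤ N * normSq v := by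
    rw [hg]
    calc normSq ((A x)⁻¹ *ᵥ v) ≤ ∑ k, normSq (fun j => (A x)⁻¹ k j) * normSq v :=
          Finset.sum_le_sum fun k _ => sq_sum_mul_le_normSq_mul _ _
      _ = (∑ k, normSq (fun j => (A x)⁻¹ k j)) * normSq v := by rw [Finset.sum_mul]
      _ ≤ N * normSq v := mul_le_mul_of_nonneg_right ((le_abs_self _).trans (hN x hx'))
          (normSq_nonneg v)
  have h2 : normSq v ≤ 2 * normSq (opP Ω A f x) + 2 * (f x ^ 2 * M) := by
    have h3 : normSq D ≤ M := (le_abs_self _).trans hMx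
    calc normSq v ≤ ∑ k, (2 * opP Ω A f x k ^ 2 + 2 * (f x ^ 2 * D k ^ 2)) :=
          Finset.sum_le_sum fun k _ => by
            nlinarith [sq_nonneg (opP Ω A f x k + f x * D k)]
      _ = 2 * normSq (opP Ω A f x) + 2 * (f x ^ 2 * normSq D) := by
          rw [Finset.sum_add_distrib, normSq, normSq, Finset.mul_sum, Finset.mul_sum,
            Finset.mul_sum]
      _ ≤ _ := by gcongr
  have h4 := normSq_nonneg (opP Ω A f x)
  have h5 := sq_nonneg (f x)
  set P := normSq (opP Ω A f x)
  calc normSq (weakGrad Ω f x) ≤ N * (2 * P + 2 * (f x ^ 2 * M)) :=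
        h1.trans (mul_le_mul_of_nonneg_left h2 hN0)
    _ ≤ (2 * N * (1 + M) + 1) * (P + f x ^ 2) := by
        have : 0 ≤ 2 * N * M * P + 2 * N * f x ^ 2 + P + f x ^ 2 := by positivity
        nlinarith

/-- The transport estimate for the field `X = ∇d`, with boundary term on `Γ` only. -/
lemma exists_transport_of_isWeightFunction (hΩ : IsSmoothBoundedDomain Ω)
    (hΓ : IsSubBoundary Ω Γ) (hd : IsWeightFunction Ω Γ d) :
    ∃ C Λ : ℝ, 0 < C ∧ 1 ≤ Λ ∧ ∀ lam s : ℝ, Λ ≤ lam → 1 ≤ s →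
      ∀ f : E3 → ℝ, MemSobolev Ω 2 1 f →
      ∫ x in Ω, s ^ 2 * lam ^ 2 * phi0 d lam x ^ 2 * Real.exp (2 * s * phi0 d lam x) * f x ^ 2 ≤
        C * (∫ x in Ω, Real.exp (2 * s * phi0 d lam x) * normSq (weakGrad Ω f x)) +
        C * ∫ x in Γ, s * lam * phi0 d lam x * Real.exp (2 * s * phi0 d lam x) *
          trace Ω f x ^ 2 ∂surfaceMeasure := by
  obtain ⟨-, U, hU, rfl⟩ := hΓ
  have hd1 : ContDiffOn ℝ 1 d (closure Ω) := hd.contDiffOn.of_le (by norm_num)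
  have hd0 := nonneg_of_pos hd1.continuousOn hd.pos
  have hXs := hΩ.contDiffOn_closureGrad hd.contDiffOn
  have hNc : ContinuousOn (fun x => normSq (closureGrad Ω d x)) (closure Ω) :=
    continuousOn_finsetSum _ fun k _ => (hXs k).continuousOn.pow 2
  obtain ⟨c₀, hc₀, hc⟩ := hΩ.exists_pos_lower_bound hNc hd.grad_pos
  obtain ⟨N, hN0, hN⟩ := hΩ.exists_bound hNc
  obtain ⟨C, Λ, hC, hΛ, hest⟩ := hΩ.exists_carleman_pair hd1 hd0
    (X := fun k x => closureGrad Ω d x k) (fun k => (hXs k).continuousOn)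
    (fun k => hΩ.memSobolev_of_contDiffOn (hXs k))
    (isClosed_frontier.measurableSet.inter hU.measurableSet) Set.inter_subset_left
    (fun c x hx hxf hxS => hΩ.closureGrad_inner_nonneg hd0 c hx hxf (hd.eq_zero x ⟨hxf, hxS⟩))
    hc₀ (fun x hx => (hc x (subset_closure hx)).trans_eq (Finset.sum_congr rfl fun k _ => by
      rw [pow_two, hΩ.closureGrad_eq hx k]))
  refine ⟨C * (N + 1), Λ, by positivity, hΛ, fun lam s hl hs f hf => ?_⟩
  have hl0 : 0 < lam := by linarith
  have hE := continuousOn_exp_phi0 hd1.continuousOn lam s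
  have hg : ∀ k, MemLp (fun x => weakGrad Ω f x k) 2 (volume.restrict Ω) := fun k =>
    hf.weakPartial hΩ.isOpen k
  have hX0 : ∀ k, MemLp (fun x => closureGrad Ω d x k) ⊤ (volume.restrict Ω) := fun k =>
    hΩ.memLp_of_continuousOn (hXs k).continuousOn
  have h1 : ∫ x in Ω, Real.exp (2 * s * phi0 d lam x) *
      (∑ k, closureGrad Ω d x k * weakPartial Ω k f x) ^ 2 ≤
      N * ∫ x in Ω, Real.exp (2 * s * phi0 d lam x) * normSq (weakGrad Ω f x) := by
    rw [← integral_const_mul]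
    refine setIntegral_mono_on (hΩ.integrableOn_weight_sq hE
      (memLp_finsetSum _ fun k _ => (hg k).mul (p := ⊤) (q := 2) (hX0 k)))
      ((hΩ.integrableOn_weight_normSq hE hg).const_mul N) hΩ.isOpen.measurableSet fun x hx => ?_
    have h2 := sq_sum_mul_le_normSq_mul (closureGrad Ω d x) (weakGrad Ω f x)
    have h3 : normSq (closureGrad Ω d x) ≤ N :=
      (le_abs_self _).trans (hN x (subset_closure hx))
    calc _ ≤ Real.exp (2 * s * phi0 d lam x) * (N * normSq (weakGrad Ω f x)) :=
          mul_le_mul_of_nonneg_left (h2.trans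
            (mul_le_mul_of_nonneg_right h3 (normSq_nonneg _))) (Real.exp_pos _).le
      _ = _ := by ring
  have h2 := (hest lam s hl hs f hf).1
  have hG0 : 0 ≤ ∫ x in Ω, Real.exp (2 * s * phi0 d lam x) * normSq (weakGrad Ω f x) :=
    integral_nonneg fun x => mul_nonneg (Real.exp_pos _).le (normSq_nonneg _)
  have hB0 : 0 ≤ ∫ x in frontier Ω ∩ U, s * lam * phi0 d lam x *
      Real.exp (2 * s * phi0 d lam x) * trace Ω f x ^ 2 ∂surfaceMeasure :=
    integral_nonneg fun x => by
      have := phi0_pos d lam x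
      positivity
  refine h2.trans ?_
  have h3 := mul_le_mul_of_nonneg_left h1 hC.le
  have h4 := mul_nonneg hC.le hG0
  have h5 := mul_nonneg (mul_nonneg hC.le hN0) hB0
  linarith

/-- The Carleman estimate for the operator `P`. -/
theorem exists_carleman_opP (hΩ : IsSmoothBoundedDomain Ω)
    (hΓ : IsSubBoundary Ω Γ) (hd : IsWeightFunction Ω Γ d)
    (hA : ∀ k j, MemSobolev Ω ⊤ 1 (fun x => A x k j)) (hAc : ContinuousOn A (closure Ω))
    (hdet : ∀ x ∈ closure Ω, (A x).det ≠ 0) :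
    ∃ lam₀ C : ℝ, 1 ≤ lam₀ ∧ 0 < C ∧ ∀ lam s : ℝ, lam₀ ≤ lam → 1 ≤ s →
      ∀ f : E3 → ℝ, MemSobolev Ω 2 1 f →
        ∫ x in Ω, (normSq (weakGrad Ω f x) + s ^ 2 * lam ^ 2 * phi0 d lam x ^ 2 * f x ^ 2)
            * Real.exp (2 * s * phi0 d lam x)
          ≤ C * (∫ x in Ω, normSq (opP Ω A f x) * Real.exp (2 * s * phi0 d lam x))
            + C * (∫ x in Γ, s * lam * phi0 d lam x * trace Ω f x ^ 2
                * Real.exp (2 * s * phi0 d lam x) ∂surfaceMeasure) := by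
  obtain ⟨C, Λ, hC, hΛ, hest⟩ := hΩ.exists_transport_of_isWeightFunction hΓ hd
  obtain ⟨K, hK, hgrad⟩ := hΩ.exists_weakGrad_le_opP hA hAc hdet
  -- `λ² ≥ 2 C K` lets the left side absorb the zeroth-order term of `Pf`
  refine ⟨Λ + 2 * C * K, K + (K + 1) * (2 * C * K + 2 * C), by nlinarith [mul_pos hC hK],
    by positivity, fun lam s hl hs f hf => ?_⟩
  have hCK := mul_pos hC hK
  have hl1 : 1 ≤ lam := by linarith
  have hd1 : ContinuousOn d (closure Ω) := hd.contDiffOn.continuousOn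
  have hd0 := nonneg_of_pos hd1 hd.pos
  have hE := continuousOn_exp_phi0 hd1 lam s
  have hp := continuousOn_phi0 hd1 lam
  have hwc : ContinuousOn (fun x => s ^ 2 * lam ^ 2 * phi0 d lam x ^ 2 *
      Real.exp (2 * s * phi0 d lam x)) (closure Ω) :=
    (continuousOn_const.mul (hp.pow 2)).mul hE
  have hg : ∀ k, MemLp (fun x => weakGrad Ω f x k) 2 (volume.restrict Ω) := fun k =>
    hf.weakPartial hΩ.isOpen k
  have iG := hΩ.integrableOn_weight_normSq hE hg
  have iF := hΩ.integrableOn_weight_sq hwc hf.1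
  have iZ := hΩ.integrableOn_weight_sq hE hf.1
  have iP := hΩ.integrableOn_weight_normSq hE (hΩ.memLp_opP hA hf)
  have h1 := hest lam s (by linarith) hs f hf
  have h2 : ∫ x in Ω, Real.exp (2 * s * phi0 d lam x) * normSq (weakGrad Ω f x) ≤
      K * (∫ x in Ω, Real.exp (2 * s * phi0 d lam x) * normSq (opP Ω A f x)) +
      K * ∫ x in Ω, Real.exp (2 * s * phi0 d lam x) * f x ^ 2 := by
    rw [← integral_const_mul, ← integral_const_mul,
      ← integral_add (iP.const_mul K) (iZ.const_mul K)]
    refine integral_mono_ae iG ((iP.const_mul K).add (iZ.const_mul K)) ?_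
    filter_upwards [hgrad f hf] with x hx
    have := mul_le_mul_of_nonneg_left hx (Real.exp_pos (2 * s * phi0 d lam x)).le
    linarith
  have h3 : lam ^ 2 * ∫ x in Ω, Real.exp (2 * s * phi0 d lam x) * f x ^ 2 ≤
      ∫ x in Ω, s ^ 2 * lam ^ 2 * phi0 d lam x ^ 2 * Real.exp (2 * s * phi0 d lam x) *
        f x ^ 2 := by
    rw [← integral_const_mul]
    refine setIntegral_mono_on (iZ.const_mul _) iF hΩ.isOpen.measurableSet fun x hx => ?_
    have e1 : 1 ≤ phi0 d lam x := one_le_phi0 (by linarith) (hd0 x (subset_closure hx))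
    have e2 : (1 : ℝ) ≤ s ^ 2 * phi0 d lam x ^ 2 :=
      one_le_mul_of_one_le_of_one_le (one_le_pow₀ hs) (one_le_pow₀ e1)
    have e3 : 0 ≤ lam ^ 2 * (Real.exp (2 * s * phi0 d lam x) * f x ^ 2) := by positivity
    nlinarith [mul_le_mul_of_nonneg_right e2 e3]
  have hL : ∫ x in Ω, (normSq (weakGrad Ω f x) + s ^ 2 * lam ^ 2 * phi0 d lam x ^ 2 * f x ^ 2)
      * Real.exp (2 * s * phi0 d lam x) =
      (∫ x in Ω, Real.exp (2 * s * phi0 d lam x) * normSq (weakGrad Ω f x)) +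
      ∫ x in Ω, s ^ 2 * lam ^ 2 * phi0 d lam x ^ 2 * Real.exp (2 * s * phi0 d lam x) *
        f x ^ 2 := by
    rw [← integral_add iG iF]
    exact integral_congr_ae (ae_of_all _ fun x => by ring)
  have hZ0 : 0 ≤ ∫ x in Ω, Real.exp (2 * s * phi0 d lam x) * f x ^ 2 :=
    integral_nonneg fun x => by positivity
  have hP0 : 0 ≤ ∫ x in Ω, Real.exp (2 * s * phi0 d lam x) * normSq (opP Ω A f x) :=
    integral_nonneg fun x => mul_nonneg (Real.exp_pos _).le (normSq_nonneg _)
  have hB0 : 0 ≤ ∫ x in Γ, s * lam * phi0 d lam x *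
      Real.exp (2 * s * phi0 d lam x) * trace Ω f x ^ 2 ∂surfaceMeasure :=
    integral_nonneg fun x => by
      have := phi0_pos d lam x
      positivity
  have hB : ∫ x in Γ, s * lam * phi0 d lam x * trace Ω f x ^ 2 *
      Real.exp (2 * s * phi0 d lam x) ∂surfaceMeasure = ∫ x in Γ, s * lam * phi0 d lam x *
      Real.exp (2 * s * phi0 d lam x) * trace Ω f x ^ 2 ∂surfaceMeasure :=
    integral_congr_ae (ae_of_all _ fun x => by ring)
  have hP : ∫ x in Ω, normSq (opP Ω A f x) * Real.exp (2 * s * phi0 d lam x) =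
      ∫ x in Ω, Real.exp (2 * s * phi0 d lam x) * normSq (opP Ω A f x) :=
    integral_congr_ae (ae_of_all _ fun x => by ring)
  rw [hL, hB, hP]
  set G := ∫ x in Ω, Real.exp (2 * s * phi0 d lam x) * normSq (weakGrad Ω f x)
  set F := ∫ x in Ω, s ^ 2 * lam ^ 2 * phi0 d lam x ^ 2 * Real.exp (2 * s * phi0 d lam x) *
    f x ^ 2
  set P := ∫ x in Ω, Real.exp (2 * s * phi0 d lam x) * normSq (opP Ω A f x)
  set Z := ∫ x in Ω, Real.exp (2 * s * phi0 d lam x) * f x ^ 2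
  set B := ∫ x in Γ, s * lam * phi0 d lam x * Real.exp (2 * s * phi0 d lam x) *
    trace Ω f x ^ 2 ∂surfaceMeasure
  have hl2 : 1 + 2 * C * K ≤ lam ^ 2 := by nlinarith
  have h4 : (1 + 2 * C * K) * Z ≤ F := (mul_le_mul_of_nonneg_right hl2 hZ0).trans h3
  have h5 : C * G ≤ C * K * P + C * K * Z := by nlinarith [mul_le_mul_of_nonneg_left h2 hC.le]
  have h6 : F ≤ 2 * C * K * P + 2 * C * B := by nlinarith
  have h7 : Z ≤ F := by nlinarith [mul_nonneg hCK.le hZ0]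
  have h8 : G ≤ K * P + K * F := by nlinarith
  have h9 : (K + 1) * F ≤ (K + 1) * (2 * C * K * P + 2 * C * B) := by gcongr
  have h10 : 0 ≤ K * B + (K + 1) * (2 * C * K * B) + (K + 1) * (2 * C * P) := by positivity
  linarith

end IsSmoothBoundedDomain

/-! ### Leibniz rules for the operator `Q` -/

/-- Cyclic form of the cross product, with indices modulo `3`. -/
lemma crossProduct_apply_cyclic (u v : Fin 3 → ℝ) (i : Fin 3) :
    crossProduct u v i = u (i + 1) * v (i + 2) - u (i + 2) * v (i + 1) := by
  fin_cases i <;> simp [cross_apply]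

/-- Cyclic form of the rotation, with indices modulo `3`. -/
lemma rot_apply_cyclic (Ω : Set E3) (v : E3 → Fin 3 → ℝ) (x : E3) (i : Fin 3) :
    rot Ω v x i = weakPartial Ω (i + 1) (fun y => v y (i + 2)) x -
      weakPartial Ω (i + 2) (fun y => v y (i + 1)) x := by
  fin_cases i <;> rfl

/-- The scalar triple product identity `(b × c)·v = c·(v × b)`. -/
lemma sum_crossProduct_mul (b c v : Fin 3 → ℝ) :
    ∑ k, crossProduct b c k * v k = ∑ i, c i * crossProduct v b i := by
  simp only [cross_apply, Fin.sum_univ_three, Matrix.cons_val_zero, Matrix.cons_val_one,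
    Matrix.cons_val]
  ring

namespace IsSmoothBoundedDomain

variable {Ω : Set E3} {d w g : E3 → ℝ} {b u v : E3 → Fin 3 → ℝ}

lemma memSobolev_crossProduct (hΩ : IsSmoothBoundedDomain Ω)
    (hu : ∀ i, MemSobolev Ω ⊤ 1 (fun x => u x i)) (hv : ∀ i, MemSobolev Ω ⊤ 1 (fun x => v x i))
    (i : Fin 3) : MemSobolev Ω ⊤ 1 (fun x => crossProduct (u x) (v x) i) := by
  simp only [crossProduct_apply_cyclic]
  exact (hΩ.memSobolev_mul (hu _) (hv _)).sub (hΩ.memSobolev_mul (hu _) (hv _))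

lemma continuousOn_crossProduct (hu : ∀ i, ContinuousOn (fun x => u x i) (closure Ω))
    (hv : ∀ i, ContinuousOn (fun x => v x i) (closure Ω)) (i : Fin 3) :
    ContinuousOn (fun x => crossProduct (u x) (v x) i) (closure Ω) := by
  simp only [crossProduct_apply_cyclic]
  exact ((hu _).mul (hv _)).sub ((hu _).mul (hv _))

lemma memSobolev_weakPartial_mul (hΩ : IsSmoothBoundedDomain Ω) (hg : MemSobolev Ω 2 2 g)
    (hw : MemSobolev Ω ⊤ 2 w) (j : Fin 3) :
    MemSobolev Ω 2 1 (weakPartial Ω j fun x => g x * w x) :=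
  ((hΩ.memSobolev_two_mul (hg.weakPartial hΩ.isOpen j) hw.of_succ).add
    (hΩ.memSobolev_two_mul hg.of_succ (hw.weakPartial hΩ.isOpen j))).congr hΩ.isOpen
    ((hΩ.hasWeakPartial_mul hg.of_succ hw.of_succ j).weakPartial_ae_eq hΩ.isOpen).symm

/-- Second-order Leibniz rule. -/
lemma weakPartial_weakPartial_mul (hΩ : IsSmoothBoundedDomain Ω) (hg : MemSobolev Ω 2 2 g)
    (hw : MemSobolev Ω ⊤ 2 w) (k j : Fin 3) :
    weakPartial Ω k (weakPartial Ω j fun x => g x * w x) =ᵐ[volume.restrict Ω] fun x =>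
      (weakPartial Ω k (weakPartial Ω j g) x * w x + weakPartial Ω j g x * weakPartial Ω k w x) +
      (weakPartial Ω k g x * weakPartial Ω j w x +
        g x * weakPartial Ω k (weakPartial Ω j w) x) :=
  HasWeakPartial.weakPartial_ae_eq hΩ.isOpen <|
    ((hΩ.hasWeakPartial_mul (hg.weakPartial hΩ.isOpen j) hw.of_succ k).add
      (hΩ.hasWeakPartial_mul hg.of_succ (hw.weakPartial hΩ.isOpen j) k)).congr hΩ.isOpen
      ((hΩ.hasWeakPartial_mul hg.of_succ hw.of_succ j).weakPartial_ae_eq hΩ.isOpen).symm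
      (ae_eq_refl _)

lemma opQ_apply_cyclic (i : Fin 3) : (fun x => opQ Ω b g x i) = fun x =>
    weakPartial Ω (i + 1) (fun y => g y * b y (i + 2)) x -
      weakPartial Ω (i + 2) (fun y => g y * b y (i + 1)) x := by
  funext x
  rw [opQ, rot_apply_cyclic]
  rfl

lemma memSobolev_opQ (hΩ : IsSmoothBoundedDomain Ω) (hb : ∀ i, MemSobolev Ω ⊤ 2 (fun x => b x i))
    (hg : MemSobolev Ω 2 2 g) (i : Fin 3) : MemSobolev Ω 2 1 (fun x => opQ Ω b g x i) := by
  rw [opQ_apply_cyclic]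
  exact (hΩ.memSobolev_weakPartial_mul hg (hb _) _).sub (hΩ.memSobolev_weakPartial_mul hg (hb _) _)

lemma opQ_ae_eq (hΩ : IsSmoothBoundedDomain Ω) (hb : ∀ i, MemSobolev Ω ⊤ 2 (fun x => b x i))
    (hg : MemSobolev Ω 2 2 g) : ∀ᵐ x ∂(volume.restrict Ω), ∀ i,
      opQ Ω b g x i = crossProduct (weakGrad Ω g x) (b x) i + g x * rot Ω b x i := by
  have h : ∀ j i, ∀ᵐ x ∂(volume.restrict Ω), weakPartial Ω j (fun y => g y * b y i) x =
      weakPartial Ω j g x * b x i + g x * weakPartial Ω j (fun y => b y i) x := fun j i =>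
    (hΩ.hasWeakPartial_mul hg.of_succ (hb i).of_succ j).weakPartial_ae_eq hΩ.isOpen
  filter_upwards [ae_all_iff.2 fun j => ae_all_iff.2 (h j)] with x hx i
  rw [congrFun (opQ_apply_cyclic (Ω := Ω) (b := b) (g := g) i) x, crossProduct_apply_cyclic,
    rot_apply_cyclic, hx, hx]
  simp only [weakGrad]
  ring

/-- `∂ₖ(Qg) = ∇(∂ₖg) × b` up to terms of order at most one in `g`. -/
lemma weakPartial_opQ_ae_eq (hΩ : IsSmoothBoundedDomain Ω)
    (hb : ∀ i, MemSobolev Ω ⊤ 2 (fun x => b x i)) (hg : MemSobolev Ω 2 2 g) :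
    ∀ᵐ x ∂(volume.restrict Ω), ∀ k i, weakPartial Ω k (fun y => opQ Ω b g y i) x =
      crossProduct (weakGrad Ω (weakPartial Ω k g) x) (b x) i +
      (weakPartial Ω (i + 1) g x * weakPartial Ω k (fun y => b y (i + 2)) x +
        weakPartial Ω k g x * weakPartial Ω (i + 1) (fun y => b y (i + 2)) x +
        g x * weakPartial Ω k (weakPartial Ω (i + 1) fun y => b y (i + 2)) x -
      (weakPartial Ω (i + 2) g x * weakPartial Ω k (fun y => b y (i + 1)) x +
        weakPartial Ω k g x * weakPartial Ω (i + 2) (fun y => b y (i + 1)) x +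
        g x * weakPartial Ω k (weakPartial Ω (i + 2) fun y => b y (i + 1)) x)) := by
  have h1 : ∀ k i, ∀ᵐ x ∂(volume.restrict Ω), weakPartial Ω k (fun y => opQ Ω b g y i) x =
      weakPartial Ω k (weakPartial Ω (i + 1) fun y => g y * b y (i + 2)) x -
        weakPartial Ω k (weakPartial Ω (i + 2) fun y => g y * b y (i + 1)) x := fun k i => by
    rw [opQ_apply_cyclic]
    exact (((hΩ.memSobolev_weakPartial_mul hg (hb _) _).hasWeakPartial k).sub
      ((hΩ.memSobolev_weakPartial_mul hg (hb _) _).hasWeakPartial k)).weakPartial_ae_eq hΩ.isOpen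
  have h2 := fun k j i => hΩ.weakPartial_weakPartial_mul hg (hb i) k j
  have h3 := fun k j => hg.weakPartial_comm hΩ.isOpen k j
  filter_upwards [ae_all_iff.2 fun k => ae_all_iff.2 (h1 k),
    ae_all_iff.2 fun k => ae_all_iff.2 fun j => ae_all_iff.2 (h2 k j),
    ae_all_iff.2 fun k => ae_all_iff.2 (h3 k)] with x hx1 hx2 hx3 k i
  rw [hx1, hx2, hx2, hx3 k, hx3 k, crossProduct_apply_cyclic]
  simp only [weakGrad]
  ring

/-- The transport field for `Q` is `X = b × (∇d × b)`: since `X·v = (∇d × b)·(v × b)`, the operator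
`Q`, whose principal part is `∇g × b`, controls `X·∇g`, and `∇Q` controls `X·∇(∂ₗg)`. -/
lemma exists_transport_le_opQ (hΩ : IsSmoothBoundedDomain Ω)
    (hb : ∀ i, MemSobolev Ω ⊤ 2 (fun x => b x i)) {c : E3 → Fin 3 → ℝ}
    (hc : ∀ i, ContinuousOn (fun x => c x i) (closure Ω)) :
    ∃ K, 0 < K ∧ ∀ g : E3 → ℝ, MemSobolev Ω 2 2 g → ∀ᵐ x ∂(volume.restrict Ω),
      (∑ k, crossProduct (b x) (c x) k * weakPartial Ω k g x) ^ 2 ≤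
        K * (normSq (opQ Ω b g x) + g x ^ 2) ∧
      ∑ l, (∑ k, crossProduct (b x) (c x) k * weakPartial Ω k (weakPartial Ω l g) x) ^ 2 ≤
        K * ((∑ i, normSq (weakGrad Ω (fun y => opQ Ω b g y i) x)) +
          normSq (weakGrad Ω g x) + g x ^ 2) := by
  have hNc : ContinuousOn (fun x => normSq (c x)) (closure Ω) :=
    continuousOn_finsetSum _ fun k _ => (hc k).pow 2
  obtain ⟨N, hN0, hN⟩ := hΩ.exists_bound hNc
  obtain ⟨M₁, hM₁0, hM₁⟩ := exists_ae_forall_abs_le (μ := volume.restrict Ω)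
    (w := fun (p : Fin 3 × Fin 3) => weakPartial Ω p.1 fun y => b y p.2)
    fun p => ((hb p.2).weakPartial hΩ.isOpen p.1).memLp
  obtain ⟨M₂, hM₂0, hM₂⟩ := exists_ae_forall_abs_le (μ := volume.restrict Ω)
    (w := fun (p : Fin 3 × Fin 3 × Fin 3) =>
      weakPartial Ω p.1 (weakPartial Ω p.2.1 fun y => b y p.2.2))
    fun p => (((hb p.2.2).weakPartial hΩ.isOpen p.2.1).weakPartial hΩ.isOpen p.1).memLp
  set M := max M₁ M₂
  have hM0 : 0 ≤ M := hM₁0.trans (le_max_left _ _)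
  refine ⟨2 * N + 540 * N * M ^ 2 + 1, by positivity, fun g hg => ?_⟩
  filter_upwards [hM₁, hM₂, hΩ.opQ_ae_eq hb hg, hΩ.weakPartial_opQ_ae_eq hb hg,
    ae_restrict_mem hΩ.isOpen.measurableSet] with x hx1 hx2 hQ hdQ hx
  have hb1 : ∀ j i, |weakPartial Ω j (fun y => b y i) x| ≤ M := fun j i =>
    (hx1 (j, i)).trans (le_max_left _ _)
  have hb2 : ∀ k j i, |weakPartial Ω k (weakPartial Ω j fun y => b y i) x| ≤ M := fun k j i =>
    (hx2 (k, j, i)).trans (le_max_right _ _)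
  have hNx : normSq (c x) ≤ N := (le_abs_self _).trans (hN x (subset_closure hx))
  have hg0 := sq_nonneg (g x)
  have hG0 := normSq_nonneg (weakGrad Ω g x)
  have hQ0 := normSq_nonneg (opQ Ω b g x)
  constructor
  · rw [show ∑ k, crossProduct (b x) (c x) k * weakPartial Ω k g x =
      ∑ i, c x i * crossProduct (weakGrad Ω g x) (b x) i from sum_crossProduct_mul _ _ _]
    have h1 : normSq (crossProduct (weakGrad Ω g x) (b x)) ≤
        2 * normSq (opQ Ω b g x) + 24 * M ^ 2 * g x ^ 2 := by
      have hR : ∀ i, rot Ω b x i ^ 2 ≤ 4 * M ^ 2 := fun i => by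
        rw [rot_apply_cyclic]
        have a1 := abs_le.1 (hb1 (i + 1) (i + 2))
        have a2 := abs_le.1 (hb1 (i + 2) (i + 1))
        rw [show 4 * M ^ 2 = (2 * M) ^ 2 by ring]
        exact sq_le_sq' (by linarith) (by linarith)
      calc normSq (crossProduct (weakGrad Ω g x) (b x)) ≤
            ∑ i, (2 * opQ Ω b g x i ^ 2 + 8 * M ^ 2 * g x ^ 2) :=
            Finset.sum_le_sum fun i _ => by
              rw [hQ i]
              set p := crossProduct (weakGrad Ω g x) (b x) i
              set r := rot Ω b x i
              have h2 := mul_le_mul_of_nonneg_left (hR i) hg0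
              nlinarith [sq_nonneg (p + 2 * (g x * r))]
        _ = _ := by
            rw [Finset.sum_add_distrib, normSq, Finset.mul_sum]
            simp only [Finset.sum_const, Finset.card_univ, Fintype.card_fin, nsmul_eq_mul]
            push_cast; ring
    calc _ ≤ N * (2 * normSq (opQ Ω b g x) + 24 * M ^ 2 * g x ^ 2) :=
          (sq_sum_mul_le_normSq_mul _ _).trans
            (mul_le_mul hNx h1 (normSq_nonneg _) hN0)
      _ ≤ _ := by
          set Q := normSq (opQ Ω b g x)
          have : 0 ≤ 540 * N * M ^ 2 * Q + Q + 2 * N * g x ^ 2 + 516 * N * M ^ 2 * g x ^ 2 +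
            g x ^ 2 := by positivity
          linarith
  · set T := normSq (weakGrad Ω g x) + g x ^ 2 with hT
    have hl : ∀ l, (∑ k, crossProduct (b x) (c x) k *
        weakPartial Ω k (weakPartial Ω l g) x) ^ 2 ≤
        N * (∑ i, (2 * weakPartial Ω l (fun y => opQ Ω b g y i) x ^ 2 + 60 * M ^ 2 * T)) := by
      intro l
      rw [show ∑ k, crossProduct (b x) (c x) k * weakPartial Ω k (weakPartial Ω l g) x =
        ∑ i, c x i * crossProduct (weakGrad Ω (weakPartial Ω l g) x) (b x) i from
          sum_crossProduct_mul _ _ _]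
      refine (sq_sum_mul_le_normSq_mul _ _).trans (mul_le_mul hNx ?_ (normSq_nonneg _) hN0)
      refine Finset.sum_le_sum fun i _ => ?_
      have hd := hdQ l i
      set p := crossProduct (weakGrad Ω (weakPartial Ω l g) x) (b x) i
      set q := weakPartial Ω l (fun y => opQ Ω b g y i) x
      set t1 := weakPartial Ω (i + 1) g x with ht1
      set t2 := weakPartial Ω (i + 2) g x with ht2
      set t0 := weakPartial Ω l g x with ht0
      have k1 : t1 ^ 2 ≤ normSq (weakGrad Ω g x) := sq_le_normSq (weakGrad Ω g x) (i + 1)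
      have k2 : t2 ^ 2 ≤ normSq (weakGrad Ω g x) := sq_le_normSq (weakGrad Ω g x) (i + 2)
      have k0 : t0 ^ 2 ≤ normSq (weakGrad Ω g x) := sq_le_normSq (weakGrad Ω g x) l
      have hr : |q - p| ≤ M * (|t1| + |t2| + 2 * |t0| + 2 * |g x|) := by
        have ht : ∀ {s m : ℝ}, |m| ≤ M → |s * m| ≤ |s| * M := fun h => by
          rw [abs_mul]; exact mul_le_mul_of_nonneg_left h (abs_nonneg _)
        have b1 := abs_le.1 (ht (s := t1) (hb1 l (i + 2)))
        have b2 := abs_le.1 (ht (s := t0) (hb1 (i + 1) (i + 2)))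
        have b3 := abs_le.1 (ht (s := g x) (hb2 l (i + 1) (i + 2)))
        have b4 := abs_le.1 (ht (s := t2) (hb1 l (i + 1)))
        have b5 := abs_le.1 (ht (s := t0) (hb1 (i + 2) (i + 1)))
        have b6 := abs_le.1 (ht (s := g x) (hb2 l (i + 2) (i + 1)))
        rw [abs_le]
        constructor <;> linarith [b1.1, b1.2, b2.1, b2.2, b3.1, b3.2, b4.1, b4.2, b5.1, b5.2,
          b6.1, b6.2]
      have hr2 : (q - p) ^ 2 ≤ 30 * M ^ 2 * T := by
        have h1 : (|t1| + |t2| + 2 * |t0| + 2 * |g x|) ^ 2 ≤ 30 * T := by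
          have e1 := sq_abs t1
          have e2 := sq_abs t2
          have e0 := sq_abs t0
          have e3 := sq_abs (g x)
          set a1 := |t1|
          set a2 := |t2|
          set a0 := |t0|
          set a3 := |g x|
          have : (a1 + a2 + 2 * a0 + 2 * a3) ^ 2 ≤ 10 * (a1 ^ 2 + a2 ^ 2 + a0 ^ 2 + a3 ^ 2) := by
            nlinarith [sq_nonneg (a1 - a2), sq_nonneg (2 * a1 - a0), sq_nonneg (2 * a1 - a3),
              sq_nonneg (2 * a2 - a0), sq_nonneg (2 * a2 - a3), sq_nonneg (a0 - a3)]
          linarith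
        calc (q - p) ^ 2 = |q - p| ^ 2 := (sq_abs _).symm
          _ ≤ (M * (|t1| + |t2| + 2 * |t0| + 2 * |g x|)) ^ 2 := by gcongr
          _ = M ^ 2 * (|t1| + |t2| + 2 * |t0| + 2 * |g x|) ^ 2 := by ring
          _ ≤ M ^ 2 * (30 * T) := by gcongr
          _ = _ := by ring
      nlinarith [sq_nonneg (p - 2 * q)]
    calc _ ≤ ∑ l, N * (∑ i, (2 * weakPartial Ω l (fun y => opQ Ω b g y i) x ^ 2 +
          60 * M ^ 2 * T)) := Finset.sum_le_sum fun l _ => hl l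
      _ = 2 * N * (∑ i, normSq (weakGrad Ω (fun y => opQ Ω b g y i) x)) +
          540 * N * M ^ 2 * T := by
          simp only [normSq, weakGrad, Fin.sum_univ_three]
          ring
      _ ≤ _ := by
          have hS0 : 0 ≤ ∑ i, normSq (weakGrad Ω (fun y => opQ Ω b g y i) x) :=
            Finset.sum_nonneg fun i _ => normSq_nonneg _
          set Sg := ∑ i, normSq (weakGrad Ω (fun y => opQ Ω b g y i) x)
          have hT0 : 0 ≤ T := by positivity
          rw [add_assoc Sg, ← hT]
          have : 0 ≤ 540 * N * M ^ 2 * Sg + Sg + 2 * N * T + T := by positivity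
          linarith

end IsSmoothBoundedDomain

/-! ### The Carleman estimate for `Q` -/

namespace IsSmoothBoundedDomain

variable {Ω Γ : Set E3} {d : E3 → ℝ} {b : E3 → Fin 3 → ℝ}

/-- The Carleman estimate for the operator `Q`. -/
theorem exists_carleman_opQ (hΩ : IsSmoothBoundedDomain Ω) (hd : IsWeightFunction Ω Γ d)
    (hb : ∀ i, MemSobolev Ω ⊤ 2 (fun x => b x i)) (hbc : ContinuousOn b (closure Ω))
    (hcross : ∀ x ∈ closure Ω, normSq (crossProduct (closureGrad Ω d x) (b x)) ≠ 0) :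
    ∃ lam₀ C : ℝ, 1 ≤ lam₀ ∧ 0 < C ∧ ∀ lam s : ℝ, lam₀ ≤ lam → 1 ≤ s →
      ∀ g : E3 → ℝ, MemSobolev Ω 2 2 g →
        ∫ x in Ω, (normSq (weakGrad Ω g x) + s ^ 2 * lam ^ 2 * phi0 d lam x ^ 2 * g x ^ 2)
            * Real.exp (2 * s * phi0 d lam x)
          ≤ C * (∫ x in Ω, (1 / (s ^ 2 * lam ^ 2 * phi0 d lam x ^ 2)
                  * (∑ i, normSq (weakGrad Ω (fun y => opQ Ω b g y i) x))
                + normSq (opQ Ω b g x)) * Real.exp (2 * s * phi0 d lam x))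
            + C * (∫ x in frontier Ω, (1 / (s * lam * phi0 d lam x) * normSq (traceGrad Ω g x)
                + s * lam * phi0 d lam x * trace Ω g x ^ 2)
                * Real.exp (2 * s * phi0 d lam x) ∂surfaceMeasure) := by
  have hd1 : ContDiffOn ℝ 1 d (closure Ω) := hd.contDiffOn.of_le (by norm_num)
  have hd0 := nonneg_of_pos hd1.continuousOn hd.pos
  have hGs := hΩ.contDiffOn_closureGrad hd.contDiffOn
  have hbi : ∀ i, ContinuousOn (fun x => b x i) (closure Ω) := fun i =>
    (continuous_apply i).comp_continuousOn hbc
  set c : E3 → Fin 3 → ℝ := fun x => crossProduct (closureGrad Ω d x) (b x) with hc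
  have hcc : ∀ i, ContinuousOn (fun x => c x i) (closure Ω) :=
    continuousOn_crossProduct (fun i => (hGs i).continuousOn) hbi
  have hcW : ∀ i, MemSobolev Ω ⊤ 1 (fun x => c x i) :=
    hΩ.memSobolev_crossProduct (fun i => hΩ.memSobolev_of_contDiffOn (hGs i))
      fun i => (hb i).of_succ
  set X : Fin 3 → E3 → ℝ := fun k x => crossProduct (b x) (c x) k with hX
  have hXc : ∀ k, ContinuousOn (X k) (closure Ω) := continuousOn_crossProduct hbi hcc
  have hXW : ∀ k, MemSobolev Ω ⊤ 1 (X k) :=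
    hΩ.memSobolev_crossProduct (fun i => (hb i).of_succ) hcW
  obtain ⟨c₀, hc₀, hc0⟩ := hΩ.exists_pos_lower_bound
    (f := fun x => normSq (c x)) (continuousOn_finsetSum _ fun k _ => (hcc k).pow 2)
    fun x hx => lt_of_le_of_ne (normSq_nonneg _) (hcross x hx).symm
  have hXd : ∀ x ∈ Ω, c₀ ≤ ∑ k, X k x * pderiv k d x := fun x hx => by
    refine (hc0 x (subset_closure hx)).trans_eq ?_
    have h := sum_crossProduct_mul (b x) (c x) (closureGrad Ω d x)
    simp only [hΩ.closureGrad_eq hx] at h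
    rw [h]
    exact Finset.sum_congr rfl fun i _ => pow_two _
  obtain ⟨C, Λ, hC, hΛ, hest⟩ := hΩ.exists_carleman_pair hd1 hd0 hXc hXW
    isClosed_frontier.measurableSet subset_rfl (fun _ x _ hxf hxS => absurd hxf hxS) hc₀ hXd
  obtain ⟨K, hK, hQ⟩ := hΩ.exists_transport_le_opQ hb hcc
  have hCK := mul_pos hC hK
  -- `λ² ≥ 4 C K` lets the left side absorb the lower order terms of `Qg` and `∇(Qg)`
  refine ⟨Λ + 4 * C * K, 2 * C * K + 2 * C, by nlinarith, by positivity,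
    fun lam s hl hs g hg => ?_⟩
  have hl1 : 1 ≤ lam := by nlinarith
  have hs0 : 0 < s := by linarith
  have hl0 : 0 < lam := by linarith
  have hE := continuousOn_exp_phi0 hd1.continuousOn lam s
  have hp := continuousOn_phi0 hd1.continuousOn lam
  have hmu : ∀ x, 0 < s * lam * phi0 d lam x := fun x => by
    have := phi0_pos d lam x
    positivity
  have hmu2 : ∀ x, 0 < s ^ 2 * lam ^ 2 * phi0 d lam x ^ 2 := fun x => by
    have := phi0_pos d lam x
    positivity
  have hmu2_ge : ∀ x ∈ Ω, lam ^ 2 ≤ s ^ 2 * lam ^ 2 * phi0 d lam x ^ 2 := fun x hx => by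
    have e1 : 1 ≤ phi0 d lam x := one_le_phi0 hl0.le (hd0 x (subset_closure hx))
    have e2 : (1 : ℝ) ≤ s ^ 2 * phi0 d lam x ^ 2 :=
      one_le_mul_of_one_le_of_one_le (one_le_pow₀ hs) (one_le_pow₀ e1)
    nlinarith [mul_le_mul_of_nonneg_right e2 (sq_nonneg lam)]
  have hw2 : ContinuousOn (fun x => s ^ 2 * lam ^ 2 * phi0 d lam x ^ 2) (closure Ω) :=
    continuousOn_const.mul (hp.pow 2)
  have hw1 : ContinuousOn (fun x => s * lam * phi0 d lam x) (closure Ω) :=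
    continuousOn_const.mul hp
  have hwF : ContinuousOn (fun x => s ^ 2 * lam ^ 2 * phi0 d lam x ^ 2 *
      Real.exp (2 * s * phi0 d lam x)) (closure Ω) := hw2.mul hE
  have hwS : ContinuousOn (fun x => 1 / (s ^ 2 * lam ^ 2 * phi0 d lam x ^ 2) *
      Real.exp (2 * s * phi0 d lam x)) (closure Ω) :=
    (continuousOn_const.div hw2 fun x _ => (hmu2 x).ne').mul hE
  have hwB1 : ContinuousOn (fun x => 1 / (s * lam * phi0 d lam x) *
      Real.exp (2 * s * phi0 d lam x)) (closure Ω) :=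
    (continuousOn_const.div hw1 fun x _ => (hmu x).ne').mul hE
  have hwB2 : ContinuousOn (fun x => s * lam * phi0 d lam x *
      Real.exp (2 * s * phi0 d lam x)) (closure Ω) := hw1.mul hE
  have hgk : ∀ k, MemSobolev Ω 2 1 (weakPartial Ω k g) := fun k => hg.weakPartial hΩ.isOpen k
  have hg1 : ∀ k, MemLp (fun x => weakGrad Ω g x k) 2 (volume.restrict Ω) := fun k => (hgk k).1
  have hq1 : ∀ i, MemSobolev Ω 2 1 (fun x => opQ Ω b g x i) := hΩ.memSobolev_opQ hb hg
  have hXm : ∀ {f : E3 → ℝ}, MemSobolev Ω 2 1 f →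
      MemLp (fun x => ∑ k, X k x * weakPartial Ω k f x) 2 (volume.restrict Ω) := fun hf =>
    memLp_finsetSum _ fun k _ =>
      (hf.weakPartial hΩ.isOpen k).memLp.mul (p := ⊤) (q := 2) (hXW k).1
  -- integrability of all terms
  have iG := hΩ.integrableOn_weight_normSq hE hg1
  have iF := hΩ.integrableOn_weight_sq hwF hg.1
  have iZ := hΩ.integrableOn_weight_sq hE hg.1
  have iQ := hΩ.integrableOn_weight_normSq hE fun i => (hq1 i).1
  have iG' := hΩ.integrableOn_weight_normSq hwS hg1
  have iZ' := hΩ.integrableOn_weight_sq hwS hg.1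
  have iS : IntegrableOn (fun x => 1 / (s ^ 2 * lam ^ 2 * phi0 d lam x ^ 2) *
      Real.exp (2 * s * phi0 d lam x) *
        ∑ i, normSq (weakGrad Ω (fun y => opQ Ω b g y i) x)) Ω := by
    simp only [Finset.mul_sum]
    exact integrable_finsetSum _ fun i _ => hΩ.integrableOn_weight_normSq hwS fun k =>
      (hq1 i).weakPartial hΩ.isOpen k
  have iB1 := hΩ.integrableOn_frontier_weight_normSq hwB1 (v := traceGrad Ω g) fun k =>
    (hΩ.isTrace_trace (hgk k)).1
  have iB2 := hΩ.integrableOn_frontier_weight_sq hwB2 subset_rfl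
    (hΩ.isTrace_trace hg.of_succ).1
  -- the transport estimate for `g` and, summed over `l`, for `∂ₗ g`
  have h1 := (hest lam s (by linarith) hs g hg.of_succ).1
  have h2 : ∫ x in Ω, Real.exp (2 * s * phi0 d lam x) * normSq (weakGrad Ω g x) ≤
      C * (∫ x in Ω, 1 / (s ^ 2 * lam ^ 2 * phi0 d lam x ^ 2) * Real.exp (2 * s * phi0 d lam x) *
        ∑ l, (∑ k, X k x * weakPartial Ω k (weakPartial Ω l g) x) ^ 2) +
      C * ∫ x in frontier Ω, 1 / (s * lam * phi0 d lam x) * Real.exp (2 * s * phi0 d lam x) *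
        normSq (traceGrad Ω g x) ∂surfaceMeasure := by
    simp only [normSq, traceGrad, Finset.mul_sum]
    rw [integral_finsetSum _ fun l _ => hΩ.integrableOn_weight_sq hE (hg1 l),
      integral_finsetSum _ fun l _ => hΩ.integrableOn_weight_sq hwS (hXm (hgk l)),
      integral_finsetSum _ fun l _ => hΩ.integrableOn_frontier_weight_sq hwB1 subset_rfl
        (hΩ.isTrace_trace (hgk l)).1, Finset.mul_sum, Finset.mul_sum, ← Finset.sum_add_distrib]
    exact Finset.sum_le_sum fun l _ => (hest lam s (by linarith) hs _ (hgk l)).2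
  have h3 : ∫ x in Ω, Real.exp (2 * s * phi0 d lam x) *
      (∑ k, X k x * weakPartial Ω k g x) ^ 2 ≤
      K * ((∫ x in Ω, Real.exp (2 * s * phi0 d lam x) * normSq (opQ Ω b g x)) +
        ∫ x in Ω, Real.exp (2 * s * phi0 d lam x) * g x ^ 2) := by
    rw [← integral_add iQ iZ, ← integral_const_mul]
    refine integral_mono_ae (hΩ.integrableOn_weight_sq hE (hXm hg.of_succ))
      ((iQ.add iZ).const_mul K) ?_
    filter_upwards [hQ g hg] with x hx
    have := mul_le_mul_of_nonneg_left hx.1 (Real.exp_pos (2 * s * phi0 d lam x)).le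
    linarith
  have h4 : ∫ x in Ω, 1 / (s ^ 2 * lam ^ 2 * phi0 d lam x ^ 2) *
      Real.exp (2 * s * phi0 d lam x) *
        ∑ l, (∑ k, X k x * weakPartial Ω k (weakPartial Ω l g) x) ^ 2 ≤
      K * ((∫ x in Ω, 1 / (s ^ 2 * lam ^ 2 * phi0 d lam x ^ 2) *
          Real.exp (2 * s * phi0 d lam x) *
          ∑ i, normSq (weakGrad Ω (fun y => opQ Ω b g y i) x)) +
        (∫ x in Ω, 1 / (s ^ 2 * lam ^ 2 * phi0 d lam x ^ 2) *
          Real.exp (2 * s * phi0 d lam x) * normSq (weakGrad Ω g x)) +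
        ∫ x in Ω, 1 / (s ^ 2 * lam ^ 2 * phi0 d lam x ^ 2) *
          Real.exp (2 * s * phi0 d lam x) * g x ^ 2) := by
    have iSG := iS.add iG'
    simp only [Pi.add_def] at iSG
    rw [← integral_add iS iG', ← integral_add iSG iZ', ← integral_const_mul]
    refine integral_mono_ae ?_ ((iSG.add iZ').const_mul K) ?_
    · simp only [Finset.mul_sum]
      exact integrable_finsetSum _ fun l _ => hΩ.integrableOn_weight_sq hwS (hXm (hgk l))
    · filter_upwards [hQ g hg] with x hx
      have hw : 0 ≤ 1 / (s ^ 2 * lam ^ 2 * phi0 d lam x ^ 2) *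
        Real.exp (2 * s * phi0 d lam x) :=
        mul_nonneg (one_div_nonneg.2 (hmu2 x).le) (Real.exp_pos _).le
      have := mul_le_mul_of_nonneg_left hx.2 hw
      linarith
  -- the lower order terms are smaller than the left side by a factor `λ²`
  have h5 : lam ^ 2 * ∫ x in Ω, Real.exp (2 * s * phi0 d lam x) * g x ^ 2 ≤
      ∫ x in Ω, s ^ 2 * lam ^ 2 * phi0 d lam x ^ 2 * Real.exp (2 * s * phi0 d lam x) *
        g x ^ 2 := by
    rw [← integral_const_mul]
    refine setIntegral_mono_on (iZ.const_mul _) iF hΩ.isOpen.measurableSet fun x hx => ?_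
    have e3 : 0 ≤ Real.exp (2 * s * phi0 d lam x) * g x ^ 2 := by positivity
    nlinarith [mul_le_mul_of_nonneg_right (hmu2_ge x hx) e3]
  have hinv : ∀ x ∈ Ω, ∀ t : ℝ, 0 ≤ t → lam ^ 2 *
      (1 / (s ^ 2 * lam ^ 2 * phi0 d lam x ^ 2) * Real.exp (2 * s * phi0 d lam x) * t) ≤
      Real.exp (2 * s * phi0 d lam x) * t := fun x hx t ht => by
    have e1 : lam ^ 2 * (1 / (s ^ 2 * lam ^ 2 * phi0 d lam x ^ 2)) ≤ 1 := by
      rw [mul_one_div]; exact (div_le_one (hmu2 x)).2 (hmu2_ge x hx)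
    have e2 : 0 ≤ Real.exp (2 * s * phi0 d lam x) * t := by positivity
    nlinarith [mul_le_mul_of_nonneg_right e1 e2]
  have h6 : lam ^ 2 * ∫ x in Ω, 1 / (s ^ 2 * lam ^ 2 * phi0 d lam x ^ 2) *
      Real.exp (2 * s * phi0 d lam x) * normSq (weakGrad Ω g x) ≤
      ∫ x in Ω, Real.exp (2 * s * phi0 d lam x) * normSq (weakGrad Ω g x) := by
    rw [← integral_const_mul]
    exact setIntegral_mono_on (iG'.const_mul _) iG hΩ.isOpen.measurableSet fun x hx =>
      hinv x hx _ (normSq_nonneg _)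
  have h7 : lam ^ 2 * ∫ x in Ω, 1 / (s ^ 2 * lam ^ 2 * phi0 d lam x ^ 2) *
      Real.exp (2 * s * phi0 d lam x) * g x ^ 2 ≤
      ∫ x in Ω, Real.exp (2 * s * phi0 d lam x) * g x ^ 2 := by
    rw [← integral_const_mul]
    exact setIntegral_mono_on (iZ'.const_mul _) iZ hΩ.isOpen.measurableSet fun x hx =>
      hinv x hx _ (sq_nonneg _)
  have hL : ∫ x in Ω, (normSq (weakGrad Ω g x) + s ^ 2 * lam ^ 2 * phi0 d lam x ^ 2 * g x ^ 2)
      * Real.exp (2 * s * phi0 d lam x) =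
      (∫ x in Ω, Real.exp (2 * s * phi0 d lam x) * normSq (weakGrad Ω g x)) +
      ∫ x in Ω, s ^ 2 * lam ^ 2 * phi0 d lam x ^ 2 * Real.exp (2 * s * phi0 d lam x) *
        g x ^ 2 := by
    rw [← integral_add iG iF]
    exact integral_congr_ae (ae_of_all _ fun x => by ring)
  have hR : ∫ x in Ω, (1 / (s ^ 2 * lam ^ 2 * phi0 d lam x ^ 2)
        * (∑ i, normSq (weakGrad Ω (fun y => opQ Ω b g y i) x))
        + normSq (opQ Ω b g x)) * Real.exp (2 * s * phi0 d lam x) =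
      (∫ x in Ω, 1 / (s ^ 2 * lam ^ 2 * phi0 d lam x ^ 2) * Real.exp (2 * s * phi0 d lam x) *
        ∑ i, normSq (weakGrad Ω (fun y => opQ Ω b g y i) x)) +
      ∫ x in Ω, Real.exp (2 * s * phi0 d lam x) * normSq (opQ Ω b g x) := by
    rw [← integral_add iS iQ]
    exact integral_congr_ae (ae_of_all _ fun x => by ring)
  have hB : ∫ x in frontier Ω, (1 / (s * lam * phi0 d lam x) * normSq (traceGrad Ω g x)
        + s * lam * phi0 d lam x * trace Ω g x ^ 2)
        * Real.exp (2 * s * phi0 d lam x) ∂surfaceMeasure =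
      (∫ x in frontier Ω, 1 / (s * lam * phi0 d lam x) * Real.exp (2 * s * phi0 d lam x) *
        normSq (traceGrad Ω g x) ∂surfaceMeasure) +
      ∫ x in frontier Ω, s * lam * phi0 d lam x * Real.exp (2 * s * phi0 d lam x) *
        trace Ω g x ^ 2 ∂surfaceMeasure := by
    rw [← integral_add iB1 iB2]
    exact integral_congr_ae (ae_of_all _ fun x => by ring)
  have hZ0 : 0 ≤ ∫ x in Ω, Real.exp (2 * s * phi0 d lam x) * g x ^ 2 :=
    integral_nonneg fun x => by positivity
  have hQ0 : 0 ≤ ∫ x in Ω, Real.exp (2 * s * phi0 d lam x) * normSq (opQ Ω b g x) :=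
    integral_nonneg fun x => mul_nonneg (Real.exp_pos _).le (normSq_nonneg _)
  have hwS0 : ∀ x, 0 ≤ 1 / (s ^ 2 * lam ^ 2 * phi0 d lam x ^ 2) *
      Real.exp (2 * s * phi0 d lam x) := fun x =>
    mul_nonneg (one_div_nonneg.2 (hmu2 x).le) (Real.exp_pos _).le
  have hS0 : 0 ≤ ∫ x in Ω, 1 / (s ^ 2 * lam ^ 2 * phi0 d lam x ^ 2) *
      Real.exp (2 * s * phi0 d lam x) *
        ∑ i, normSq (weakGrad Ω (fun y => opQ Ω b g y i) x) :=
    integral_nonneg fun x => mul_nonneg (hwS0 x) (Finset.sum_nonneg fun i _ => normSq_nonneg _)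
  have hG'0 : 0 ≤ ∫ x in Ω, 1 / (s ^ 2 * lam ^ 2 * phi0 d lam x ^ 2) *
      Real.exp (2 * s * phi0 d lam x) * normSq (weakGrad Ω g x) :=
    integral_nonneg fun x => mul_nonneg (hwS0 x) (normSq_nonneg _)
  have hZ'0 : 0 ≤ ∫ x in Ω, 1 / (s ^ 2 * lam ^ 2 * phi0 d lam x ^ 2) *
      Real.exp (2 * s * phi0 d lam x) * g x ^ 2 :=
    integral_nonneg fun x => mul_nonneg (hwS0 x) (sq_nonneg _)
  have hB10 : 0 ≤ ∫ x in frontier Ω, 1 / (s * lam * phi0 d lam x) *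
      Real.exp (2 * s * phi0 d lam x) * normSq (traceGrad Ω g x) ∂surfaceMeasure :=
    integral_nonneg fun x => mul_nonneg (mul_nonneg (one_div_nonneg.2 (hmu x).le)
      (Real.exp_pos _).le) (normSq_nonneg _)
  have hB20 : 0 ≤ ∫ x in frontier Ω, s * lam * phi0 d lam x * Real.exp (2 * s * phi0 d lam x) *
      trace Ω g x ^ 2 ∂surfaceMeasure :=
    integral_nonneg fun x => mul_nonneg (mul_nonneg (hmu x).le (Real.exp_pos _).le) (sq_nonneg _)
  rw [hL, hR, hB]
  set G := ∫ x in Ω, Real.exp (2 * s * phi0 d lam x) * normSq (weakGrad Ω g x)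
  set F := ∫ x in Ω, s ^ 2 * lam ^ 2 * phi0 d lam x ^ 2 * Real.exp (2 * s * phi0 d lam x) *
    g x ^ 2
  set Q := ∫ x in Ω, Real.exp (2 * s * phi0 d lam x) * normSq (opQ Ω b g x)
  set Z := ∫ x in Ω, Real.exp (2 * s * phi0 d lam x) * g x ^ 2
  set S := ∫ x in Ω, 1 / (s ^ 2 * lam ^ 2 * phi0 d lam x ^ 2) *
    Real.exp (2 * s * phi0 d lam x) * ∑ i, normSq (weakGrad Ω (fun y => opQ Ω b g y i) x)
  set G' := ∫ x in Ω, 1 / (s ^ 2 * lam ^ 2 * phi0 d lam x ^ 2) *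
    Real.exp (2 * s * phi0 d lam x) * normSq (weakGrad Ω g x)
  set Z' := ∫ x in Ω, 1 / (s ^ 2 * lam ^ 2 * phi0 d lam x ^ 2) *
    Real.exp (2 * s * phi0 d lam x) * g x ^ 2
  set B₁ := ∫ x in frontier Ω, 1 / (s * lam * phi0 d lam x) *
    Real.exp (2 * s * phi0 d lam x) * normSq (traceGrad Ω g x) ∂surfaceMeasure
  set B₂ := ∫ x in frontier Ω, s * lam * phi0 d lam x * Real.exp (2 * s * phi0 d lam x) *
    trace Ω g x ^ 2 ∂surfaceMeasure
  have hl2 : 4 * (C * K) ≤ lam ^ 2 := by nlinarith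
  have hl3 : 1 ≤ lam ^ 2 := one_le_pow₀ hl1
  have g1 : 4 * (C * K) * Z ≤ F := (mul_le_mul_of_nonneg_right hl2 hZ0).trans h5
  have g2 : 4 * (C * K) * G' ≤ G := (mul_le_mul_of_nonneg_right hl2 hG'0).trans h6
  have g3 : Z' ≤ Z := by nlinarith [mul_le_mul_of_nonneg_right hl3 hZ'0]
  have g4 : C * K * Z' ≤ C * K * Z := by gcongr
  have g5 := h1.trans (add_le_add_left (mul_le_mul_of_nonneg_left h3 hC.le) _)
  have g6 := h2.trans (add_le_add_left (mul_le_mul_of_nonneg_left h4 hC.le) _)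
  have g0 : 0 ≤ C * K * G' := by positivity
  have g7 : 0 ≤ C * S + C * Q + C * K * B₁ + C * K * B₂ := by positivity
  linarith

end IsSmoothBoundedDomain

end Carleman

end

open Carleman in
theorem theorem3p2 (Ω Γ : Set E3) (hΩ : IsSmoothBoundedDomain Ω) (hΓ : IsSubBoundary Ω Γ)
    (d : E3 → ℝ) (hd : IsWeightFunction Ω Γ d)
    (A : E3 → Matrix (Fin 3) (Fin 3) ℝ) (b : E3 → Fin 3 → ℝ)
    -- `A ∈ W^{1,∞}(Ω)` and `b ∈ W^{2,∞}(Ω)`, given by their continuous representatives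
    (hA : ∀ k j, MemSobolev Ω ⊤ 1 (fun x => A x k j)) (hAc : ContinuousOn A (closure Ω))
    (hb : ∀ i, MemSobolev Ω ⊤ 2 (fun x => b x i)) (hbc : ContinuousOn b (closure Ω))
    (hdet : ∀ x ∈ closure Ω, (A x).det ≠ 0)
    (hcross : ∀ x ∈ closure Ω, normSq (crossProduct (closureGrad Ω d x) (b x)) ≠ 0) :
    ∃ lam₀ s₀ C : ℝ, 1 ≤ lam₀ ∧ 1 ≤ s₀ ∧ 0 < C ∧
      ∀ lam s : ℝ, lam₀ ≤ lam → s₀ ≤ s →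
        (∀ f : E3 → ℝ, MemSobolev Ω 2 1 f →
          ∫ x in Ω, (normSq (weakGrad Ω f x) + s ^ 2 * lam ^ 2 * phi0 d lam x ^ 2 * f x ^ 2)
              * Real.exp (2 * s * phi0 d lam x)
            ≤ C * (∫ x in Ω, normSq (opP Ω A f x) * Real.exp (2 * s * phi0 d lam x))
              + C * (∫ x in Γ, s * lam * phi0 d lam x * trace Ω f x ^ 2
                  * Real.exp (2 * s * phi0 d lam x) ∂surfaceMeasure)) ∧
        (∀ g : E3 → ℝ, MemSobolev Ω 2 2 g →
          ∫ x in Ω, (normSq (weakGrad Ω g x) + s ^ 2 * lam ^ 2 * phi0 d lam x ^ 2 * g x ^ 2)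
              * Real.exp (2 * s * phi0 d lam x)
            ≤ C * (∫ x in Ω, (1 / (s ^ 2 * lam ^ 2 * phi0 d lam x ^ 2)
                    * (∑ i, normSq (weakGrad Ω (fun y => opQ Ω b g y i) x))
                  + normSq (opQ Ω b g x)) * Real.exp (2 * s * phi0 d lam x))
              + C * (∫ x in frontier Ω, (1 / (s * lam * phi0 d lam x) * normSq (traceGrad Ω g x)
                  + s * lam * phi0 d lam x * trace Ω g x ^ 2)
                  * Real.exp (2 * s * phi0 d lam x) ∂surfaceMeasure)) := by
  obtain ⟨l₁, C₁, hl₁, hC₁, h₁⟩ := hΩ.exists_carleman_opP hΓ hd hA hAc hdet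
  obtain ⟨l₂, C₂, hl₂, hC₂, h₂⟩ := hΩ.exists_carleman_opQ hd hb hbc hcross
  refine ⟨max l₁ l₂, 1, C₁ + C₂, hl₁.trans (le_max_left _ _), le_rfl, by positivity,
    fun lam s hl hs => ⟨fun f hf => ?_, fun g hg => ?_⟩⟩
  all_goals
    have hlam : 0 < lam := by linarith [le_max_left l₁ l₂]
    have hs0 : 0 < s := by linarith
    have hp := phi0_pos d lam
    have hmu : ∀ x, 0 < s * lam * phi0 d lam x := fun x => mul_pos (mul_pos hs0 hlam) (hp x)
  · refine (h₁ lam s ((le_max_left _ _).trans hl) hs f hf).trans (add_le_add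
      (mul_le_mul_of_nonneg_right (by linarith) (integral_nonneg fun x => ?_))
      (mul_le_mul_of_nonneg_right (by linarith) (integral_nonneg fun x => ?_)))
    · exact mul_nonneg (normSq_nonneg _) (Real.exp_pos _).le
    · exact mul_nonneg (mul_nonneg (hmu x).le (sq_nonneg _)) (Real.exp_pos _).le
  · refine (h₂ lam s ((le_max_right _ _).trans hl) hs g hg).trans (add_le_add
      (mul_le_mul_of_nonneg_right (by linarith) (integral_nonneg fun x => ?_))
      (mul_le_mul_of_nonneg_right (by linarith) (integral_nonneg fun x => ?_)))
    · exact mul_nonneg (add_nonneg (mul_nonneg (by positivity)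
        (Finset.sum_nonneg fun i _ => normSq_nonneg _)) (normSq_nonneg _)) (Real.exp_pos _).le
    · exact mul_nonneg (add_nonneg (mul_nonneg (one_div_nonneg.2 (hmu x).le) (normSq_nonneg _))
        (mul_nonneg (hmu x).le (sq_nonneg _))) (Real.exp_pos _).le
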